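/- **Setting.** Let $p\ge 3$, let $T\subset\mathbb V=\mathbb R^2$ be a nondegenerate closed triangle, $W$ a point in its interior, and $\mathcal R$ the Clough–Tocher split of $T$ into the three triangles obtained by joining $W$ to the vertices. $\mathrm P^q$ denotes polynomials of degree at most $q$. For $k$-forms on $T$, $C^0_{\mathrm d}\Lambda^k(T)$ is the space of continuous $k$-forms $u$ on $T$ whose distributional exterior derivative $\mathrm du$ is continuous on $T$ (so $C^0_{\mathrm d}\Lambda^0=C^1$). On a subcell $c$ of $T$ (vertex, edge, or $T$ itself), a pair $(v_0,v_1)\in C^0(c)\otimes\mathrm{Alt}^k(\mathbb V)\oplus C^0(c)\otimes \mathrm{Alt}^{k+1}(\mathbb V)$ is *admissible* if the pullbacks (restrictions to vectors tangent to $c$) satisfy $\mathrm d\,\mathrm{pull}_c v_0=\mathrm{pull}_c v_1$ in the sense of distributions. **The system $A$.** * On $T$: $A^0(T)=C^1\mathrm P^p\Lambda^0(\mathcal R)$, $A^1(T)=C^0_{\mathrm d}\mathrm P^{p-1}\Lambda^1(\mathcal R)$, $A^2(T)=C^0\mathrm P^{p-2}\Lambda^2(\mathcal R)$: the forms that are piecewise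 polynomial with respect to $\mathcal R$, of degree $p$, $p-1$, $p-2$ respectively, and belong to $C^1$, $C^0_{\mathrm d}\Lambda^1(T)$, $C^0$ respectively. A form $u$ is identified with the pair $(u,\mathrm du)$. (This is the complex of regularity $(2,1+,1)$.) * On an edge $E$: $A^k(E)$ is the space of admissible pairs in $\mathrm P^{p-k}(E)\otimes\mathrm{Alt}^k(\mathbb V)\oplus\mathrm P^{p-k-1}(E)\otimes\mathrm{Alt}^{k+1}(\mathbb V)$, for $k=0,1,2$. * At a vertex $V$: $A^k(V)=\mathrm{Alt}^k(\mathbb V)\oplus\mathrm{Alt}^{k+1}(\mathbb V)$, for $k=0,1,2$. * $A^k=0$ for all other $k$. The differential is $(v_0,v_1)\mapsto(v_1,0)$. The restriction to a subcell is the double-trace $(v_0,v_1)\mapsto(v_0|_{c'},v_1|_{c'})$, all values in $\mathrm{Alt}^\bullet(\mathbb V)$ being kept. The constant $a$ is included as $(a,0)$. The evaluation on a $k$-dimensional cell $c$ is $(v_0,v_1)\mapsto\int_c \mathrm{pull}_c v_0$ (the value at $c$ if $k=0$), cells being oriented by an ordering of the vertices of $T$. For a cell $c$, $A^k(\partial c)$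 is the space of families $(u_{c'})$ with $u_{c'}\in A^k(c')$, indexed by the strict subcells $c'$ of $c$ and stable under restriction; $A^k_0(c)$ is the kernel of the restriction $A^k(c)\to A^k(\partial c)$. **Theorem.** 1. $A$ admits extensions from $\partial T$ to $T$: for every $k$ the restriction $A^k(T)\to A^k(\partial T)$ is onto. 2. $A$ is a compatible finite element system on the complex of all subcells of $T$. That is: * the spaces are stable under the differentials, the restrictions and the inclusion of constants; $\mathrm d\circ\mathrm d=0$; the restrictions are functorial and commute with the differentials; constants are mapped to $0$ by the differential and to constants by the restrictions; and Stokes' formula holds, i.e. for $u\in A^{k-1}(c)$, $\dim c=k$, the evaluation of $\mathrm du$ on $c$ is the sum over the $(k-1)$-dimensional subcells $c'$ of $c$, weighted with relative orientations, of the evaluations of the restrictions of $u$ to $c'$; * for every cell $c$ and every $k$ the restriction $A^k(c)\to A^k(\partial c)$ is onto; * for every cell $c$ the sequence $0\to\mathbb R\to A^0(c)\to A^1(c)\to A^2(c)\to 0$ is exact. 3. $A$ has harmonic commuting interpolators. The differential $(u,\mathrm du)\mapsto(\mathrm du,0)$ maps $C^0_{\mathrm d}\Lambda^k(T)$ to $C^0_{\mathrm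 d}\Lambda^{k+1}(T)$. For each cell $c$ and each $k$ let $\langle\cdot|\cdot\rangle$ be any scalar product on the space of double-traces on $c$ of elements of $C^0_{\mathrm d}\Lambda^k(T)$. Define spaces of linear forms $$\mathcal F^k(c)=\{\langle\cdot|v\rangle: v\in A^k_0(c),\ \mathrm dv=0\}+\{\langle\mathrm d\,\cdot|v\rangle: v\in\mathrm dA^k_0(c)\}\quad\text{if } k\ne\dim c,$$ $$\mathcal F^k(c)=\{\langle\cdot|v\rangle: v\in \mathrm dA^{k-1}_0(c)\}+\mathbb R\textstyle\int_c\cdot+\{\langle\mathrm d\,\cdot|v\rangle: v\in\mathrm dA^k_0(c)\}\quad\text{if } k=\dim c$$ (with $\mathrm dA_0^{-1}(c)=0$). Then these degrees of freedom are unisolvent: for each $k$ the canonical map $A^k(T)\to\prod_c\mathcal F^k(c)^*$, with the product over all subcells $c$ of $T$, is bijective. Moreover there are unique linear maps $I^k:C^0_{\mathrm d}\Lambda^k(T)\to A^k(T)$ such that the double-traces on $c$ of $I^ku$ and of $u$ take the same value under every $l\in\mathcal F^k(c)$, for all $c$, $k$ and $u$; and these maps satisfy $\mathrm d\,I^ku=I^{k+1}\mathrm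 du$. -/

import Mathlib

open scoped ContDiff

/-! ### Finite element systems -/

/-- The data of a finite element system on a cellular complex with set of cells `C`
(`c' ≤ c` means that `c'` is a subcell of `c`).  The space `A^k(c)` is the submodule `A c k` of an
ambient real vector space `M c k`, on which the operators are defined; the axioms relating these
data are collected in `FESData.IsFES`. -/
structure FESData (C : Type) [PartialOrder C] (M : C → ℕ → Type)
    [∀ c k, AddCommGroup (M c k)] [∀ c k, Module ℝ (M c k)] where
  /-- the dimension of a cell -/
  dim : C → ℕ
  /-- the relative orientation of two cells -/
  orient : C → C → ℤ
  /-- the spaces `A^k(c)` -/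
  A : ∀ (c : C) (k : ℕ), Submodule ℝ (M c k)
  /-- the differentials -/
  d : ∀ (c : C) (k : ℕ), M c k →ₗ[ℝ] M c (k + 1)
  /-- the restrictions to subcells -/
  r : ∀ {c' c : C}, c' ≤ c → ∀ k : ℕ, M c k →ₗ[ℝ] M c' k
  /-- the inclusions of constants -/
  const : ∀ c : C, ℝ →ₗ[ℝ] M c 0
  /-- the evaluation maps on `k`-dimensional cells -/
  ev : ∀ (c : C) (k : ℕ), dim c = k → M c k →ₗ[ℝ] ℝ

section Abstract

variable {C : Type} [PartialOrder C] {M : C → ℕ → Type}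
  [∀ c k, AddCommGroup (M c k)] [∀ c k, Module ℝ (M c k)]

open scoped Classical in
/-- The axioms of a finite element system; the last one is the analogue of Stokes' theorem. -/
structure FESData.IsFES [Fintype C] (S : FESData C M) : Prop where
  d_mem : ∀ c k, ∀ u ∈ S.A c k, S.d c k u ∈ S.A c (k + 1)
  d_d : ∀ c k, ∀ u ∈ S.A c k, S.d c (k + 1) (S.d c k u) = 0
  r_mem : ∀ {c' c : C} (h : c' ≤ c) k, ∀ u ∈ S.A c k, S.r h k u ∈ S.A c' k
  r_d : ∀ {c' c : C} (h : c' ≤ c) k, ∀ u ∈ S.A c k,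
    S.r h (k + 1) (S.d c k u) = S.d c' k (S.r h k u)
  r_refl : ∀ (c : C) k, ∀ u ∈ S.A c k, S.r (le_refl c) k u = u
  r_r : ∀ {c'' c' c : C} (h' : c'' ≤ c') (h : c' ≤ c) k, ∀ u ∈ S.A c k,
    S.r (h'.trans h) k u = S.r h' k (S.r h k u)
  const_mem : ∀ c a, S.const c a ∈ S.A c 0
  d_const : ∀ c a, S.d c 0 (S.const c a) = 0
  r_const : ∀ {c' c : C} (h : c' ≤ c) a, S.r h 0 (S.const c a) = S.const c' a
  stokes : ∀ c k (h : S.dim c = k + 1), ∀ u ∈ S.A c k,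
    S.ev c (k + 1) h (S.d c k u) =
      ∑ c' : {c' : C // c' < c ∧ S.dim c' = k},
        (S.orient c c' : ℝ) * S.ev c' k c'.2.2 (S.r c'.2.1.le k u)

/-- `A^k(∂c)`: families of elements of the spaces `A^k(c')`, for the strict subcells `c'` of `c`,
which are stable under restriction. -/
def FESData.IsBoundaryFamily (S : FESData C M) (c : C) (k : ℕ)
    (f : ∀ c' : C, c' < c → M c' k) : Prop :=
  (∀ c' (h : c' < c), f c' h ∈ S.A c' k) ∧
  ∀ c'' c' (h' : c'' ≤ c') (h : c' < c), f c'' (h'.trans_lt h) = S.r h' k (f c' h)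

/-- `A` admits extensions on `c`: the restriction `A^k(c) → A^k(∂c)` is onto, for each `k`. -/
def FESData.AdmitsExtensionsOn (S : FESData C M) (c : C) : Prop :=
  ∀ k (f : ∀ c' : C, c' < c → M c' k), S.IsBoundaryFamily c k f →
    ∃ u ∈ S.A c k, ∀ c' (h : c' < c), S.r h.le k u = f c' h

/-- Exactness of `0 → ℝ → A⁰(c) → A¹(c) → ⋯`
(the converse inclusions being part of the axioms of a finite element system). -/
def FESData.IsExactOn (S : FESData C M) (c : C) : Prop :=
  Function.Injective (S.const c) ∧
  (∀ u ∈ S.A c 0, S.d c 0 u = 0 → ∃ a, S.const c a = u) ∧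
  ∀ k, ∀ u ∈ S.A c (k + 1), S.d c (k + 1) u = 0 → ∃ w ∈ S.A c k, S.d c k w = u

/-- A compatible finite element system: it admits extensions and is exact, on each cell. -/
structure FESData.IsCompatible [Fintype C] (S : FESData C M) : Prop where
  isFES : S.IsFES
  extensions : ∀ c, S.AdmitsExtensionsOn c
  exact : ∀ c, S.IsExactOn c

/-- `A₀^k(c)`: the elements of `A^k(c)` whose restrictions to all strict subcells are zero. -/
def FESData.A₀ (S : FESData C M) (c : C) (k : ℕ) : Submodule ℝ (M c k) :=
  S.A c k ⊓ ⨅ (c' : C) (h : c' < c), LinearMap.ker (S.r h.le k)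

/-- `d A₀^{k-1}(c)`, which is zero for `k = 0`. -/
def FESData.dA₀ (S : FESData C M) (c : C) : ∀ k : ℕ, Submodule ℝ (M c k)
  | 0 => ⊥
  | k + 1 => (S.A₀ c k).map (S.d c k)

open scoped Classical in
/-- The harmonic degrees of freedom `F^k(c)`, relative to bilinear forms `B`.  They are
spanned by `⟨d · | v⟩` with `v ∈ d A₀^k(c)`, together with
* for `k ≠ dim c`, the forms `⟨ · | v⟩` with `v ∈ A₀^k(c)`, `d v = 0`;
* for `k = dim c`, the forms `⟨ · | v⟩` with `v ∈ d A₀^{k-1}(c)` and the evaluation. -/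
noncomputable def FESData.harmonicDoF (S : FESData C M)
    (B : ∀ c k, M c k →ₗ[ℝ] M c k →ₗ[ℝ] ℝ) (c : C) (k : ℕ) :
    Submodule ℝ (Module.Dual ℝ (M c k)) :=
  (S.dA₀ c (k + 1)).map (((S.d c k).lcomp ℝ ℝ) ∘ₗ (B c (k + 1)).flip) ⊔
  if h : S.dim c = k then
    (S.dA₀ c k).map (B c k).flip ⊔ Submodule.span ℝ {S.ev c k h}
  else
    (S.A₀ c k ⊓ LinearMap.ker (S.d c k)).map (B c k).flip

end Abstract

/-! ### The triangle, its cells and differential forms on them -/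

/-- The plane `𝕍 = ℝ²`. -/
abbrev Plane : Type := EuclideanSpace ℝ (Fin 2)

/-- `Alt^k(𝕍)`. -/
abbrev AltForm (k : ℕ) : Type := Plane [⋀^Fin k]→L[ℝ] ℝ

/-- The cells of a triangle: the nonempty sets of vertices, ordered by inclusion. -/
abbrev TriCell : Type := {s : Finset (Fin 3) // s.Nonempty}

/-- The triangle itself, as a cell. -/
def triTop : TriCell := ⟨Finset.univ, Finset.univ_nonempty⟩

lemma TriCell.le_triTop (c : TriCell) : c ≤ triTop := Finset.subset_univ c.1

/-- Relative orientation, each cell being oriented by the increasing order of its vertices: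
`(-1)^i` if `c'` is obtained from `c` by removing its `i`-th vertex (counted from `0`),
and `0` otherwise. -/
def TriCell.orient (c c' : TriCell) : ℤ :=
  ∑ j ∈ c.1.filter (fun j => c'.1 = c.1.erase j), (-1) ^ (c.1.filter (fun i => i < j)).card

/-- The closed cell with vertices `v i`, `i ∈ c`. -/
def cellSet (v : Fin 3 → Plane) (c : TriCell) : Set Plane := convexHull ℝ (v '' (c.1 : Set (Fin 3)))

lemma cellSet_mono (v : Fin 3 → Plane) {c' c : TriCell} (h : c' ≤ c) :
    cellSet v c' ⊆ cellSet v c :=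
  convexHull_mono (Set.image_mono (Finset.coe_subset.2 h))

/-- The pairs in `C⁰(c) ⊗ Alt^k(𝕍) ⊕ C⁰(c) ⊗ Alt^{k+1}(𝕍)`. -/
abbrev FormPair (v : Fin 3 → Plane) (c : TriCell) (k : ℕ) : Type :=
  C(cellSet v c, AltForm k) × C(cellSet v c, AltForm (k + 1))

noncomputable instance instAddCommGroupFormPair (v : Fin 3 → Plane) (c : TriCell) (k : ℕ) :
    AddCommGroup (FormPair v c k) := Prod.instAddCommGroup

noncomputable instance instModuleFormPair (v : Fin 3 → Plane) (c : TriCell) (k : ℕ) :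
    Module ℝ (FormPair v c k) := Prod.instModule

/-- Extension by zero of a form given on `K` (it is only evaluated on `K`). -/
noncomputable def extZero {K : Set Plane} {k : ℕ} (f : C(K, AltForm k)) : Plane → AltForm k :=
  Function.extend Subtype.val f 0

/-- The reference simplex `{t ∈ ℝ^m : t_i ≥ 0, ∑ t_i ≤ 1}`. -/
def refSimplex (m : ℕ) : Set (Fin m → ℝ) := {t | (∀ i, 0 ≤ t i) ∧ ∑ i, t i ≤ 1}

/-- The `i`-th vertex of an `m`-dimensional cell. -/
def cellVertex (v : Fin 3 → Plane) (c : TriCell) {m : ℕ} (h : c.1.card = m + 1)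
    (i : Fin (m + 1)) : Plane := v (c.1.orderEmbOfFin h i)

/-- The linear part `η ↦ ∑ η_i (x_{i+1} - x_0)` of the affine parametrization of a cell with
ordered vertices `x_0, …, x_m`; it identifies `ℝ^m` with the space of vectors tangent to the
cell. -/
def cellTangent (v : Fin 3 → Plane) (c : TriCell) {m : ℕ} (h : c.1.card = m + 1)
    (η : Fin m → ℝ) : Plane :=
  ∑ i, η i • (cellVertex v c h i.succ - cellVertex v c h 0)

/-- The affine parametrization of a cell by the reference simplex. -/
def cellParam (v : Fin 3 → Plane) (c : TriCell) {m : ℕ} (h : c.1.card = m + 1)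
    (t : Fin m → ℝ) : Plane := cellVertex v c h 0 + cellTangent v c h t

/-- The integral over an oriented `m`-dimensional cell of (the pullback to the cell of) an
`m`-form. -/
noncomputable def cellIntegral (v : Fin 3 → Plane) (c : TriCell) {m : ℕ} (h : c.1.card = m + 1)
    (u : C(cellSet v c, AltForm m)) : ℝ :=
  ∫ t in refSimplex m, extZero u (cellParam v c h t)
    (fun i => cellVertex v c h i.succ - cellVertex v c h 0)

/-- Admissibility of a pair `(z₀, z₁)` of a `k`-form and a `(k+1)`-form on the cell `c`:
`d (pull_c z₀) = pull_c z₁` in the sense of distributions in the interior of the cell, i.e.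
`∫ φ z₁(η_0,…,η_k) = - ∑ᵢ (-1)ⁱ ∫ (∂_{η_i} φ) z₀(η_0,…,η̂_i,…,η_k)`
for all test functions `φ` and all tangent vectors `η_0,…,η_k`.
For `c` the triangle itself this says that `z₀ ∈ C⁰_dΛ^k` and `d z₀ = z₁`. -/
def IsAdmissible (v : Fin 3 → Plane) (c : TriCell) (k : ℕ) (z : FormPair v c k) : Prop :=
  ∀ (m : ℕ) (h : c.1.card = m + 1) (φ : (Fin m → ℝ) → ℝ),
    ContDiff ℝ ∞ φ → HasCompactSupport φ → tsupport φ ⊆ interior (refSimplex m) →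
    ∀ η : Fin (k + 1) → (Fin m → ℝ),
      ∫ t in refSimplex m,
          φ t * extZero z.2 (cellParam v c h t) (fun j => cellTangent v c h (η j)) =
        - ∑ i : Fin (k + 1), (-1 : ℝ) ^ (i : ℕ) * ∫ t in refSimplex m,
            fderiv ℝ φ t (η i) * extZero z.1 (cellParam v c h t)
              (fun j => cellTangent v c h (η (i.succAbove j)))

/-! ### Linearity of integrals -/

lemma extZero_apply {K : Set Plane} {k : ℕ} (f : C(K, AltForm k)) {x : Plane} (hx : x ∈ K) :
    extZero f x = f ⟨x, hx⟩ :=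
  Subtype.val_injective.extend_apply f 0 (⟨x, hx⟩ : K)

lemma extZero_add {K : Set Plane} {k : ℕ} (f g : C(K, AltForm k)) (x : Plane) :
    extZero (f + g) x = extZero f x + extZero g x := by
  by_cases hx : x ∈ K
  · simp [extZero_apply _ hx]
  · have : ¬ ∃ a : K, (a : Plane) = x := by rintro ⟨a, rfl⟩; exact hx a.2
    simp [extZero, Function.extend_apply' _ _ _ this]

lemma extZero_smul {K : Set Plane} {k : ℕ} (a : ℝ) (f : C(K, AltForm k)) (x : Plane) :
    extZero (a • f) x = a • extZero f x := by
  by_cases hx : x ∈ K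
  · simp [extZero_apply _ hx]
  · have : ¬ ∃ a : K, (a : Plane) = x := by rintro ⟨a, rfl⟩; exact hx a.2
    simp [extZero, Function.extend_apply' _ _ _ this]

lemma extZero_zero {K : Set Plane} {k : ℕ} (x : Plane) :
    extZero (0 : C(K, AltForm k)) x = 0 := by
  rw [← zero_smul ℝ (0 : C(K, AltForm k)), extZero_smul, zero_smul]

lemma isCompact_refSimplex (m : ℕ) : IsCompact (refSimplex m) := by
  have hc : IsClosed (refSimplex m) := by
    have : refSimplex m = (⋂ i, {t : Fin m → ℝ | 0 ≤ t i}) ∩ {t | ∑ i, t i ≤ 1} := by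
      ext t; simp [refSimplex]
    rw [this]
    refine (isClosed_iInter fun i => isClosed_le continuous_const (continuous_apply i)).inter ?_
    exact isClosed_le (by fun_prop) continuous_const
  refine (isCompact_Icc (a := (0 : Fin m → ℝ)) (b := 1)).of_isClosed_subset hc ?_
  rintro t ⟨h0, h1⟩
  exact ⟨fun i => h0 i, fun i =>
    (Finset.single_le_sum (fun j _ => h0 j) (Finset.mem_univ i)).trans h1⟩

lemma cellVertex_mem (v : Fin 3 → Plane) (c : TriCell) {m : ℕ} (h : c.1.card = m + 1)
    (i : Fin (m + 1)) : cellVertex v c h i ∈ cellSet v c :=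
  subset_convexHull ℝ _ ⟨_, Finset.orderEmbOfFin_mem c.1 h i, rfl⟩

lemma cellParam_mem (v : Fin 3 → Plane) (c : TriCell) {m : ℕ} (h : c.1.card = m + 1)
    {t : Fin m → ℝ} (ht : t ∈ refSimplex m) : cellParam v c h t ∈ cellSet v c := by
  have key : cellParam v c h t = ∑ i : Fin (m + 1),
      (Fin.cons (1 - ∑ i, t i) t : Fin (m + 1) → ℝ) i • cellVertex v c h i := by
    rw [Fin.sum_univ_succ]
    simp only [Fin.cons_zero, Fin.cons_succ, cellParam, cellTangent, smul_sub,
      Finset.sum_sub_distrib, sub_smul, one_smul, ← Finset.sum_smul]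
    abel
  rw [key]
  refine (convex_convexHull ℝ _).sum_mem (fun i _ => ?_) ?_ (fun i _ => cellVertex_mem v c h i)
  · refine Fin.cases ?_ (fun j => ?_) i
    · simpa using ht.2
    · simpa using ht.1 j
  · rw [Fin.sum_univ_succ]; simp

lemma continuous_cellParam (v : Fin 3 → Plane) (c : TriCell) {m : ℕ} (h : c.1.card = m + 1) :
    Continuous (cellParam v c h) := by
  unfold cellParam cellTangent
  fun_prop

lemma integrableOn_cell (v : Fin 3 → Plane) (c : TriCell) {m k : ℕ} (h : c.1.card = m + 1)
    (f : C(cellSet v c, AltForm k)) {g : (Fin m → ℝ) → ℝ} (hg : Continuous g)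
    (ξ : Fin k → Plane) :
    MeasureTheory.IntegrableOn (fun t => g t * extZero f (cellParam v c h t) ξ)
      (refSimplex m) := by
  refine ContinuousOn.integrableOn_compact (isCompact_refSimplex m) (hg.continuousOn.mul ?_)
  rw [continuousOn_iff_continuous_domRestrict]
  have hE : Set.domRestrict (refSimplex m) (fun t => extZero f (cellParam v c h t) ξ) =
      fun t : refSimplex m => f ⟨cellParam v c h t, cellParam_mem v c h t.2⟩ ξ := by
    ext t
    simp [extZero_apply f (cellParam_mem v c h t.2)]
  rw [hE]
  have h1 : Continuous fun t : refSimplex m =>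
      f ⟨cellParam v c h t, cellParam_mem v c h t.2⟩ :=
    f.continuous.comp (((continuous_cellParam v c h).comp continuous_subtype_val).subtype_mk _)
  exact (ContinuousAlternatingMap.apply ℝ Plane ℝ ξ).continuous.comp h1

lemma integral_cell_add (v : Fin 3 → Plane) (c : TriCell) {m k : ℕ} (h : c.1.card = m + 1)
    (f f' : C(cellSet v c, AltForm k)) {g : (Fin m → ℝ) → ℝ} (hg : Continuous g)
    (ξ : Fin k → Plane) :
    ∫ t in refSimplex m, g t * extZero (f + f') (cellParam v c h t) ξ =
      (∫ t in refSimplex m, g t * extZero f (cellParam v c h t) ξ) +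
        ∫ t in refSimplex m, g t * extZero f' (cellParam v c h t) ξ := by
  rw [← MeasureTheory.integral_add (integrableOn_cell v c h f hg ξ)
    (integrableOn_cell v c h f' hg ξ)]
  simp [extZero_add, mul_add]

lemma integral_cell_smul (v : Fin 3 → Plane) (c : TriCell) {m k : ℕ} (h : c.1.card = m + 1)
    (a : ℝ) (f : C(cellSet v c, AltForm k)) (g : (Fin m → ℝ) → ℝ) (ξ : Fin k → Plane) :
    ∫ t in refSimplex m, g t * extZero (a • f) (cellParam v c h t) ξ =
      a * ∫ t in refSimplex m, g t * extZero f (cellParam v c h t) ξ := by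
  rw [← MeasureTheory.integral_const_mul]
  simp [extZero_smul, mul_left_comm]

/-- The vector space of admissible pairs on a cell. -/
def admissiblePairs (v : Fin 3 → Plane) (c : TriCell) (k : ℕ) :
    Submodule ℝ (FormPair v c k) where
  carrier := {z | IsAdmissible v c k z}
  zero_mem' := by
    intro m h φ _ _ _ η
    simp [extZero_zero]
  add_mem' := by
    intro y z hy hz m h φ h1 h2 h3 η
    have hd : ∀ w, Continuous fun t => fderiv ℝ φ t w := fun w =>
      (h1.continuous_fderiv (by simp)).clm_apply continuous_const
    have e1 := hy m h φ h1 h2 h3 η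
    have e2 := hz m h φ h1 h2 h3 η
    simp only [Prod.fst_add, Prod.snd_add]
    rw [integral_cell_add v c h _ _ h1.continuous, e1, e2, ← neg_add, ← Finset.sum_add_distrib]
    congr 1
    refine Finset.sum_congr rfl fun i _ => ?_
    rw [integral_cell_add v c h _ _ (hd (η i)), mul_add]
  smul_mem' := by
    intro a z hz m h φ h1 h2 h3 η
    have e1 := hz m h φ h1 h2 h3 η
    simp only [Prod.smul_fst, Prod.smul_snd]
    rw [integral_cell_smul, e1, mul_neg, Finset.mul_sum]
    congr 1
    refine Finset.sum_congr rfl fun i _ => ?_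
    rw [integral_cell_smul, mul_left_comm]

/-! ### The composite finite element system -/

/-- The form `u` is, on `K`, polynomial of degree at most `q`: all its components are. -/
def IsPolyOn (q : ℕ) {k : ℕ} (u : Plane → AltForm k) (K : Set Plane) : Prop :=
  ∀ ξ : Fin k → Plane, ∃ P : MvPolynomial (Fin 2) ℝ, P.totalDegree ≤ q ∧
    ∀ x ∈ K, u x ξ = MvPolynomial.eval (fun i => x i) P

/-- The pieces on which elements are polynomial: for the triangle, the three subtriangles of the
Clough-Tocher split with inpoint `W` (one for each omitted vertex); any other cell is its own and
only piece. -/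
def cellPieces (v : Fin 3 → Plane) (W : Plane) (c : TriCell) : Set (Set Plane) :=
  if c = triTop then
    Set.range fun i : Fin 3 => convexHull ℝ (insert W (v '' {j | j ≠ i}))
  else {cellSet v c}

/-- Continuous forms on a cell, piecewise polynomial of degree at most `q`. -/
def polyForms (v : Fin 3 → Plane) (W : Plane) (c : TriCell) (q k : ℕ) :
    Submodule ℝ C(cellSet v c, AltForm k) where
  carrier := {u | ∀ K ∈ cellPieces v W c, IsPolyOn q (extZero u) K}
  zero_mem' := by
    intro K _ ξ
    exact ⟨0, by simp, fun x _ => by simp [extZero_zero]⟩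
  add_mem' := by
    intro f g hf hg K hK ξ
    obtain ⟨P, hP, hP'⟩ := hf K hK ξ
    obtain ⟨Q, hQ, hQ'⟩ := hg K hK ξ
    refine ⟨P + Q, (MvPolynomial.totalDegree_add P Q).trans (max_le hP hQ), fun x hx => ?_⟩
    simp [extZero_add, hP' x hx, hQ' x hx]
  smul_mem' := by
    intro a f hf K hK ξ
    obtain ⟨P, hP, hP'⟩ := hf K hK ξ
    refine ⟨a • P, (MvPolynomial.totalDegree_smul_le a P).trans hP, fun x hx => ?_⟩
    simp [extZero_smul, hP' x hx, MvPolynomial.smul_eval]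

/-- The space `A^k(c)`: admissible pairs `(z₀, z₁)` with `z₀` a (piecewise) polynomial `k`-form of
degree `p - k` and `z₁` a (piecewise) polynomial `(k+1)`-form of degree `p - k - 1`.
On the triangle the pair is `(u, du)`, so that the space is (identified through its first
component with) `C⁰_d P^{p-k} Λ^k(R)`; in particular it is `C¹P^p Λ⁰(R)` for `k = 0` and
`C⁰P^{p-2} Λ²(R)` for `k = 2`.  All spaces are zero for `k ≥ 3`, since `Alt^k(𝕍) = 0`. -/
noncomputable def ctSpace (p : ℕ) (v : Fin 3 → Plane) (W : Plane) (c : TriCell) (k : ℕ) :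
    Submodule ℝ (FormPair v c k) :=
  admissiblePairs v c k ⊓ (polyForms v W c (p - k) k).prod (polyForms v W c (p - (k + 1)) (k + 1))

/-- Restriction of forms to a subcell (as a trace: the values are kept in `Alt^k(𝕍)`). -/
noncomputable def traceForm (v : Fin 3 → Plane) {c' c : TriCell} (h : c' ≤ c) (k : ℕ) :
    C(cellSet v c, AltForm k) →ₗ[ℝ] C(cellSet v c', AltForm k) where
  toFun u := u.comp (ContinuousMap.inclusion (cellSet_mono v h))
  map_add' _ _ := rfl
  map_smul' _ _ := rfl

/-- The Clough-Tocher composite finite element system on the triangle with vertices `v` and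
inpoint `W`, with double-traces as restrictions, and differential `(z₀, z₁) ↦ (z₁, 0)`. -/
noncomputable def ctFES (p : ℕ) (v : Fin 3 → Plane) (W : Plane) :
    FESData TriCell (FormPair v) where
  dim c := c.1.card - 1
  orient := TriCell.orient
  A := ctSpace p v W
  d c k := (LinearMap.snd ℝ _ _).prod 0
  r h k := (traceForm v h k).prodMap (traceForm v h (k + 1))
  const c := LinearMap.prod
    { toFun := fun a =>
        ContinuousMap.const _ (ContinuousAlternatingMap.constOfIsEmpty ℝ Plane (Fin 0) a)
      map_add' := fun a b => by ext x; simp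
      map_smul' := fun a b => by ext x; simp } 0
  ev c k h :=
    { toFun := fun z => cellIntegral v c
        (show c.1.card = k + 1 by have := c.2.card_pos; omega) z.1
      map_add' := fun y z => by
        have := integral_cell_add v c (show c.1.card = k + 1 by have := c.2.card_pos; omega)
          y.1 z.1 (continuous_const (y := (1 : ℝ)))
        simpa [cellIntegral] using this _
      map_smul' := fun a z => by
        have := integral_cell_smul v c (show c.1.card = k + 1 by have := c.2.card_pos; omega)
          a z.1 (fun _ => (1 : ℝ))
        simpa [cellIntegral] using this _ }

/-- The space `C⁰_d Λ^k(T)`, each of its elements `u` being recorded as the pair `(u, du)`. -/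
abbrev CdForms (v : Fin 3 → Plane) (k : ℕ) : Submodule ℝ (FormPair v triTop k) :=
  admissiblePairs v triTop k

/-- A choice of scalar product `⟨·|·⟩` on each space of double-traces of `C⁰_d Λ^k(T)` on a cell
`c`, given as a bilinear form on the space of all pairs, of which only the values on double-traces
matter. -/
structure IsTraceScalarProduct (p : ℕ) (v : Fin 3 → Plane) (W : Plane)
    (B : ∀ c k, FormPair v c k →ₗ[ℝ] FormPair v c k →ₗ[ℝ] ℝ) : Prop where
  symm : ∀ c k, ∀ x ∈ (CdForms v k).map ((ctFES p v W).r c.le_triTop k),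
    ∀ y ∈ (CdForms v k).map ((ctFES p v W).r c.le_triTop k), B c k x y = B c k y x
  pos : ∀ c k, ∀ x ∈ (CdForms v k).map ((ctFES p v W).r c.le_triTop k),
    x ≠ 0 → 0 < B c k x x

/-- Unisolvence of the harmonic degrees of freedom: the canonical map
`A^k(T) → ∏_c F^k(c)^*` is bijective, for each `k`. -/
def HarmonicUnisolvent (p : ℕ) (v : Fin 3 → Plane) (W : Plane)
    (B : ∀ c k, FormPair v c k →ₗ[ℝ] FormPair v c k →ₗ[ℝ] ℝ) : Prop :=
  ∀ k, Function.Bijective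
    fun (u : (ctFES p v W).A triTop k) (c : TriCell) =>
      (LinearMap.applyₗ ((ctFES p v W).r c.le_triTop k (u : FormPair v triTop k)) ∘ₗ
        ((ctFES p v W).harmonicDoF B c k).subtype :
          Module.Dual ℝ ((ctFES p v W).harmonicDoF B c k))

/-- `I` is the interpolator `C⁰_d Λ^•(T) → A^•(T)` associated with the harmonic degrees of
freedom. -/
def IsHarmonicInterpolator (p : ℕ) (v : Fin 3 → Plane) (W : Plane)
    (B : ∀ c k, FormPair v c k →ₗ[ℝ] FormPair v c k →ₗ[ℝ] ℝ)
    (I : ∀ k, CdForms v k →ₗ[ℝ] (ctFES p v W).A triTop k) : Prop :=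
  ∀ k (u : CdForms v k) (c : TriCell), ∀ l ∈ (ctFES p v W).harmonicDoF B c k,
    l ((ctFES p v W).r c.le_triTop k (I k u : FormPair v triTop k)) =
      l ((ctFES p v W).r c.le_triTop k (u : FormPair v triTop k))

/-! ### Abstract finite element systems -/

namespace FESData

variable {C : Type} [PartialOrder C] {M : C → ℕ → Type}
  [∀ c k, AddCommGroup (M c k)] [∀ c k, Module ℝ (M c k)]

/-! The proof splits into an algebraic half, valid for any finite element system, and an analytic
half about the Clough–Tocher triangle.

Algebra. Call the elements of `A₀` bubbles. Suppose that extensions exist and that the bubbles on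
each cell form exact sequences (`HasExactBubbles`), with the evaluation closing the sequence in
degree `dim c`. On bubbles the harmonic degrees of freedom are injective: testing with `v = d u`
gives `d u = 0`, then exactness makes `u` itself an admissible test element, so `u = 0` by
positivity. Rank-nullity bounds the number of degrees of freedom by the dimension of the bubbles,
hence they are dual to the bubbles (`exists_A₀_of_dual`). Unisolvence on a cell follows by induction
on the cells: extend what is already determined on the boundary and correct by a bubble
(`existsUnique_of_dual`). Positivity is only assumed on double-traces, and extension from any cell
to the triangle (`exists_extension`) shows that all elements of the system are double-traces.
Commutation holds because each degree of freedom of `d u` is zero, or a degree of freedom of `u`, or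
an evaluation that Stokes' formula turns into evaluations of `u` on faces (`harmonicDoF_d_eq_zero`).

Analysis. For piecewise smooth forms, distributional admissibility means that the second component
is the exterior derivative of the first on each piece (`isAdmissible_iff_of_pieces`). The
interpolators act on general continuous forms, so traces and Stokes' formula are proved for
arbitrary admissible pairs, with test functions that concentrate on the boundary
(`isAdmissible_trace_edge`, `stokes_edge`, `stokes_triangle`). Exactness on the triangle uses
homotopy operators centred at `W`: because `W` lies in all three pieces and the pieces are
star-shaped about it, potentials built piece by piece agree on the interfaces.

Extension to the triangle is the finite element core. For functions, a double-trace at a vertex is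
extended by a squared barycentric coordinate times an affine function; on an edge, after the values
are matched, the transversal derivative is adjusted with a piecewise cubic `C¹` bubble whose
gradient lives on that edge only. This is where `p ≥ 3` is needed. For `2`-forms, products of
barycentric coordinates suffice. For `1`-forms nothing is built by hand: extend the differential as
a `2`-form, correct its integral to the required circulation, take a primitive `u₁`; the remaining
boundary data are closed with zero circulation, hence have a potential on the boundary, which
extends to a function `Φ`, and `u₁ + dΦ` is the extension (`exists_extension_one_of_d`). With zero
boundary data, the same construction gives the exactness of the bubbles in degree two. -/

lemma mem_A₀ {S : FESData C M} {c : C} {k : ℕ} {u : M c k} :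
    u ∈ S.A₀ c k ↔ u ∈ S.A c k ∧ ∀ c' (h : c' < c), S.r h.le k u = 0 := by
  simp [A₀, Submodule.mem_iInf]

section HarmonicDoF

variable {S : FESData C M} {B : ∀ c k, M c k →ₗ[ℝ] M c k →ₗ[ℝ] ℝ}

lemma apply_d_mem_harmonicDoF {c : C} {k : ℕ} {v : M c (k + 1)} (hv : v ∈ S.dA₀ c (k + 1)) :
    (B c (k + 1)).flip v ∘ₗ S.d c k ∈ S.harmonicDoF B c k :=
  Submodule.mem_sup_left ⟨v, hv, rfl⟩

lemma flip_mem_harmonicDoF_of_ne {c : C} {k : ℕ} (h : S.dim c ≠ k) {v : M c k}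
    (hv : v ∈ S.A₀ c k) (hv' : S.d c k v = 0) :
    (B c k).flip v ∈ S.harmonicDoF B c k := by
  unfold harmonicDoF
  rw [dif_neg h]
  exact Submodule.mem_sup_right ⟨v, ⟨hv, hv'⟩, rfl⟩

lemma flip_mem_harmonicDoF_of_eq {c : C} {k : ℕ} (h : S.dim c = k) {v : M c k}
    (hv : v ∈ S.dA₀ c k) : (B c k).flip v ∈ S.harmonicDoF B c k := by
  unfold harmonicDoF
  rw [dif_pos h]
  exact Submodule.mem_sup_right (Submodule.mem_sup_left ⟨v, hv, rfl⟩)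

lemma ev_mem_harmonicDoF {c : C} {k : ℕ} (h : S.dim c = k) :
    S.ev c k h ∈ S.harmonicDoF B c k := by
  unfold harmonicDoF
  rw [dif_pos h]
  exact Submodule.mem_sup_right (Submodule.mem_sup_right (Submodule.mem_span_singleton_self _))

/-- To check an identity on harmonic degrees of freedom it suffices to check it on generators. -/
lemma harmonicDoF_apply_eq_zero {c : C} {k : ℕ} {u : M c k}
    (h1 : ∀ v ∈ S.dA₀ c (k + 1), B c (k + 1) (S.d c k u) v = 0)
    (h2 : S.dim c ≠ k → ∀ v ∈ S.A₀ c k, S.d c k v = 0 → B c k u v = 0)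
    (h3 : S.dim c = k → ∀ v ∈ S.dA₀ c k, B c k u v = 0)
    (h4 : ∀ h : S.dim c = k, S.ev c k h u = 0) :
    ∀ l ∈ S.harmonicDoF B c k, l u = 0 := by
  suffices S.harmonicDoF B c k ≤ LinearMap.ker (LinearMap.applyₗ u) from fun l hl => this hl
  unfold harmonicDoF
  refine sup_le ?_ ?_
  · rintro _ ⟨v, hv, rfl⟩
    exact h1 v hv
  · split_ifs with h
    · refine sup_le ?_ ?_
      · rintro _ ⟨v, hv, rfl⟩
        exact h3 h v hv
      · rw [Submodule.span_singleton_le_iff_mem]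
        exact h4 h
    · rintro _ ⟨v, hv, rfl⟩
      exact h2 h v hv.1 hv.2

end HarmonicDoF

/-- A space of linear forms which separates the points of a finite dimensional space, and
whose dimension is not greater, is dual to it. -/
lemma surjective_of_finrank_le {A F : Type*} [AddCommGroup A] [Module ℝ A] [AddCommMonoid F]
    [Module ℝ F] [Module.Finite ℝ A] [Module.Finite ℝ F] (Φ : A →ₗ[ℝ] Module.Dual ℝ F)
    (hle : Module.finrank ℝ F ≤ Module.finrank ℝ A)
    (hinj : ∀ u, (∀ l, Φ u l = 0) → u = 0) : Function.Surjective Φ := by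
  let _ : AddCommGroup F := Module.addCommMonoidToAddCommGroup ℝ
  have hinj : Function.Injective Φ := by
    rw [← LinearMap.ker_eq_bot, LinearMap.ker_eq_bot']
    exact fun u hu => hinj u fun l => by rw [hu, LinearMap.zero_apply]
  refine (LinearMap.injective_iff_surjective_of_finrank_eq_finrank ?_).1 hinj
  refine le_antisymm (LinearMap.finrank_le_finrank_of_injective hinj) ?_
  rwa [Subspace.dual_finrank_eq]

lemma finrank_sup_le_of_le {V : Type*} [AddCommGroup V] [Module ℝ V] (X Y : Submodule ℝ V)
    [Module.Finite ℝ X] [Module.Finite ℝ Y] {a b : ℕ} (hX : Module.finrank ℝ X ≤ a)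
    (hY : Module.finrank ℝ Y ≤ b) :
    Module.Finite ℝ ↥(X ⊔ Y) ∧ Module.finrank ℝ ↥(X ⊔ Y) ≤ a + b :=
  ⟨inferInstance, (Submodule.finrank_add_le_finrank_add_finrank X Y).trans (by omega)⟩

variable [Fintype C]

lemma d_mem_A₀ {S : FESData C M} (hS : S.IsFES) {c : C} {k : ℕ} {u : M c k}
    (hu : u ∈ S.A₀ c k) : S.d c k u ∈ S.A₀ c (k + 1) := by
  rw [mem_A₀] at hu ⊢
  refine ⟨hS.d_mem _ _ _ hu.1, fun c' h => ?_⟩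
  rw [hS.r_d _ _ _ hu.1, hu.2 c' h, map_zero]

lemma dA₀_le {S : FESData C M} (hS : S.IsFES) (c : C) (k : ℕ) :
    S.dA₀ c k ≤ S.A₀ c k ⊓ LinearMap.ker (S.d c k) := by
  cases k with
  | zero => exact bot_le
  | succ k =>
    rintro _ ⟨u, hu, rfl⟩
    exact ⟨d_mem_A₀ hS hu, by simpa using hS.d_d _ _ _ (mem_A₀.1 hu).1⟩

/-- Stokes' formula only sees the traces on faces, which are zero for a bubble. -/
lemma ev_dA₀ {S : FESData C M} (hS : S.IsFES) {c : C} {k : ℕ} (h : S.dim c = k) {u : M c k}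
    (hu : u ∈ S.dA₀ c k) : S.ev c k h u = 0 := by
  cases k with
  | zero => rw [(Submodule.mem_bot ℝ).1 hu, map_zero]
  | succ k =>
    obtain ⟨w, hw, rfl⟩ := hu
    rw [SetLike.mem_coe, mem_A₀] at hw
    rw [hS.stokes c k h w hw.1]
    refine Finset.sum_eq_zero fun c' _ => ?_
    rw [hw.2 _ c'.2.1, map_zero, mul_zero]

/-- Exactness of `A₀^0(c) → ⋯ → A₀^{dim c}(c) → ℝ → 0` and of the part in degrees greater than
`dim c`, the spaces being finite dimensional. -/
structure HasExactBubbles (S : FESData C M) : Prop where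
  finite : ∀ c k, Module.Finite ℝ (S.A₀ c k)
  exact_of_ne : ∀ c k, S.dim c ≠ k → ∀ v ∈ S.A₀ c k, S.d c k v = 0 → v ∈ S.dA₀ c k
  exact_of_eq : ∀ c k (h : S.dim c = k), ∀ v ∈ S.A₀ c k, S.d c k v = 0 → S.ev c k h v = 0 →
    v ∈ S.dA₀ c k
  exists_ev_ne : ∀ c k (h : S.dim c = k), ∃ v ∈ S.A₀ c k, S.d c k v = 0 ∧ S.ev c k h v ≠ 0

section HarmonicDoF

variable {S : FESData C M} {B : ∀ c k, M c k →ₗ[ℝ] M c k →ₗ[ℝ] ℝ}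

variable (hS : S.IsCompatible) (hX : S.HasExactBubbles)
  (hB : ∀ c k, ∀ x ∈ S.A c k, x ≠ 0 → 0 < B c k x x)

include hS hX hB

/-- Testing with `v = d u` forces `d u = 0`. Then `v = u` is allowed too: as a closed bubble when `k
≠ dim c`, and as an element of `dA₀` when `k = dim c`, since the evaluation is among the degrees of
freedom and vanishes. -/
lemma eq_zero_of_harmonicDoF {c : C} {k : ℕ} {u : M c k} (hu : u ∈ S.A₀ c k)
    (h : ∀ l ∈ S.harmonicDoF B c k, l u = 0) : u = 0 := by
  have hd : S.d c k u = 0 := by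
    by_contra hne
    have := h _ (apply_d_mem_harmonicDoF (B := B) (v := S.d c k u) ⟨u, hu, rfl⟩)
    exact (hB c (k + 1) _ (hS.isFES.d_mem _ _ _ (mem_A₀.1 hu).1) hne).ne' this
  by_contra hne
  refine (hB c k u (mem_A₀.1 hu).1 hne).ne' ?_
  by_cases hk : S.dim c = k
  · exact h ((B c k).flip u) (flip_mem_harmonicDoF_of_eq hk
      (hX.exact_of_eq c k hk u hu hd (h _ (ev_mem_harmonicDoF hk))))
  · exact h ((B c k).flip u) (flip_mem_harmonicDoF_of_ne hk hu hd)

omit hB in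
-- Rank-nullity for `d` on bubbles. In degree `dim c` the closed bubbles are replaced by the smaller
-- space `dA₀`, and the dimension lost makes room for the evaluation.
lemma finrank_harmonicDoF_le (c : C) (k : ℕ) :
    Module.Finite ℝ (S.harmonicDoF B c k) ∧
      Module.finrank ℝ (S.harmonicDoF B c k) ≤ Module.finrank ℝ (S.A₀ c k) := by
  have := hX.finite
  have hd : ∀ k, Module.Finite ℝ (S.dA₀ c k) := by
    intro k
    cases k with
    | zero => exact inferInstanceAs (Module.Finite ℝ (⊥ : Submodule ℝ (M c 0)))
    | succ k => exact inferInstanceAs (Module.Finite ℝ ((S.A₀ c k).map (S.d c k)))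
  have hker : Module.Finite ℝ ↥(S.A₀ c k ⊓ LinearMap.ker (S.d c k)) :=
    Submodule.finiteDimensional_of_le inf_le_left
  have key : Module.finrank ℝ (S.dA₀ c (k + 1)) +
      Module.finrank ℝ ↥(S.A₀ c k ⊓ LinearMap.ker (S.d c k)) =
      Module.finrank ℝ (S.A₀ c k) := by
    have h1 := LinearMap.finrank_range_add_finrank_ker ((S.d c k).domRestrict (S.A₀ c k))
    have h2 : LinearMap.range ((S.d c k).domRestrict (S.A₀ c k)) = S.dA₀ c (k + 1) :=
      LinearMap.range_domRestrict _ _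
    have h3 : S.A₀ c k ⊓ LinearMap.ker (S.d c k) =
        (LinearMap.ker ((S.d c k).domRestrict (S.A₀ c k))).map (S.A₀ c k).subtype := by
      ext x
      simp [LinearMap.mem_ker, and_comm]
    rw [h3, Submodule.finrank_map_subtype_eq, ← h2, h1]
  have h1 : Module.finrank ℝ ((S.dA₀ c (k + 1)).map
      (((S.d c k).lcomp ℝ ℝ) ∘ₗ (B c (k + 1)).flip)) ≤ Module.finrank ℝ (S.dA₀ c (k + 1)) :=
    Submodule.finrank_map_le _ _
  rw [← key]
  by_cases h : S.dim c = k
  · have h4 : Module.finrank ℝ ((S.dA₀ c k).map (B c k).flip) ≤ Module.finrank ℝ (S.dA₀ c k) :=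
      Submodule.finrank_map_le _ _
    have h5 : Module.finrank ℝ (Submodule.span ℝ {S.ev c k h}) ≤ 1 := by
      simpa using finrank_span_le_card (R := ℝ) ({S.ev c k h} : Set (Module.Dual ℝ (M c k)))
    obtain ⟨v, hv, hdv, hev⟩ := hX.exists_ev_ne c k h
    -- The inclusion is strict because the evaluation kills `dA₀` but not all closed bubbles.
    have h6 : S.dA₀ c k < S.A₀ c k ⊓ LinearMap.ker (S.d c k) := by
      refine lt_of_le_of_ne (dA₀_le hS.isFES c k) fun heq => hev ?_
      have hmem : v ∈ S.A₀ c k ⊓ LinearMap.ker (S.d c k) := ⟨hv, hdv⟩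
      rw [← heq] at hmem
      exact ev_dA₀ hS.isFES h hmem
    have h7 := Submodule.finrank_lt_finrank_of_lt h6
    have h8 := finrank_sup_le_of_le _ _ h4 h5
    have := h8.1
    unfold harmonicDoF
    rw [dif_pos h]
    exact finrank_sup_le_of_le _ _ h1 (h8.2.trans h7)
  · unfold harmonicDoF
    rw [dif_neg h]
    exact finrank_sup_le_of_le _ _ h1 (Submodule.finrank_map_le _ _)

/-- The degrees of freedom separate bubbles and are not more numerous, so the pairing with bubbles
is perfect. -/
lemma exists_A₀_of_dual {c : C} {k : ℕ} (ψ : Module.Dual ℝ (S.harmonicDoF B c k)) :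
    ∃ u ∈ S.A₀ c k, ∀ l : S.harmonicDoF B c k, (l : Module.Dual ℝ (M c k)) u = ψ l := by
  have := hX.finite c k
  obtain ⟨hfin, hle⟩ := finrank_harmonicDoF_le (B := B) hS hX c k
  obtain ⟨u, hu⟩ := surjective_of_finrank_le
    ((S.harmonicDoF B c k).subtype.flip ∘ₗ (S.A₀ c k).subtype) hle
    (fun u h => Subtype.ext (eq_zero_of_harmonicDoF hS hX hB u.2 fun l hl => h ⟨l, hl⟩)) ψ
  exact ⟨u, u.2, fun l => by rw [← hu]; rfl⟩

/-- By induction all restrictions to strict subcells vanish, so that `u` is a bubble. -/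
lemma eq_zero_of_harmonicDoF_all {c : C} {k : ℕ} {u : M c k} (hu : u ∈ S.A c k)
    (h : ∀ c' (hc : c' ≤ c), ∀ l ∈ S.harmonicDoF B c' k, l (S.r hc k u) = 0) : u = 0 := by
  induction c using WellFoundedLT.induction with
  | ind c ih =>
    have hu0 : u ∈ S.A₀ c k := by
      refine mem_A₀.2 ⟨hu, fun c' hc => ih c' hc (hS.isFES.r_mem _ _ _ hu) fun c'' hc' l hl => ?_⟩
      rw [← hS.isFES.r_r _ _ _ _ hu]
      exact h _ _ l hl
    refine eq_zero_of_harmonicDoF hS hX hB hu0 fun l hl => ?_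
    have := h c le_rfl l hl
    rwa [hS.isFES.r_refl _ _ _ hu] at this

/-- Unisolvence of the harmonic degrees of freedom on a cell. -/
lemma existsUnique_of_dual (c : C) (k : ℕ)
    (ψ : ∀ c', Module.Dual ℝ (S.harmonicDoF B c' k)) :
    ∃! u : M c k, u ∈ S.A c k ∧ ∀ c' (hc : c' ≤ c) (l : S.harmonicDoF B c' k),
      (l : Module.Dual ℝ (M c' k)) (S.r hc k u) = ψ c' l := by
  have huniq : ∀ (c : C) (u u' : M c k), (u ∈ S.A c k ∧ ∀ c' (hc : c' ≤ c)
      (l : S.harmonicDoF B c' k), (l : Module.Dual ℝ (M c' k)) (S.r hc k u) = ψ c' l) →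
      (u' ∈ S.A c k ∧ ∀ c' (hc : c' ≤ c) (l : S.harmonicDoF B c' k),
      (l : Module.Dual ℝ (M c' k)) (S.r hc k u') = ψ c' l) → u = u' := by
    intro c u u' hu hu'
    refine sub_eq_zero.1 (eq_zero_of_harmonicDoF_all hS hX hB
      (Submodule.sub_mem _ hu.1 hu'.1) fun c' hc l hl => ?_)
    rw [map_sub, map_sub, hu.2 c' hc ⟨l, hl⟩, hu'.2 c' hc ⟨l, hl⟩, sub_self]
  induction c using WellFoundedLT.induction with
  | ind c ih =>
    choose! f hf _ using ih
    -- The solutions found on smaller cells are compatible under restriction by uniqueness, hence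
    -- form a boundary family.
    have hf' : ∀ c' < c, ∀ c'' (h' : c'' ≤ c') , f c'' = S.r h' k (f c') := by
      intro c' hc c'' h'
      refine huniq c'' _ _ (hf c'' (h'.trans_lt hc))
        ⟨hS.isFES.r_mem _ _ _ (hf c' hc).1, fun e he l => ?_⟩
      rw [← hS.isFES.r_r _ _ _ _ (hf c' hc).1]
      exact (hf c' hc).2 _ _ l
    obtain ⟨u, hu, huf⟩ := hS.extensions c k (fun c' _ => f c')
      ⟨fun c' hc => (hf c' hc).1, fun c'' c' h' h => hf' c' h c'' h'⟩
    -- Adding a bubble fits the degrees of freedom of `c` itself without disturbing those of its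
    -- subcells.
    obtain ⟨w, hw, hwψ⟩ := exists_A₀_of_dual hS hX hB
      (ψ c - (S.harmonicDoF B c k).subtype.flip u)
    rw [mem_A₀] at hw
    refine ⟨u + w, ⟨Submodule.add_mem _ hu hw.1, fun c' hc l => ?_⟩,
      fun y hy => huniq c _ _ hy ⟨Submodule.add_mem _ hu hw.1, fun c' hc l => ?_⟩⟩ <;>
    · rcases hc.lt_or_eq with hlt | rfl
      · rw [map_add, hw.2 c' hlt, add_zero, huf c' hlt]
        have := (hf c' hlt).2 c' le_rfl l
        rwa [hS.isFES.r_refl _ _ _ (hf c' hlt).1] at this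
      · rw [hS.isFES.r_refl _ _ _ (Submodule.add_mem _ hu hw.1), map_add, hwψ l]
        simp

omit hS hB in
open scoped Classical in
/-- If the harmonic degrees of freedom of a form vanish, so do those of its differential. -/
lemma harmonicDoF_d_eq_zero {top : C} (hle : ∀ c, c ≤ top) {k : ℕ} {u : M top k}
    (hrd : ∀ c, S.r (hle c) (k + 1) (S.d top k u) = S.d c k (S.r (hle c) k u))
    (hdd : ∀ c, S.d c (k + 1) (S.d c k (S.r (hle c) k u)) = 0)
    (hst : ∀ c (h : S.dim c = k + 1), S.ev c (k + 1) h (S.d c k (S.r (hle c) k u)) =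
      ∑ c' : {c' : C // c' < c ∧ S.dim c' = k},
        (S.orient c c' : ℝ) * S.ev c' k c'.2.2 (S.r (hle c') k u))
    (h0 : ∀ c, ∀ l ∈ S.harmonicDoF B c k, l (S.r (hle c) k u) = 0) (c : C) :
    ∀ l ∈ S.harmonicDoF B c (k + 1), l (S.r (hle c) (k + 1) (S.d top k u)) = 0 := by
  rw [hrd c]
  have h1 : ∀ v ∈ S.dA₀ c (k + 1), B c (k + 1) (S.d c k (S.r (hle c) k u)) v = 0 :=
    fun v hv => h0 c _ (apply_d_mem_harmonicDoF hv)
  -- The first family vanishes by `d ∘ d = 0`. The others test `d u` against elements of `dA₀`,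
  -- which is `h1` (closed bubbles are in `dA₀` away from degree `dim c`), except for the
  -- evaluation, where Stokes' formula applies.
  refine harmonicDoF_apply_eq_zero (fun v _ => ?_)
    (fun hne v hv hdv => h1 v (hX.exact_of_ne c _ hne v hv hdv)) (fun _ => h1) fun h => ?_
  · rw [hdd, map_zero, LinearMap.zero_apply]
  · rw [hst c h]
    exact Finset.sum_eq_zero fun c' _ => by
      rw [h0 c' _ (ev_mem_harmonicDoF c'.2.2), mul_zero]

end HarmonicDoF

/-- In a compatible system, each element of `A^k(c)` extends to larger cells. -/
lemma exists_extension {S : FESData C M} (hS : S.IsFES) {top : C} (hle : ∀ c, c ≤ top)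
    (hext : ∀ c, S.AdmitsExtensionsOn c) (c : C) (k : ℕ) {u : M c k} (hu : u ∈ S.A c k) :
    ∃ w ∈ S.A top k, S.r (hle c) k w = u := by
  classical
  -- Compatible values are constructed on larger and larger sets of cells stable under passage to
  -- subcells, always equal to the restrictions of `u` below `c`. The induction removes a maximal
  -- cell, which is a subcell of no other cell of the set.
  have key : ∀ s : Finset C, (∀ e ∈ s, ∀ e' ≤ e, e' ∈ s) →
      ∃ f : ∀ e, M e k, (∀ e ∈ s, f e ∈ S.A e k) ∧ (∀ e (h : e ≤ c), f e = S.r h k u) ∧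
        ∀ e ∈ s, ∀ e' (h : e' ≤ e), f e' = S.r h k (f e) := by
    intro s
    induction s using Finset.strongInduction with
    | H s ih =>
      intro hs
      rcases s.eq_empty_or_nonempty with rfl | hne
      · refine ⟨fun e => if h : e ≤ c then S.r h k u else 0, by simp, fun e h => by simp [h],
          by simp⟩
      · obtain ⟨m, hm⟩ := s.exists_maximal hne
        have hlt : ∀ e ∈ s, ∀ e' ≤ e, e' ≠ e → e' ≠ m := by
          rintro e he e' hle' hne' rfl
          exact hne' (le_antisymm hle' (hm.2 he hle'))
        obtain ⟨f, hfA, hfu, hfr⟩ := ih (s.erase m) (Finset.erase_ssubset hm.1) (by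
          intro e he e' hle'
          rw [Finset.mem_erase] at he ⊢
          refine ⟨?_, hs e he.2 e' hle'⟩
          by_cases h : e' = e
          · exact h ▸ he.1
          · exact hlt e he.2 e' hle' h)
        have hsub : ∀ e < m, e ∈ s.erase m := fun e he =>
          Finset.mem_erase.2 ⟨he.ne, hs m hm.1 e he.le⟩
        -- On the removed cell the value is imposed by `u` if it lies below `c`, and is otherwise an
        -- extension of the values on its boundary.
        obtain ⟨w, hw, hwr⟩ : ∃ w ∈ S.A m k, (∀ e (h : e < m), S.r h.le k w = f e) ∧
            ∀ h : m ≤ c, w = S.r h k u := by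
          by_cases hmc : m ≤ c
          · refine ⟨S.r hmc k u, hS.r_mem _ _ _ hu, fun e h => ?_, fun _ => rfl⟩
            rw [hfu e (h.le.trans hmc), ← hS.r_r _ _ _ _ hu]
          · obtain ⟨w, hw, hwr⟩ := hext m k (fun e _ => f e)
              ⟨fun e he => hfA e (hsub e he), fun e' e h' h => hfr e (hsub e h) e' h'⟩
            exact ⟨w, hw, hwr, fun h => absurd h hmc⟩
        have hup : ∀ e ∈ s, e ≠ m → ∀ e' ≤ e, e' ≠ m := by
          intro e he hem e' hle'
          by_cases h : e' = e
          · exact h ▸ hem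
          · exact hlt e he e' hle' h
        refine ⟨Function.update f m w, fun e he => ?_, fun e h => ?_, fun e he e' h => ?_⟩
        · by_cases hem : e = m
          · subst hem; simpa using hw
          · rw [Function.update_of_ne hem]
            exact hfA e (Finset.mem_erase.2 ⟨hem, he⟩)
        · by_cases hem : e = m
          · subst hem; simpa using hwr.2 h
          · rw [Function.update_of_ne hem]
            exact hfu e h
        · by_cases hem : e = m
          · subst hem
            by_cases hem' : e' = e
            · subst hem'; simp [hS.r_refl _ _ _ hw]
            · rw [Function.update_of_ne hem', Function.update_self, hwr.1 _ (lt_of_le_of_ne h hem')]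
          · rw [Function.update_of_ne hem, Function.update_of_ne (hup e he hem e' h)]
            exact hfr e (Finset.mem_erase.2 ⟨hem, he⟩) e' h
  obtain ⟨f, hfA, hfu, hfr⟩ := key Finset.univ (by simp)
  refine ⟨f top, hfA _ (Finset.mem_univ _), ?_⟩
  rw [← hfr top (Finset.mem_univ _) c (hle c), hfu c le_rfl, hS.r_refl _ _ _ hu]

/-- Extension from the boundary follows from the extension of elements of `A₀^k(c')` which vanish
on the other cells of at most the same rank. -/
lemma admitsExtensionsOn_of_step {S : FESData C M} (hS : S.IsFES) {c : C} {k : ℕ} (ρ : C → ℕ)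
    (hρ : StrictMono ρ)
    (hstep : ∀ c' (h : c' < c), ∀ e ∈ S.A₀ c' k, ∃ u ∈ S.A c k, S.r h.le k u = e ∧
      ∀ c'' (h'' : c'' < c), c'' ≠ c' → ρ c'' ≤ ρ c' → S.r h''.le k u = 0)
    (f : ∀ c' : C, c' < c → M c' k) (hf : S.IsBoundaryFamily c k f) :
    ∃ u ∈ S.A c k, ∀ c' (h : c' < c), S.r h.le k u = f c' h := by
  classical
  -- Cells are treated by increasing rank. Once all cells of smaller rank are matched, the remaining
  -- error on a cell is a bubble, and its extension is zero on the other cells already treated.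
  have key : ∀ s : Finset C, (∀ e ∈ s, ∀ e', ρ e' < ρ e → e' ∈ s) →
      ∃ u ∈ S.A c k, ∀ e ∈ s, ∀ h : e < c, S.r h.le k u = f e h := by
    intro s
    induction s using Finset.strongInduction with
    | H s ih =>
      intro hs
      rcases s.eq_empty_or_nonempty with rfl | hne
      · exact ⟨0, Submodule.zero_mem _, by simp⟩
      · obtain ⟨m, hm, hmax⟩ := s.exists_max_image ρ hne
        obtain ⟨u, hu, huf⟩ := ih (s.erase m) (Finset.erase_ssubset hm) (by
          intro e he e' hle'
          rw [Finset.mem_erase] at he ⊢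
          exact ⟨fun h => absurd (hmax e he.2) (by rw [← h]; omega), hs e he.2 e' hle'⟩)
        by_cases hmc : m < c
        · have he : f m hmc - S.r hmc.le k u ∈ S.A₀ m k := by
            refine mem_A₀.2 ⟨Submodule.sub_mem _ (hf.1 m hmc) (hS.r_mem _ _ _ hu), fun e h => ?_⟩
            rw [map_sub, ← hf.2 e m h.le hmc, ← hS.r_r _ _ _ _ hu, sub_eq_zero]
            exact (huf e (Finset.mem_erase.2 ⟨h.ne, hs m hm e (hρ h)⟩) (h.trans hmc)).symm
          obtain ⟨w, hw, hwe, hw0⟩ := hstep m hmc _ he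
          refine ⟨u + w, Submodule.add_mem _ hu hw, fun e hes h => ?_⟩
          rw [map_add]
          by_cases hem : e = m
          · subst hem; rw [hwe]; abel
          · rw [hw0 e h hem (hmax e hes), add_zero, huf e (Finset.mem_erase.2 ⟨hem, hes⟩)]
        · refine ⟨u, hu, fun e hes h => huf e (Finset.mem_erase.2 ⟨?_, hes⟩) h⟩
          rintro rfl
          exact hmc h
  obtain ⟨u, hu, huf⟩ := key Finset.univ (by simp)
  exact ⟨u, hu, fun e h => huf e (Finset.mem_univ _) h⟩

end FESData

/-! ### Integration by parts for piecewise smooth forms -/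

section Calculus

open Set MeasureTheory Filter Topology

/-- The estimate `|f t - f 0| ≤ L t` holds on a closed set of times that can always be prolonged to
the right: among finitely many closed sets, one is met arbitrarily close to the right of `x`, hence
contains `x`, and its own estimate takes over. -/
lemma abs_sub_le_of_closed_cover {ι : Type*} [Finite ι] {f : ℝ → ℝ} {L : ℝ}
    (hf : ContinuousOn f (Icc 0 1)) (S : ι → Set ℝ) (hS : ∀ i, IsClosed (S i))
    (hcov : Icc 0 1 ⊆ ⋃ i, S i)
    (h : ∀ i, ∀ x ∈ S i ∩ Icc 0 1, ∀ y ∈ S i ∩ Icc 0 1, |f y - f x| ≤ L * |y - x|) :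
    |f 1 - f 0| ≤ L := by
  have hmem : (1 : ℝ) ∈ {t | |f t - f 0| ≤ L * t} := by
    refine IsClosed.mem_of_ge_of_forall_exists_gt (a := 0) ?_ (by simp) zero_le_one ?_
    · have := ContinuousOn.preimage_isClosed_of_isClosed
        (f := fun t => L * t - |f t - f 0|) (s := Icc 0 1) (t := Ici 0) (by fun_prop)
        isClosed_Icc isClosed_Ici
      convert this using 1
      ext t
      simp [and_comm]
    · rintro x ⟨hx, hx0, hx1⟩
      obtain ⟨i, hi⟩ : ∃ i, ∃ᶠ y in 𝓝[>] x, y ∈ S i ∩ Ioc x 1 := by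
        by_contra hcon
        push Not at hcon
        have h1 : ∀ᶠ y in 𝓝[>] x, ∀ i, y ∉ S i ∩ Ioc x 1 := eventually_all.2 hcon
        obtain ⟨y, hy, hy'⟩ := (h1.and (Ioc_mem_nhdsGT hx1)).exists
        obtain ⟨i, hi⟩ := mem_iUnion.1 (hcov ⟨hx0.trans hy'.1.le, hy'.2⟩)
        exact hy i ⟨hi, hy'⟩
      obtain ⟨y, hyi, hy⟩ := hi.exists
      have hxi : x ∈ S i := by
        refine (hS i).closure_subset (mem_closure_iff_frequently.2 ?_)
        exact (hi.filter_mono nhdsWithin_le_nhds).mono fun _ h => h.1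
      refine ⟨y, ?_, hy⟩
      have h1 := h i x ⟨hxi, hx0, hx1.le⟩ y ⟨hyi, hx0.trans hy.1.le, hy.2⟩
      rw [abs_of_pos (sub_pos.2 hy.1)] at h1
      have h2 := abs_sub_le (f y) (f x) (f 0)
      simp only [mem_ofPred_eq] at hx ⊢
      linarith
  simpa using hmem

/-- A continuous function on a convex set which is Lipschitz on each member of a finite closed
cover is Lipschitz. -/
lemma lipschitzOnWith_of_closed_cover {E ι : Type*} [NormedAddCommGroup E] [NormedSpace ℝ E]
    [Finite ι] {f : E → ℝ} {L : NNReal} {s : Set E} (hs : Convex ℝ s) (hf : ContinuousOn f s)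
    (S : ι → Set E) (hS : ∀ i, IsClosed (S i)) (hcov : s ⊆ ⋃ i, S i)
    (h : ∀ i, LipschitzOnWith L f (S i ∩ s)) : LipschitzOnWith L f s := by
  refine LipschitzOnWith.of_dist_le_mul fun x hx y hy => ?_
  let γ : ℝ → E := fun t => y + t • (x - y)
  have hγ : Continuous γ := by fun_prop
  have hγs : ∀ t ∈ Icc (0 : ℝ) 1, γ t ∈ s := fun t ht => by
    have := hs hy hx (sub_nonneg.2 ht.2) ht.1 (by ring)
    convert this using 1
    simp only [γ, smul_sub, sub_smul, one_smul]
    abel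
  have hd : ∀ a b : ℝ, dist (γ a) (γ b) = |a - b| * dist x y := fun a b => by
    rw [dist_eq_norm, dist_eq_norm, ← Real.norm_eq_abs, ← norm_smul]
    simp only [γ, sub_smul]
    congr 1
    abel
  have := abs_sub_le_of_closed_cover (f := f ∘ γ) (L := L * dist x y)
    (hf.comp hγ.continuousOn hγs) (fun i => γ ⁻¹' S i) (fun i => (hS i).preimage hγ)
    (fun t ht => by
      obtain ⟨i, hi⟩ := mem_iUnion.1 (hcov (hγs t ht))
      exact mem_iUnion.2 ⟨i, hi⟩)
    (fun i a ha b hb => by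
      have := (h i).dist_le_mul _ ⟨hb.1, hγs b hb.2⟩ _ ⟨ha.1, hγs a ha.2⟩
      rw [hd, Real.dist_eq] at this
      simp only [Function.comp]
      linarith)
  simpa [γ, Real.dist_eq] using this

/-- Integration by parts of a Lipschitz function against a test function. -/
lemma setIntegral_mul_lineDeriv {m : ℕ} {s : Set (Fin m → ℝ)} {f φ : (Fin m → ℝ) → ℝ} {L : NNReal}
    (hf : LipschitzOnWith L f s) (hφ : ContDiff ℝ ∞ φ) (hc : HasCompactSupport φ)
    (hs : tsupport φ ⊆ interior s) (η : Fin m → ℝ) :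
    Integrable (fun t => φ t * lineDeriv ℝ f t η) (volume.restrict s) ∧
    ∫ t in s, fderiv ℝ φ t η * f t = - ∫ t in s, φ t * lineDeriv ℝ f t η := by
  -- Integration by parts is available for Lipschitz functions on the whole space. The choice of
  -- extension is immaterial since `φ` is supported in the interior of `s`.
  obtain ⟨f', hf', heq⟩ := hf.extend_real
  have hzero : ∀ t, t ∉ s → φ t = 0 := fun t ht => by
    by_contra hne
    exact ht (interior_subset (hs (subset_tsupport _ hne)))
  have hzero' : ∀ t, t ∉ s → fderiv ℝ φ t = 0 := fun t ht => by
    by_contra hne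
    exact ht (interior_subset (hs (support_fderiv_subset ℝ hne)))
  have hline : ∀ t, φ t * lineDeriv ℝ f t η = φ t * lineDeriv ℝ f' t η := fun t => by
    by_cases ht : t ∈ interior s
    · rw [Filter.EventuallyEq.lineDeriv_eq (f₁ := f')]
      filter_upwards [isOpen_interior.mem_nhds ht] with x hx
      exact (heq (interior_subset hx)).symm
    · rw [image_eq_zero_of_notMem_tsupport fun h => ht (hs h)]
      simp
  obtain ⟨D, hD⟩ : ∃ D, LipschitzWith D φ := by
    obtain ⟨D, hD⟩ := (hφ.continuous_fderiv (by simp)).bounded_above_of_compact_support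
      (hc.fderiv ℝ)
    refine ⟨D.toNNReal, lipschitzWith_of_nnnorm_fderiv_le (hφ.differentiable (by simp))
      fun x => ?_⟩
    rw [← NNReal.coe_le_coe]
    exact (hD x).trans (Real.le_coe_toNNReal _)
  have hI := hf'.integral_lineDeriv_mul_eq (μ := volume) hD hc η
  have h1 : ∫ t in s, fderiv ℝ φ t η * f t = ∫ t, fderiv ℝ φ t η * f' t := by
    refine Eq.trans (integral_congr_ae (Eventually.of_forall fun t => ?_))
      (setIntegral_eq_integral_of_forall_compl_eq_zero (s := s) fun t ht => by
        rw [hzero' t ht]; simp)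
    by_cases ht : t ∈ s
    · simp only [heq ht]
    · simp [hzero' t ht]
  simp only [hline]
  refine ⟨?_, ?_⟩
  · refine Integrable.integrableOn ?_
    exact (hf'.locallyIntegrable_lineDeriv η).integrable_smul_left_of_hasCompactSupport
      hφ.continuous hc
  · rw [h1, setIntegral_eq_integral_of_forall_compl_eq_zero (s := s) (fun t ht => by
      rw [hzero t ht]; simp)]
    -- In the whole-space formula the sign is carried by the direction `-η`.
    have h2 : ∀ t, lineDeriv ℝ φ t (-η) = - fderiv ℝ φ t η := fun t => by
      rw [(hφ.differentiable (by simp) t).lineDeriv_eq_fderiv, map_neg]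
    simp only [h2, neg_mul, integral_neg] at hI
    simp only [mul_comm (φ _)]
    rw [hI, neg_neg]

end Calculus

/-! ### Parametrized cells and the piecewise criterion of admissibility -/

section Cells

open Set MeasureTheory Filter Topology

variable (v : Fin 3 → Plane) (c : TriCell) {m : ℕ} (h : c.1.card = m + 1)

/-- The linear part of the parametrization of a cell, as a continuous linear map. -/
noncomputable def cellTangentL : (Fin m → ℝ) →L[ℝ] Plane :=
  LinearMap.toContinuousLinearMap
    { toFun := cellTangent v c h
      map_add' := fun a b => by simp [cellTangent, add_smul, Finset.sum_add_distrib]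
      map_smul' := fun a b => by simp [cellTangent, mul_smul, Finset.smul_sum] }

lemma cellTangentL_apply (t : Fin m → ℝ) : cellTangentL v c h t = cellTangent v c h t := rfl

lemma hasFDerivAt_cellParam (t : Fin m → ℝ) :
    HasFDerivAt (cellParam v c h) (cellTangentL v c h) t :=
  (cellTangentL v c h).hasFDerivAt.const_add _

lemma contDiff_cellParam : ContDiff ℝ ∞ (cellParam v c h) :=
  contDiff_const.add (cellTangentL v c h).contDiff

lemma convex_refSimplex (m : ℕ) : Convex ℝ (refSimplex m) := by
  rintro x ⟨hx, hx'⟩ y ⟨hy, hy'⟩ a b ha hb hab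
  refine ⟨fun i => ?_, ?_⟩
  · have := mul_nonneg ha (hx i)
    have := mul_nonneg hb (hy i)
    simp only [Pi.add_apply, Pi.smul_apply, smul_eq_mul]
    linarith
  · simp only [Pi.add_apply, Pi.smul_apply, smul_eq_mul, Finset.sum_add_distrib, ← Finset.mul_sum]
    nlinarith

lemma convex_cellParam_preimage {K : Set Plane} (hK : Convex ℝ K) :
    Convex ℝ (cellParam v c h ⁻¹' K) := by
  have : cellParam v c h ⁻¹' K =
      cellTangentL v c h ⁻¹' ((fun x => cellVertex v c h 0 + x) ⁻¹' K) := rfl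
  rw [this]
  exact (hK.translate_preimage_right _).linear_preimage (cellTangentL v c h).toLinearMap

lemma exists_cellParam_eq {x : Plane} (hx : x ∈ cellSet v c) :
    ∃ t ∈ refSimplex m, cellParam v c h t = x := by
  suffices cellSet v c ⊆ cellParam v c h '' refSimplex m from this hx
  refine convexHull_min ?_ ?_
  · rintro _ ⟨i, hi, rfl⟩
    obtain ⟨j, hj⟩ : i ∈ range (c.1.orderEmbOfFin h) := by simpa using hi
    refine Fin.cases (fun hj => ?_) (fun j hj => ?_) j hj
    · exact ⟨0, ⟨fun _ => le_rfl, by simp⟩, by simp [cellParam, cellTangent, cellVertex, hj]⟩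
    · refine ⟨Pi.single j 1, ⟨fun i => ?_, by simp⟩, ?_⟩
      · rw [Pi.single_apply]; split_ifs <;> norm_num
      · simp [cellParam, cellTangent, cellVertex, Pi.single_apply, ite_smul, hj]
  · have : cellParam v c h '' refSimplex m =
        (fun x => cellVertex v c h 0 + x) '' (cellTangentL v c h '' refSimplex m) := by
      rw [image_image]; rfl
    rw [this]
    exact ((convex_refSimplex m).linear_image (cellTangentL v c h).toLinearMap).translate _

lemma continuousOn_extZero_cellParam {k : ℕ} (f : C(cellSet v c, AltForm k))
    (ξ : Fin k → Plane) :
    ContinuousOn (fun t => extZero f (cellParam v c h t) ξ) (refSimplex m) := by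
  rw [continuousOn_iff_continuous_domRestrict]
  have hE : Set.domRestrict (refSimplex m) (fun t => extZero f (cellParam v c h t) ξ) =
      fun t : refSimplex m => f ⟨cellParam v c h t, cellParam_mem v c h t.2⟩ ξ := by
    ext t
    simp [extZero_apply f (cellParam_mem v c h t.2)]
  rw [hE]
  have h1 : Continuous fun t : refSimplex m =>
      f ⟨cellParam v c h t, cellParam_mem v c h t.2⟩ :=
    f.continuous.comp (((continuous_cellParam v c h).comp continuous_subtype_val).subtype_mk _)
  exact (ContinuousAlternatingMap.apply ℝ Plane ℝ ξ).continuous.comp h1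

lemma hasFDerivAt_form_apply {k : ℕ} {g : Plane → AltForm k} (hg : ContDiff ℝ ∞ g)
    (ξ : Fin k → Plane) (t : Fin m → ℝ) :
    HasFDerivAt (fun t => g (cellParam v c h t) ξ)
      (((ContinuousAlternatingMap.apply ℝ Plane ℝ ξ).comp (fderiv ℝ g (cellParam v c h t))).comp
        (cellTangentL v c h)) t :=
  (((ContinuousAlternatingMap.apply ℝ Plane ℝ ξ).hasFDerivAt.comp _
    (hg.differentiable (by simp) _).hasFDerivAt).comp t (hasFDerivAt_cellParam v c h t))

/-- A pair with piecewise smooth first component is admissible if and only if its second component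
is, piecewise, the exterior derivative of the first one (after pullback to the cell). -/
lemma isAdmissible_iff_of_pieces {k : ℕ} (z : FormPair v c k) {ι : Type} [Finite ι]
    (K : ι → Set Plane) (hKc : ∀ i, IsClosed (K i)) (hKv : ∀ i, Convex ℝ (K i))
    (hcov : cellSet v c ⊆ ⋃ i, K i)
    (hne : ∀ i, (interior (cellParam v c h ⁻¹' K i ∩ refSimplex m)).Nonempty)
    (g : ι → Plane → AltForm k) (hg : ∀ i, ContDiff ℝ ∞ (g i))
    (hz : ∀ i x (hx : x ∈ cellSet v c), x ∈ K i → z.1 ⟨x, hx⟩ = g i x) :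
    IsAdmissible v c k z ↔ ∀ i x (hx : x ∈ cellSet v c), x ∈ K i →
      ∀ η : Fin (k + 1) → (Fin m → ℝ), z.2 ⟨x, hx⟩ (fun j => cellTangent v c h (η j)) =
        extDeriv (g i) x (fun j => cellTangent v c h (η j)) := by
  set Q : ι → Set (Fin m → ℝ) := fun i => cellParam v c h ⁻¹' K i ∩ refSimplex m with hQ
  have hQv : ∀ i, Convex ℝ (Q i) := fun i =>
    (convex_cellParam_preimage v c h (hKv i)).inter (convex_refSimplex m)
  have hQc : ∀ i, IsClosed (Q i) := fun i =>
    ((hKc i).preimage (continuous_cellParam v c h)).inter (isCompact_refSimplex m).isClosed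
  have hQcov : refSimplex m ⊆ ⋃ i, Q i := fun t ht => by
    obtain ⟨i, hi⟩ := mem_iUnion.1 (hcov (cellParam_mem v c h ht))
    exact mem_iUnion.2 ⟨i, hi, ht⟩
  set F : (Fin k → Plane) → (Fin m → ℝ) → ℝ := fun ξ t => extZero z.1 (cellParam v c h t) ξ with hF
  have hFQ : ∀ ξ i, EqOn (F ξ) (fun t => g i (cellParam v c h t) ξ) (Q i) := fun ξ i t ht => by
    simp only [hF, extZero_apply z.1 (cellParam_mem v c h ht.2), hz i _ _ ht.1]
  -- Continuity across the interfaces makes the piecewise smooth components globally Lipschitz,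
  -- which is why integration by parts produces no jump terms.
  have hlip : ∀ ξ, ∃ L, LipschitzOnWith L (F ξ) (refSimplex m) := by
    intro ξ
    have h1 : ∀ i, ∃ L, LipschitzOnWith L (F ξ) (Q i) := fun i => by
      have hs : ContDiff ℝ 1 (fun t => g i (cellParam v c h t) ξ) :=
        ((ContinuousAlternatingMap.apply ℝ Plane ℝ ξ).contDiff.comp
          ((hg i).comp (contDiff_cellParam v c h))).of_le (by simp)
      obtain ⟨L, hL⟩ := LocallyLipschitzOn.exists_lipschitzOnWith_of_compact
        ((isCompact_refSimplex m).inter_left ((hKc i).preimage (continuous_cellParam v c h)))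
        hs.locallyLipschitz.locallyLipschitzOn
      exact ⟨L, fun x hx y hy => by rw [hFQ ξ i hx, hFQ ξ i hy]; exact hL hx hy⟩
    choose L hL using h1
    have := Fintype.ofFinite ι
    refine ⟨∑ i, L i, lipschitzOnWith_of_closed_cover (convex_refSimplex m)
      (continuousOn_extZero_cellParam v c h z.1 ξ) Q hQc hQcov fun i => ?_⟩
    exact ((hL i).mono inter_subset_left).weaken
      (Finset.single_le_sum (fun _ _ => zero_le) (Finset.mem_univ i))
  set T := cellTangent v c h with hT
  -- The exterior derivative of the pullback, written with line derivatives so as to be defined at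
  -- every point; it is meaningful almost everywhere.
  let D : (Fin (k + 1) → (Fin m → ℝ)) → (Fin m → ℝ) → ℝ := fun η t =>
    ∑ i : Fin (k + 1), (-1 : ℝ) ^ (i : ℕ) * lineDeriv ℝ (F fun j => T (η (i.succAbove j))) t (η i)
  have hD : ∀ η i, ∀ t ∈ interior (Q i),
      D η t = extDeriv (g i) (cellParam v c h t) (fun j => T (η j)) := by
    intro η i t ht
    rw [extDeriv, ContinuousAlternatingMap.alternatizeUncurryFin_apply]
    refine Finset.sum_congr rfl fun a _ => ?_
    have h1 : lineDeriv ℝ (F fun j => T (η (a.succAbove j))) t (η a) =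
        lineDeriv ℝ (fun t => g i (cellParam v c h t) fun j => T (η (a.succAbove j))) t (η a) := by
      refine Filter.EventuallyEq.lineDeriv_eq ?_
      filter_upwards [isOpen_interior.mem_nhds ht] with x hx using hFQ _ i (interior_subset hx)
    rw [h1, ((hasFDerivAt_form_apply v c h (hg i) _ t).hasLineDerivAt _).lineDeriv]
    simp only [ContinuousLinearMap.comp_apply, cellTangentL_apply, zsmul_eq_mul, Int.cast_pow,
      Int.cast_neg, Int.cast_one]
    rfl
  -- Frontiers of convex sets are null, so almost every point is interior to a piece.
  have hae : ∀ᵐ t, t ∈ refSimplex m → ∃ i, t ∈ interior (Q i) := by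
    have h1 : ∀ᵐ t, ∀ i, t ∉ frontier (Q i) :=
      ae_all_iff.2 fun i => measure_eq_zero_iff_ae_notMem.1 ((hQv i).addHaar_frontier _)
    filter_upwards [h1] with t ht hts
    obtain ⟨i, hi⟩ := mem_iUnion.1 (hQcov hts)
    exact ⟨i, by rw [← self_sdiff_frontier]; exact ⟨hi, ht i⟩⟩
  -- Nondegeneracy of the pieces is used here: an almost everywhere identity of continuous functions
  -- then holds on the whole piece.
  have hcl : ∀ i, Q i ⊆ closure (interior (Q i)) := fun i => by
    rw [(hQv i).closure_interior_eq_closure_of_nonempty_interior (hne i)]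
    exact subset_closure
  have hibp : ∀ φ : (Fin m → ℝ) → ℝ, ContDiff ℝ ∞ φ → HasCompactSupport φ →
      tsupport φ ⊆ interior (refSimplex m) → ∀ η : Fin (k + 1) → (Fin m → ℝ),
      Integrable (fun t => φ t * D η t) (volume.restrict (refSimplex m)) ∧
      - ∑ i : Fin (k + 1), (-1 : ℝ) ^ (i : ℕ) * ∫ t in refSimplex m,
        fderiv ℝ φ t (η i) * F (fun j => T (η (i.succAbove j))) t =
      ∫ t in refSimplex m, φ t * D η t := by
    intro φ h1 h2 h3 η
    have key := fun i : Fin (k + 1) => setIntegral_mul_lineDeriv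
      (hlip fun j => T (η (i.succAbove j))).choose_spec h1 h2 h3 (η i)
    have e : (fun t => φ t * D η t) = fun t => ∑ i : Fin (k + 1), (-1 : ℝ) ^ (i : ℕ) *
        (φ t * lineDeriv ℝ (F fun j => T (η (i.succAbove j))) t (η i)) := by
      ext t
      simp only [D, Finset.mul_sum]
      exact Finset.sum_congr rfl fun i _ => by ring
    rw [e]
    refine ⟨integrable_finsetSum _ fun i _ => (key i).1.const_mul _, ?_⟩
    rw [integral_finsetSum _ fun i _ => (key i).1.const_mul _, ← Finset.sum_neg_distrib]
    refine Finset.sum_congr rfl fun i _ => ?_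
    rw [(key i).2, integral_const_mul]
    ring
  have hm : ∀ i x, x ∈ cellSet v c → x ∈ K i → ∃ t ∈ Q i, cellParam v c h t = x := by
    intro i x hx hxi
    obtain ⟨t, ht, rfl⟩ := exists_cellParam_eq v c h hx
    exact ⟨t, ⟨hxi, ht⟩, rfl⟩
  constructor
  · intro hadm i x hx hxi η
    obtain ⟨t, ht, rfl⟩ := hm i x hx hxi
    set H : (Fin m → ℝ) → ℝ := fun t => extZero z.2 (cellParam v c h t) fun j => T (η j) with hH
    have hHc : ContinuousOn H (refSimplex m) := continuousOn_extZero_cellParam v c h z.2 _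
    have hDint : LocallyIntegrableOn (D η) (interior (refSimplex m)) := by
      have h1 : ∀ t, t ∈ interior (refSimplex m) → D η t = ∑ i : Fin (k + 1), (-1 : ℝ) ^ (i : ℕ) *
          lineDeriv ℝ (hlip fun j => T (η (i.succAbove j))).choose_spec.extend_real.choose t
            (η i) := by
        intro t ht
        refine Finset.sum_congr rfl fun i _ => ?_
        congr 1
        refine Filter.EventuallyEq.lineDeriv_eq ?_
        filter_upwards [isOpen_interior.mem_nhds ht] with x hx
        exact ((hlip fun j => T (η (i.succAbove j))).choose_spec.extend_real.choose_spec.2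
          (interior_subset hx))
      refine LocallyIntegrableOn.congr (f := fun t => ∑ i : Fin (k + 1), (-1 : ℝ) ^ (i : ℕ) *
          lineDeriv ℝ (hlip fun j => T (η (i.succAbove j))).choose_spec.extend_real.choose t
            (η i)) ?_ ?_
      rotate_left
      · refine LocallyIntegrable.locallyIntegrableOn ?_ _
        refine locallyIntegrable_finsetSum _ fun i _ => ?_
        exact ((hlip fun j => T (η (i.succAbove j))).choose_spec.extend_real.choose_spec.1
          |>.locallyIntegrable_lineDeriv (η i)).smul ((-1 : ℝ) ^ (i : ℕ))
      · refine (ae_restrict_iff' isOpen_interior.measurableSet).2 (Eventually.of_forall ?_)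
        exact fun t ht => (h1 t ht).symm
    have hHint : LocallyIntegrableOn H (interior (refSimplex m)) :=
      ((hHc.integrableOn_compact (isCompact_refSimplex m)).mono_set
        interior_subset).locallyIntegrableOn
    -- Fundamental lemma of the calculus of variations, comparing admissibility with the integration
    -- by parts `hibp`.
    have hzero : ∀ᵐ t, t ∈ interior (refSimplex m) → H t - D η t = 0 := by
      refine isOpen_interior.ae_eq_zero_of_integral_contDiff_smul_eq_zero (hHint.sub hDint) ?_
      intro φ h1 h2 h3
      have h4 := hibp φ h1 h2 h3 η
      have h5 := hadm m h φ h1 h2 h3 η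
      have h6 : IntegrableOn (fun t => φ t * H t) (refSimplex m) :=
        integrableOn_cell v c h z.2 h1.continuous _
      rw [← setIntegral_eq_integral_of_forall_compl_eq_zero (s := refSimplex m)]
      · simp only [smul_eq_mul, mul_sub]
        rw [integral_sub h6 h4.1, ← h4.2, ← h5, sub_self]
      · intro t ht
        rw [image_eq_zero_of_notMem_tsupport fun h => ht (interior_subset (h3 h)), zero_smul]
    have hEq : EqOn H (fun t => extDeriv (g i) (cellParam v c h t) fun j => T (η j)) (Q i) := by
      refine Measure.eqOn_of_ae_eq (μ := volume) ?_ (hHc.mono inter_subset_right) ?_ (hcl i)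
      · rw [Filter.EventuallyEq, ae_restrict_iff' (hQc i).measurableSet]
        have h1 : ∀ᵐ t, t ∉ frontier (Q i) :=
          measure_eq_zero_iff_ae_notMem.1 ((hQv i).addHaar_frontier _)
        filter_upwards [hzero, h1] with t ht ht1 htQ
        have hti : t ∈ interior (Q i) := by rw [← self_sdiff_frontier]; exact ⟨htQ, ht1⟩
        rw [← hD η i t hti]
        exact sub_eq_zero.1 (ht (interior_mono inter_subset_right hti))
      · have h1 : Continuous (extDeriv (g i)) :=
          (ContinuousAlternatingMap.alternatizeUncurryFinCLM ℝ Plane ℝ).continuous.comp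
            ((hg i).continuous_fderiv (by simp))
        exact ((ContinuousAlternatingMap.apply ℝ Plane ℝ _).continuous.comp
          (h1.comp (continuous_cellParam v c h))).continuousOn
    have := hEq ht
    simp only [hH, extZero_apply z.2 hx] at this
    exact this
  · intro hcls m' h' φ h1 h2 h3 η
    obtain rfl : m' = m := by omega
    refine Eq.trans ?_ (hibp φ h1 h2 h3 η).2.symm
    refine setIntegral_congr_ae (isCompact_refSimplex m').measurableSet ?_
    filter_upwards [hae] with t ht hts
    obtain ⟨i, hi⟩ := ht hts
    rw [hD η i t hi, extZero_apply z.2 (cellParam_mem v c h hts)]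
    rw [hcls i _ (cellParam_mem v c h hts) (interior_subset hi).1 η]

/-- In degrees at least the dimension of the cell, all pairs are admissible. -/
lemma isAdmissible_of_le {k : ℕ} (hk : c.1.card ≤ k + 1) (z : FormPair v c k) :
    IsAdmissible v c k z := by
  intro m h φ h1 h2 h3 η
  -- There are `k + 1` vectors in a space of dimension `m ≤ k`, so every alternating form in `k + 1`
  -- variables vanishes on them.
  have hdep : ¬ LinearIndependent ℝ η := fun hli => by
    have := hli.fintype_card_le_finrank
    simp at this
    omega
  have hL : ∀ t, φ t * extZero z.2 (cellParam v c h t) (fun j => cellTangent v c h (η j)) = 0 := by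
    intro t
    have : ((extZero z.2 (cellParam v c h t)).compContinuousLinearMap (cellTangentL v c h)) η = 0 :=
      AlternatingMap.map_linearDependent
        ((extZero z.2 (cellParam v c h t)).compContinuousLinearMap
          (cellTangentL v c h)).toAlternatingMap η hdep
    simp only [ContinuousAlternatingMap.compContinuousLinearMap_apply, Function.comp_def,
      cellTangentL_apply] at this
    rw [this, mul_zero]
  -- The sum is the value on `η` of the wedge product of `dφ` with the pullback of `z.1`, again an
  -- alternating `(k + 1)`-form.
  have hR : ∀ t, ∑ i : Fin (k + 1), (-1 : ℝ) ^ (i : ℕ) * (fderiv ℝ φ t (η i) *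
      extZero z.1 (cellParam v c h t) (fun j => cellTangent v c h (η (i.succAbove j)))) = 0 := by
    intro t
    let α : (Fin m → ℝ) [⋀^Fin k]→L[ℝ] ℝ :=
      (extZero z.1 (cellParam v c h t)).compContinuousLinearMap (cellTangentL v c h)
    have : ContinuousAlternatingMap.alternatizeUncurryFin ((fderiv ℝ φ t).smulRight α) η = 0 :=
      AlternatingMap.map_linearDependent (ContinuousAlternatingMap.alternatizeUncurryFin
        ((fderiv ℝ φ t).smulRight α)).toAlternatingMap η hdep
    rw [ContinuousAlternatingMap.alternatizeUncurryFin_apply] at this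
    simp only [zsmul_eq_mul, Int.cast_pow, Int.cast_neg, Int.cast_one] at this
    exact this
  simp only [hL, integral_zero]
  have hi : ∀ i : Fin (k + 1), (-1 : ℝ) ^ (i : ℕ) * ∫ t in refSimplex m, fderiv ℝ φ t (η i) *
      extZero z.1 (cellParam v c h t) (fun j => cellTangent v c h (η (i.succAbove j))) =
      ∫ t in refSimplex m, (-1 : ℝ) ^ (i : ℕ) * (fderiv ℝ φ t (η i) *
      extZero z.1 (cellParam v c h t) (fun j => cellTangent v c h (η (i.succAbove j)))) :=
    fun i => (integral_const_mul _ _).symm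
  simp only [hi]
  rw [← integral_finsetSum]
  · simp [hR]
  · intro i _
    refine Integrable.const_mul ?_ _
    exact integrableOn_cell v c h z.1
      ((h1.continuous_fderiv (by simp)).clm_apply continuous_const) _

end Cells

/-! ### Boundary values by approximate identities -/

section ApproximateIdentity

open Set MeasureTheory Filter Topology

/-- A smooth function which vanishes on `(-∞, 1]` and is equal to `1` on `[2, ∞)`. -/
noncomputable def cutoff (s : ℝ) : ℝ := Real.smoothTransition (s - 1)

lemma contDiff_cutoff : ContDiff ℝ ∞ cutoff :=
  Real.smoothTransition.contDiff.comp (contDiff_id.sub contDiff_const)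

lemma cutoff_of_le {s : ℝ} (h : s ≤ 1) : cutoff s = 0 :=
  Real.smoothTransition.zero_of_nonpos (by linarith)

lemma cutoff_of_ge {s : ℝ} (h : 2 ≤ s) : cutoff s = 1 :=
  Real.smoothTransition.one_of_one_le (by linarith)

lemma abs_cutoff_le (s : ℝ) : |cutoff s| ≤ 1 :=
  abs_le.2 ⟨by unfold cutoff; linarith [Real.smoothTransition.nonneg (s - 1)],
    Real.smoothTransition.le_one _⟩

lemma continuous_deriv_cutoff : Continuous (deriv cutoff) :=
  contDiff_cutoff.continuous_deriv (by simp)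

lemma hasDerivAt_cutoff (s : ℝ) : HasDerivAt cutoff (deriv cutoff s) s :=
  (contDiff_cutoff.differentiable (by simp) s).hasDerivAt

lemma deriv_cutoff_of_notMem {s : ℝ} (h : s ∉ Ioo (1 : ℝ) 2) : deriv cutoff s = 0 := by
  have h1 : ∀ t < 1, deriv cutoff t = 0 := fun t ht => by
    have : cutoff =ᶠ[𝓝 t] fun _ => 0 := by
      filter_upwards [Iio_mem_nhds ht] with x hx using cutoff_of_le (le_of_lt hx)
    rw [this.deriv_eq, deriv_const]
  have h2 : ∀ t, 2 < t → deriv cutoff t = 0 := fun t ht => by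
    have : cutoff =ᶠ[𝓝 t] fun _ => 1 := by
      filter_upwards [Ioi_mem_nhds ht] with x hx using cutoff_of_ge (le_of_lt hx)
    rw [this.deriv_eq, deriv_const]
  -- The two endpoints are reached by continuity of the derivative.
  have hcl : IsClosed {t | deriv cutoff t = 0} :=
    isClosed_eq continuous_deriv_cutoff continuous_const
  rcases le_or_gt s 1 with hs | hs
  · have : Iic (1 : ℝ) ⊆ {t | deriv cutoff t = 0} := by
      rw [← closure_Iio]
      exact hcl.closure_subset_iff.2 h1
    exact this hs
  · have : Ici (2 : ℝ) ⊆ {t | deriv cutoff t = 0} := by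
      rw [← closure_Ioi]
      exact hcl.closure_subset_iff.2 h2
    exact this (not_lt.1 fun hs2 => h ⟨hs, hs2⟩)

lemma integrable_deriv_cutoff : Integrable (deriv cutoff) := by
  refine (continuous_deriv_cutoff.integrable_of_hasCompactSupport ?_)
  refine HasCompactSupport.of_support_subset_isCompact (isCompact_Icc (a := (1 : ℝ)) (b := 2)) ?_
  intro s hs
  by_contra hcon
  exact hs (deriv_cutoff_of_notMem fun h => hcon (Ioo_subset_Icc_self h))

lemma integral_deriv_cutoff : ∫ s, deriv cutoff s = 1 := by
  rw [← setIntegral_eq_integral_of_forall_compl_eq_zero (s := Ioc 1 2),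
    ← intervalIntegral.integral_of_le one_le_two,
    intervalIntegral.integral_deriv_eq_sub' _ rfl, cutoff_of_ge le_rfl, cutoff_of_le le_rfl,
    sub_zero]
  · exact fun x _ => contDiff_cutoff.differentiable (by simp) x
  · exact continuous_deriv_cutoff.continuousOn
  · exact fun s hs => deriv_cutoff_of_notMem fun h => hs ⟨h.1, h.2.le⟩

/-- An approximation of the Dirac measure at `0`, supported in `[ε, 2ε]`. -/
noncomputable def approxDirac (ε y : ℝ) : ℝ := ε⁻¹ * deriv cutoff (y / ε)

lemma continuous_approxDirac (ε : ℝ) : Continuous (approxDirac ε) :=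
  continuous_const.mul (continuous_deriv_cutoff.comp (continuous_id.div_const ε))

lemma approxDirac_of_notMem {ε y : ℝ} (hε : 0 < ε) (h : y ∉ Icc ε (2 * ε)) :
    approxDirac ε y = 0 := by
  rw [approxDirac, deriv_cutoff_of_notMem, mul_zero]
  rintro ⟨h1, h2⟩
  rw [lt_div_iff₀ hε] at h1
  rw [div_lt_iff₀ hε] at h2
  exact h ⟨by linarith, h2.le⟩

lemma integral_approxDirac_mul {ε : ℝ} (hε : 0 < ε) (g : ℝ → ℝ) :
    ∫ y, approxDirac ε y * g y = ∫ τ, deriv cutoff τ * g (ε * τ) := by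
  have := Measure.integral_comp_mul_left (fun y => approxDirac ε y * g y) ε
  rw [abs_of_pos (inv_pos.2 hε), smul_eq_mul, eq_comm, inv_mul_eq_iff_eq_mul₀ hε.ne'] at this
  rw [this, ← integral_const_mul]
  congr 1
  ext τ
  rw [approxDirac, mul_div_cancel_left₀ _ hε.ne', ← mul_assoc, ← mul_assoc,
    mul_inv_cancel₀ hε.ne', one_mul]

/-- After the rescaling `y = ε τ` the kernel no longer depends on `ε` and lives on `1 < τ < 2`.
Dominated convergence then only asks for limits along `y = ε τ`, so `g` may itself depend on `ε`, as
products with cutoffs do. -/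
lemma tendsto_integral_approxDirac_mul {g : ℝ → ℝ → ℝ} {M g₀ : ℝ}
    (hg : ∀ ε, 0 < ε → Measurable (g ε)) (hM : ∀ ε, 0 < ε → ∀ y, |g ε y| ≤ M)
    (hlim : ∀ τ ∈ Ioo (1 : ℝ) 2, Tendsto (fun ε => g ε (ε * τ)) (𝓝[>] 0) (𝓝 g₀)) :
    Tendsto (fun ε => ∫ y, approxDirac ε y * g ε y) (𝓝[>] 0) (𝓝 g₀) := by
  have h1 : Tendsto (fun ε => ∫ τ, deriv cutoff τ * g ε (ε * τ)) (𝓝[>] 0)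
      (𝓝 (∫ τ, deriv cutoff τ * g₀)) := by
    refine tendsto_integral_filter_of_dominated_convergence (fun τ => |deriv cutoff τ| * M)
      ?_ ?_ (integrable_deriv_cutoff.abs.mul_const M) ?_
    · filter_upwards [self_mem_nhdsWithin] with ε hε
      exact (continuous_deriv_cutoff.measurable.mul ((hg ε hε).comp
        (measurable_const_mul ε))).aestronglyMeasurable
    · filter_upwards [self_mem_nhdsWithin] with ε hε
      refine Eventually.of_forall fun τ => ?_
      rw [Real.norm_eq_abs, abs_mul]
      exact mul_le_mul_of_nonneg_left (hM ε hε _) (abs_nonneg _)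
    · refine Eventually.of_forall fun τ => ?_
      by_cases hτ : τ ∈ Ioo (1 : ℝ) 2
      · exact (hlim τ hτ).const_mul _
      · simp [deriv_cutoff_of_notMem hτ]
  rw [integral_mul_const, integral_deriv_cutoff, one_mul] at h1
  refine h1.congr' ?_
  filter_upwards [self_mem_nhdsWithin] with ε hε
  exact (integral_approxDirac_mul hε _).symm

/-- A bound uniform in `ε`, used as majorant over the slices of the triangle. -/
lemma abs_integral_approxDirac_mul_le {g : ℝ → ℝ} {M ε : ℝ} (hε : 0 < ε)
    (hM : ∀ y, |g y| ≤ M) :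
    |∫ y, approxDirac ε y * g y| ≤ (∫ τ, |deriv cutoff τ|) * M := by
  rw [integral_approxDirac_mul hε, ← integral_mul_const, ← Real.norm_eq_abs]
  refine norm_integral_le_of_norm_le (integrable_deriv_cutoff.abs.mul_const M) ?_
  refine Eventually.of_forall fun τ => ?_
  rw [Real.norm_eq_abs, abs_mul]
  exact mul_le_mul_of_nonneg_left (hM _) (abs_nonneg _)

lemma measurable_indicator_of_continuousOn {X : Type*} [TopologicalSpace X] [MeasurableSpace X]
    [OpensMeasurableSpace X] {F : X → ℝ} {s : Set X} (hF : ContinuousOn F s)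
    (hs : MeasurableSet s) : Measurable (s.indicator F) := by
  classical
  rw [← piecewise_eq_indicator]
  exact hF.measurable_piecewise continuousOn_const hs

/-- Concentration of integrals over the interval `[0, 1]` at the point `0`. -/
lemma tendsto_setIntegral_approxDirac {F : ℝ → ℝ} (hF : ContinuousOn F (Icc 0 1))
    {κ : ℝ → ℝ → ℝ} {M : ℝ} (hκ : ∀ ε, 0 < ε → Continuous (κ ε))
    (hM : ∀ ε, 0 < ε → ∀ y, |κ ε y| ≤ M)
    (hlim : ∀ τ ∈ Ioo (1 : ℝ) 2, Tendsto (fun ε => κ ε (ε * τ)) (𝓝[>] 0) (𝓝 1)) :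
    Tendsto (fun ε => ∫ y in Icc 0 1, approxDirac ε y * (κ ε y * F y)) (𝓝[>] 0) (𝓝 (F 0)) := by
  obtain ⟨N, hN⟩ := isCompact_Icc.exists_bound_of_continuousOn hF
  have hM0 : 0 ≤ M := (abs_nonneg _).trans (hM 1 one_pos 0)
  have hN0 : 0 ≤ N := (norm_nonneg _).trans (hN 0 ⟨le_rfl, zero_le_one⟩)
  have key := tendsto_integral_approxDirac_mul (g := fun ε y => κ ε y * (Icc 0 1).indicator F y)
    (M := M * N) (g₀ := F 0) ?_ ?_ ?_
  · refine key.congr fun ε => ?_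
    rw [← integral_indicator measurableSet_Icc]
    congr 1
    ext y
    by_cases hy : y ∈ Icc (0 : ℝ) 1 <;> simp [hy]
  · intro ε hε
    refine (hκ ε hε).measurable.mul ?_
    exact measurable_indicator_of_continuousOn hF measurableSet_Icc
  · intro ε hε y
    rw [abs_mul]
    refine mul_le_mul (hM ε hε y) ?_ (abs_nonneg _) hM0
    by_cases hy : y ∈ Icc (0 : ℝ) 1
    · simpa [hy] using hN y hy
    · simpa [hy] using hN0
  · intro τ hτ
    have h1 : Tendsto (fun ε : ℝ => ε * τ) (𝓝[>] 0) (𝓝[Icc 0 1] 0) := by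
      refine tendsto_nhdsWithin_iff.2 ⟨?_, ?_⟩
      · have : Tendsto (fun ε : ℝ => ε * τ) (𝓝 0) (𝓝 (0 * τ)) := tendsto_id.mul_const τ
        rw [zero_mul] at this
        exact this.mono_left nhdsWithin_le_nhds
      · filter_upwards [Ioo_mem_nhdsGT (show (0 : ℝ) < 1 / 2 by norm_num)] with ε hε
        exact ⟨mul_nonneg hε.1.le (by linarith [hτ.1]), by nlinarith [hτ.1, hτ.2, hε.1, hε.2]⟩
    have h2 : Tendsto (fun ε => F (ε * τ)) (𝓝[>] 0) (𝓝 (F 0)) :=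
      (hF 0 ⟨le_rfl, zero_le_one⟩).tendsto.comp h1
    have h3 := (hlim τ hτ).mul h2
    rw [one_mul] at h3
    refine h3.congr' ?_
    have h4 := h1 self_mem_nhdsWithin
    filter_upwards [h4] with ε hε
    rw [indicator_of_mem (mem_preimage.1 hε)]

lemma mem_refSimplex_two {s y : ℝ} : ![s, y] ∈ refSimplex 2 ↔ 0 ≤ s ∧ 0 ≤ y ∧ s + y ≤ 1 := by
  simp [refSimplex, Fin.forall_fin_two, Fin.sum_univ_two, and_assoc]

lemma setIntegral_refSimplex_two (f : (Fin 2 → ℝ) → ℝ) (hf : IntegrableOn f (refSimplex 2)) :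
    Integrable (fun p : ℝ × ℝ => (refSimplex 2).indicator f ![p.1, p.2]) ∧
    ∫ t in refSimplex 2, f t = ∫ s : ℝ, ∫ y : ℝ, (refSimplex 2).indicator f ![s, y] := by
  have hm := (isCompact_refSimplex 2).measurableSet
  have h1 := (volume_preserving_finTwoArrow ℝ).symm
  have h2 : Integrable (fun p : ℝ × ℝ => (refSimplex 2).indicator f ![p.1, p.2]) := by
    have := h1.integrable_comp_emb (MeasurableEquiv.measurableEmbedding _)
      (g := (refSimplex 2).indicator f)
    exact this.2 ((integrable_indicator_iff hm).2 hf)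
  refine ⟨h2, ?_⟩
  rw [← integral_indicator hm, ← h1.integral_comp (MeasurableEquiv.measurableEmbedding _)]
  exact integral_prod _ h2

/-- Concentration of integrals over the reference triangle on the edge `t₁ = 0`. -/
lemma tendsto_setIntegral_approxDirac_edge {F : (Fin 2 → ℝ) → ℝ}
    (hF : ContinuousOn F (refSimplex 2)) {κ : ℝ → (Fin 2 → ℝ) → ℝ} {M : ℝ} {κ₀ : ℝ → ℝ}
    (hκ : ∀ ε, 0 < ε → Continuous (κ ε)) (hM : ∀ ε, 0 < ε → ∀ t, |κ ε t| ≤ M)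
    (hlim : ∀ s ∈ Ioo (0 : ℝ) 1, ∀ τ ∈ Ioo (1 : ℝ) 2,
      Tendsto (fun ε => κ ε ![s, ε * τ]) (𝓝[>] 0) (𝓝 (κ₀ s))) :
    Tendsto (fun ε => ∫ t in refSimplex 2, approxDirac ε (t 1) * (κ ε t * F t)) (𝓝[>] 0)
      (𝓝 (∫ s in Icc 0 1, κ₀ s * F ![s, 0])) := by
  obtain ⟨N, hN⟩ := (isCompact_refSimplex 2).exists_bound_of_continuousOn hF
  have h0 : ![0, 0] ∈ refSimplex 2 := mem_refSimplex_two.2 (by norm_num)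
  have hM0 : 0 ≤ M := (abs_nonneg _).trans (hM 1 one_pos 0)
  have hN0 : 0 ≤ N := (norm_nonneg _).trans (hN _ h0)
  have hm := (isCompact_refSimplex 2).measurableSet
  have hmk : Measurable fun p : ℝ × ℝ => ![p.1, p.2] :=
    (volume_preserving_finTwoArrow ℝ).symm.measurable
  have hind : Measurable ((refSimplex 2).indicator F) :=
    measurable_indicator_of_continuousOn hF hm
  have hg : ∀ ε t, (refSimplex 2).indicator (fun t => approxDirac ε (t 1) * (κ ε t * F t)) t =
      approxDirac ε (t 1) * (κ ε t * (refSimplex 2).indicator F t) := fun ε t => by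
    by_cases ht : t ∈ refSimplex 2 <;> simp [ht]
  have hint : ∀ ε, 0 < ε → IntegrableOn (fun t => approxDirac ε (t 1) * (κ ε t * F t))
      (refSimplex 2) := fun ε hε => by
    refine ContinuousOn.integrableOn_compact (isCompact_refSimplex 2) ?_
    exact ((continuous_approxDirac ε).comp (continuous_apply 1)).continuousOn.mul
      ((hκ ε hε).continuousOn.mul hF)
  have hbound : ∀ ε, 0 < ε → ∀ t, |κ ε t * (refSimplex 2).indicator F t| ≤ M * N := by
    intro ε hε t
    rw [abs_mul]
    refine mul_le_mul (hM ε hε t) ?_ (abs_nonneg _) hM0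
    by_cases ht : t ∈ refSimplex 2
    · simpa [ht] using hN t ht
    · simpa [ht] using hN0
  rw [← integral_indicator measurableSet_Icc]
  -- Each slice `s = const` concentrates at `y = 0`; the integral over `s` follows by dominated
  -- convergence.
  have key : Tendsto (fun ε => ∫ s : ℝ, ∫ y : ℝ, approxDirac ε y *
      (κ ε ![s, y] * (refSimplex 2).indicator F ![s, y])) (𝓝[>] 0)
      (𝓝 (∫ s, (Icc (0 : ℝ) 1).indicator (fun s => κ₀ s * F ![s, 0]) s)) := by
    refine tendsto_integral_filter_of_dominated_convergence
      (fun s => (Icc (0 : ℝ) 1).indicator (fun _ => (∫ τ, |deriv cutoff τ|) * (M * N)) s)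
      ?_ ?_ ?_ ?_
    · filter_upwards [self_mem_nhdsWithin] with ε hε
      have := (setIntegral_refSimplex_two _ (hint ε hε)).1
      simp only [hg] at this
      exact this.integral_prod_left.aestronglyMeasurable
    · filter_upwards [self_mem_nhdsWithin] with ε hε
      refine Eventually.of_forall fun s => ?_
      by_cases hs : s ∈ Icc (0 : ℝ) 1
      · rw [indicator_of_mem hs]
        exact abs_integral_approxDirac_mul_le hε fun y => hbound ε hε _
      · have : ∀ y, ![s, y] ∉ refSimplex 2 := fun y hy => by
          rw [mem_refSimplex_two] at hy
          exact hs ⟨hy.1, by linarith⟩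
        simp [this, hs]
    · exact (integrable_indicator_iff measurableSet_Icc).2 (integrableOn_const (by simp))
    -- The endpoints of the edge are discarded: there the cutoffs need not converge to `κ₀`, and at
    -- `s = 1` the slice is reduced to a point.
    · have hne : ∀ᵐ s : ℝ, s ≠ 0 ∧ s ≠ 1 :=
        (Measure.ae_ne volume 0).and (Measure.ae_ne volume 1)
      filter_upwards [hne] with s hs
      by_cases hs' : s ∈ Icc (0 : ℝ) 1
      · have hs1 : s ∈ Ioo (0 : ℝ) 1 :=
          ⟨lt_of_le_of_ne hs'.1 hs.1.symm, lt_of_le_of_ne hs'.2 hs.2⟩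
        rw [indicator_of_mem hs']
        refine tendsto_integral_approxDirac_mul
          (g := fun ε y => κ ε ![s, y] * (refSimplex 2).indicator F ![s, y]) (M := M * N) ?_ ?_ ?_
        · intro ε hε
          exact ((hκ ε hε).measurable.mul hind).comp (hmk.comp measurable_prodMk_left)
        · exact fun ε hε y => hbound ε hε _
        · intro τ hτ
          have h1 : Tendsto (fun ε : ℝ => ![s, ε * τ]) (𝓝[>] 0) (𝓝[refSimplex 2] ![s, 0]) := by
            refine tendsto_nhdsWithin_iff.2 ⟨?_, ?_⟩
            · have hc : Continuous fun ε : ℝ => ![s, ε * τ] := by fun_prop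
              have := hc.tendsto 0
              rw [zero_mul] at this
              exact this.mono_left nhdsWithin_le_nhds
            -- Since `τ < 2`, taking `ε < (1 - s) / 2` keeps the point `(s, ε τ)` in the triangle.
            · have hpos : 0 < (1 - s) / 2 := by linarith [hs1.2]
              filter_upwards [Ioo_mem_nhdsGT hpos] with ε hε
              refine mem_refSimplex_two.2 ⟨hs'.1, mul_nonneg hε.1.le (by linarith [hτ.1]), ?_⟩
              nlinarith [hτ.1, hτ.2, hε.1, hε.2]
          have h2 : Tendsto (fun ε => F ![s, ε * τ]) (𝓝[>] 0) (𝓝 (F ![s, 0])) :=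
            (hF _ (mem_refSimplex_two.2 ⟨hs'.1, le_rfl, by linarith [hs'.2]⟩)).tendsto.comp h1
          refine ((hlim s hs1 τ hτ).mul h2).congr' ?_
          filter_upwards [h1 self_mem_nhdsWithin] with ε hε
          rw [indicator_of_mem (mem_preimage.1 hε)]
      · have : ∀ y, ![s, y] ∉ refSimplex 2 := fun y hy => by
          rw [mem_refSimplex_two] at hy
          exact hs' ⟨hy.1, by linarith⟩
        simp [this, hs']
  refine key.congr' ?_
  filter_upwards [self_mem_nhdsWithin] with ε hε
  rw [(setIntegral_refSimplex_two _ (hint ε hε)).2]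
  simp only [hg]
  rfl

end ApproximateIdentity

/-! ### Symmetries of the reference triangle and edges of the triangle -/

section RefSimplex

open Set MeasureTheory Filter Topology

lemma setIntegral_refSimplex_one (f : (Fin 1 → ℝ) → ℝ) :
    ∫ t in refSimplex 1, f t = ∫ s in Icc (0 : ℝ) 1, f fun _ => s := by
  have h1 := (volume_preserving_funUnique (Fin 1) ℝ).symm
  refine (h1.setIntegral_preimage_emb (MeasurableEquiv.measurableEmbedding _) f
    (refSimplex 1)).symm.trans ?_
  congr 2
  ext s
  simp [refSimplex]

lemma nonempty_interior_refSimplex (m : ℕ) : (interior (refSimplex m)).Nonempty := by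
  refine ⟨fun _ => 1 / (m + 1), ?_⟩
  have hopen : IsOpen {t : Fin m → ℝ | (∀ i, 0 < t i) ∧ ∑ i, t i < 1} := by
    refine IsOpen.inter ?_ (isOpen_lt (f := fun t : Fin m → ℝ => ∑ i, t i) (by fun_prop)
      continuous_const)
    have : {t : Fin m → ℝ | ∀ i, 0 < t i} = ⋂ i, {t : Fin m → ℝ | 0 < t i} := by
      ext t; simp
    change IsOpen {t : Fin m → ℝ | ∀ i, 0 < t i}
    rw [this]
    exact isOpen_iInter_of_finite fun i => isOpen_lt continuous_const (continuous_apply i)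
  refine interior_maximal ?_ hopen ⟨fun i => by positivity, ?_⟩
  · exact fun t ht => ⟨fun i => (ht.1 i).le, ht.2.le⟩
  · simp only [Finset.sum_const, Finset.card_univ, Fintype.card_fin, nsmul_eq_mul]
    rw [mul_one_div, div_lt_one (by positivity)]
    linarith

lemma volume_refSimplex_pos (m : ℕ) : 0 < volume.real (refSimplex m) := by
  refine ENNReal.toReal_pos ?_ (isCompact_refSimplex m).measure_lt_top.ne
  exact (Measure.measure_pos_of_nonempty_interior _ (nonempty_interior_refSimplex m)).ne'

/-- Integrals over a reference simplex are invariant under affine symmetries. -/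
lemma setIntegral_refSimplex_comp {m : ℕ} (L : (Fin m → ℝ) ≃L[ℝ] (Fin m → ℝ)) (a : Fin m → ℝ)
    (hA : ∀ x, L x + a ∈ refSimplex m ↔ x ∈ refSimplex m) (F : (Fin m → ℝ) → ℝ) :
    ∫ x in refSimplex m, F (L x + a) = ∫ x in refSimplex m, F x := by
  have himg : (fun x => L x + a) '' refSimplex m = refSimplex m := by
    ext y
    constructor
    · rintro ⟨x, hx, rfl⟩
      exact (hA x).2 hx
    · intro hy
      refine ⟨L.symm (y - a), (hA _).1 (by simpa using hy), by simp⟩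
  have key : ∀ F : (Fin m → ℝ) → ℝ, ∫ x in refSimplex m, F x =
      |(L : (Fin m → ℝ) →L[ℝ] (Fin m → ℝ)).det| * ∫ x in refSimplex m, F (L x + a) := by
    intro F
    have := integral_image_eq_integral_abs_det_fderiv_smul volume
      (isCompact_refSimplex m).measurableSet (f := fun x => L x + a)
      (f' := fun _ => (L : (Fin m → ℝ) →L[ℝ] (Fin m → ℝ)))
      (fun x _ => (L.hasFDerivAt.add_const a).hasFDerivWithinAt)
      (fun x _ y _ hxy => L.injective (add_right_cancel hxy)) F
    rw [himg] at this
    rw [this, ← integral_const_mul]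
    rfl
  -- Comparing volumes identifies the Jacobian as one, without computing a determinant.
  have h1 := key fun _ => 1
  simp only [setIntegral_const, smul_eq_mul, mul_one] at h1
  have hdet : |(L : (Fin m → ℝ) →L[ℝ] (Fin m → ℝ)).det| = 1 := by
    have := volume_refSimplex_pos m
    field_simp at h1
    exact h1.symm
  rw [key F, hdet, one_mul]

/-- The symmetry `(t₀, t₁) ↦ (t₁, t₀)` of the plane. -/
noncomputable def swapL : (Fin 2 → ℝ) ≃L[ℝ] (Fin 2 → ℝ) :=
  LinearEquiv.toContinuousLinearEquiv
    { toFun := fun t => ![t 1, t 0]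
      invFun := fun t => ![t 1, t 0]
      map_add' := fun a b => by ext i; fin_cases i <;> simp
      map_smul' := fun a b => by ext i; fin_cases i <;> simp
      left_inv := fun a => by ext i; fin_cases i <;> simp
      right_inv := fun a => by ext i; fin_cases i <;> simp }

/-- The linear part `(t₀, t₁) ↦ (- t₀ - t₁, t₀)` of a symmetry of order three of the reference
triangle. -/
noncomputable def rotL : (Fin 2 → ℝ) ≃L[ℝ] (Fin 2 → ℝ) :=
  LinearEquiv.toContinuousLinearEquiv
    { toFun := fun t => ![- t 0 - t 1, t 0]
      invFun := fun t => ![t 1, - t 0 - t 1]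
      map_add' := fun a b => by ext i; fin_cases i <;> (simp; try ring)
      map_smul' := fun a b => by ext i; fin_cases i <;> (simp; try ring)
      left_inv := fun a => by ext i; fin_cases i <;> simp
      right_inv := fun a => by ext i; fin_cases i <;> (simp; try ring) }

lemma swapL_apply (t : Fin 2 → ℝ) : swapL t = ![t 1, t 0] := rfl

lemma rotL_apply (t : Fin 2 → ℝ) : rotL t = ![- t 0 - t 1, t 0] := rfl

lemma mem_refSimplex_two' {t : Fin 2 → ℝ} :
    t ∈ refSimplex 2 ↔ 0 ≤ t 0 ∧ 0 ≤ t 1 ∧ t 0 + t 1 ≤ 1 := by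
  simp [refSimplex, Fin.forall_fin_two, Fin.sum_univ_two, and_assoc]

lemma swapL_mem (x : Fin 2 → ℝ) : swapL x + 0 ∈ refSimplex 2 ↔ x ∈ refSimplex 2 := by
  simp only [mem_refSimplex_two', swapL_apply]
  simp
  constructor <;> rintro ⟨h1, h2, h3⟩ <;> refine ⟨h2, h1, by linarith⟩

lemma rotL_mem (x : Fin 2 → ℝ) : rotL x + ![1, 0] ∈ refSimplex 2 ↔ x ∈ refSimplex 2 := by
  simp only [mem_refSimplex_two', rotL_apply]
  simp
  constructor <;> rintro ⟨h1, h2, h3⟩ <;> refine ⟨by linarith, by linarith, by linarith⟩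

end RefSimplex

section Edges

open Set

lemma card_triTop : triTop.1.card = 2 + 1 := rfl

lemma cellVertex_triTop (v : Fin 3 → Plane) (i : Fin 3) :
    cellVertex v triTop card_triTop i = v i := by
  have : (id : Fin 3 → Fin 3) = triTop.1.orderEmbOfFin card_triTop :=
    Finset.orderEmbOfFin_unique card_triTop (fun x => Finset.mem_univ _) strictMono_id
  rw [cellVertex, ← this]
  rfl

lemma cellVertex_pair (v : Fin 3 → Plane) {c : TriCell} (h : c.1.card = 1 + 1) {i j : Fin 3}
    (hij : i < j) (hc : c.1 = {i, j}) :
    cellVertex v c h 0 = v i ∧ cellVertex v c h 1 = v j := by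
  have : ![i, j] = c.1.orderEmbOfFin h :=
    Finset.orderEmbOfFin_unique h (fun x => by rw [hc]; fin_cases x <;> simp) (by
      intro a b hab
      fin_cases a <;> fin_cases b <;> simp_all)
  rw [cellVertex, cellVertex, ← this]
  exact ⟨rfl, rfl⟩

lemma cellVertex_singleton (v : Fin 3 → Plane) {c : TriCell} (h : c.1.card = 0 + 1) {i : Fin 3}
    (hc : c.1 = {i}) : cellVertex v c h 0 = v i := by
  rw [cellVertex, Finset.mem_singleton.1 (hc.subset (Finset.orderEmbOfFin_mem c.1 h 0))]

lemma exists_pair_of_card {c : TriCell} (h : c.1.card = 1 + 1) :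
    c.1 = {0, 1} ∨ c.1 = {0, 2} ∨ c.1 = {1, 2} := by
  obtain ⟨c, hc⟩ := c
  revert hc h
  revert c
  decide

lemma eq_triTop_of_card {c : TriCell} (h : c.1.card = 2 + 1) : c = triTop :=
  Subtype.ext (Finset.card_eq_iff_eq_univ _ |>.1 (by simpa using h))

lemma cellTangent_triTop (v : Fin 3 → Plane) (η : Fin 2 → ℝ) :
    cellTangent v triTop card_triTop η = η 0 • (v 1 - v 0) + η 1 • (v 2 - v 0) := by
  simp only [cellTangent, Fin.sum_univ_two, cellVertex_triTop]
  rfl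

lemma cellParam_triTop (v : Fin 3 → Plane) (t : Fin 2 → ℝ) :
    cellParam v triTop card_triTop t = v 0 + (t 0 • (v 1 - v 0) + t 1 • (v 2 - v 0)) := by
  rw [cellParam, cellTangent_triTop, cellVertex_triTop]

lemma cellTangent_pair (v : Fin 3 → Plane) {c : TriCell} (h : c.1.card = 1 + 1) {i j : Fin 3}
    (hij : i < j) (hc : c.1 = {i, j}) (η : Fin 1 → ℝ) :
    cellTangent v c h η = η 0 • (v j - v i) := by
  obtain ⟨h0, h1⟩ := cellVertex_pair v h hij hc
  simp only [cellTangent, Fin.sum_univ_one, h0]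
  rw [← h1]
  rfl

lemma cellParam_pair (v : Fin 3 → Plane) {c : TriCell} (h : c.1.card = 1 + 1) {i j : Fin 3}
    (hij : i < j) (hc : c.1 = {i, j}) (t : Fin 1 → ℝ) :
    cellParam v c h t = v i + t 0 • (v j - v i) := by
  rw [cellParam, cellTangent_pair v h hij hc, (cellVertex_pair v h hij hc).1]

/-- Each edge is the image of the edge `t₁ = 0` under an affine symmetry of the reference
triangle. -/
lemma exists_symm_of_edge (v : Fin 3 → Plane) {c : TriCell} (h : c.1.card = 1 + 1) :
    ∃ (L : (Fin 2 → ℝ) ≃L[ℝ] (Fin 2 → ℝ)) (a : Fin 2 → ℝ),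
      (∀ x, L x + a ∈ refSimplex 2 ↔ x ∈ refSimplex 2) ∧
      (∀ η, cellTangent v c h η = cellTangent v triTop card_triTop (L ![η 0, 0])) ∧
      ∀ t, cellParam v c h t = cellParam v triTop card_triTop (L ![t 0, 0] + a) := by
  rcases exists_pair_of_card h with hc | hc | hc
  · refine ⟨ContinuousLinearEquiv.refl _ _, 0, fun x => by simp, fun η => ?_, fun t => ?_⟩
    · rw [cellTangent_pair v h (by decide) hc, cellTangent_triTop]; simp
    · rw [cellParam_pair v h (by decide) hc, cellParam_triTop]; simp
  · refine ⟨swapL, 0, swapL_mem, fun η => ?_, fun t => ?_⟩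
    · rw [cellTangent_pair v h (by decide) hc, cellTangent_triTop, swapL_apply]; simp
    · rw [cellParam_pair v h (by decide) hc, cellParam_triTop, swapL_apply]; simp
  -- The edge opposite to the vertex `0` is run from `(1, 0)` to `(0, 1)`, as `s ↦ (1 - s, s)`.
  · refine ⟨rotL, ![1, 0], rotL_mem, fun η => ?_, fun t => ?_⟩
    · rw [cellTangent_pair v h (by decide) hc, cellTangent_triTop, rotL_apply]; simp
      module
    · rw [cellParam_pair v h (by decide) hc, cellParam_triTop, rotL_apply]; simp
      module

end Edges

/-! ### Differentials and traces of admissible pairs -/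

section Trace

open Set MeasureTheory Filter Topology

/-- Only `k = 0` has content, the cells having dimension at most two. Admissibility is applied to
the test functions `∂_a φ`, and the two resulting terms cancel by symmetry of the second derivative.
-/
lemma isAdmissible_d (v : Fin 3 → Plane) (c : TriCell) (k : ℕ) {z : FormPair v c k}
    (hz : IsAdmissible v c k z) : IsAdmissible v c (k + 1) (z.2, 0) := by
  have hcard : c.1.card ≤ 3 := c.1.card_le_univ
  rcases Nat.eq_zero_or_pos k with rfl | hk
  · intro m h φ h1 h2 h3 η
    have key : ∀ a b : Fin m → ℝ, ∫ t in refSimplex m, fderiv ℝ φ t a *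
        extZero z.2 (cellParam v c h t) (fun _ => cellTangent v c h b) =
        - ∫ t in refSimplex m, fderiv ℝ (fderiv ℝ φ) t b a *
          extZero z.1 (cellParam v c h t) ![] := by
      intro a b
      have hdd : ∀ t, fderiv ℝ (fun t => fderiv ℝ φ t a) t b = fderiv ℝ (fderiv ℝ φ) t b a := by
        intro t
        have hd : DifferentiableAt ℝ (fderiv ℝ φ) t :=
          ((h1.fderiv_right (m := ∞) (by simp)).differentiable (by simp)) t
        rw [fderiv_clm_apply hd (differentiableAt_const a)]
        simp
      have := hz m h (fun t => fderiv ℝ φ t a)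
        ((h1.fderiv_right (m := ∞) (by simp)).clm_apply contDiff_const)
        (h2.fderiv_apply ℝ a)
        ((tsupport_fderiv_apply_subset ℝ a).trans h3) (fun _ => b)
      simp only [hdd] at this
      rw [this]
      simp only [Fin.sum_univ_succ, Fin.sum_univ_zero]
      simp [Subsingleton.elim (fun j : Fin 0 => cellTangent v c h b) ![]]
    have hsymm : ∀ t a b, fderiv ℝ (fderiv ℝ φ) t b a = fderiv ℝ (fderiv ℝ φ) t a b :=
      fun t a b => ((contDiff_infty.1 h1 2).contDiffAt (x := t)).isSymmSndFDerivAt (by simp) b a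
    have e0 := key (η 0) (η 1)
    have e1 := key (η 1) (η 0)
    simp only [hsymm _ (η 1) (η 0)] at e1
    have f0 : (fun j : Fin 1 => cellTangent v c h (η ((0 : Fin 2).succAbove j))) =
        fun _ => cellTangent v c h (η 1) := by ext1 j; fin_cases j; rfl
    have f1 : (fun j : Fin 1 => cellTangent v c h (η ((1 : Fin 2).succAbove j))) =
        fun _ => cellTangent v c h (η 0) := by ext1 j; fin_cases j; rfl
    simp only [extZero_zero, Nat.reduceAdd, Fin.sum_univ_two, f0, f1, e0, e1]
    simp
  · exact isAdmissible_of_le v c (by omega) _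

/-- Traces on edges of functions with continuous differential on the triangle. -/
lemma isAdmissible_trace_edge (v : Fin 3 → Plane) {c : TriCell} (h : c.1.card = 1 + 1)
    {z : FormPair v triTop 0} (hz : IsAdmissible v triTop 0 z) :
    IsAdmissible v c 0 (traceForm v c.le_triTop 0 z.1, traceForm v c.le_triTop 1 z.2) := by
  intro m h' φ hφ hφc hφs η
  obtain rfl : m = 1 := by omega
  obtain ⟨L, a, hA, hT, hP⟩ := exists_symm_of_edge v h
  have hApply : ∀ (k : ℕ) (f : C(cellSet v triTop, AltForm k)) (t : Fin 1 → ℝ),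
      t ∈ refSimplex 1 → extZero (traceForm v c.le_triTop k f) (cellParam v c h t) =
        extZero f (cellParam v triTop card_triTop (L ![t 0, 0] + a)) := by
    intro k f t ht
    rw [extZero_apply _ (cellParam_mem v c h ht), ← hP t,
      extZero_apply f (cellSet_mono v c.le_triTop (cellParam_mem v c h ht))]
    rfl
  set F : (Fin 2 → ℝ) → ℝ := fun x =>
    extZero z.1 (cellParam v triTop card_triTop (L x + a)) ![] with hF
  set H : (Fin 2 → ℝ) → ℝ := fun x => extZero z.2 (cellParam v triTop card_triTop (L x + a))
    (fun j => cellTangent v c h (η j)) with hH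
  have hmaps : MapsTo (fun x => L x + a) (refSimplex 2) (refSimplex 2) := fun x hx => (hA x).2 hx
  have hLa : Continuous fun x => L x + a := by fun_prop
  have hFc : ContinuousOn F (refSimplex 2) :=
    (continuousOn_extZero_cellParam v triTop card_triTop z.1 ![]).comp hLa.continuousOn hmaps
  have hHc : ContinuousOn H (refSimplex 2) :=
    (continuousOn_extZero_cellParam v triTop card_triTop z.2 _).comp hLa.continuousOn hmaps
  let pr : (Fin 2 → ℝ) →L[ℝ] (Fin 1 → ℝ) :=
    ContinuousLinearMap.pi fun _ => ContinuousLinearMap.proj 0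
  have hpr : ∀ x, pr x = fun _ => x 0 := fun x => rfl
  -- the two limits
  have hlim : ∀ (κ : (Fin 1 → ℝ) → ℝ) (G : (Fin 2 → ℝ) → ℝ), Continuous κ → HasCompactSupport κ →
      ContinuousOn G (refSimplex 2) →
      Tendsto (fun ε => ∫ x in refSimplex 2, approxDirac ε (x 1) * (κ (pr x) * G x)) (𝓝[>] 0)
        (𝓝 (∫ t in refSimplex 1, κ t * G ![t 0, 0])) := by
    intro κ G hκ hκc hG
    obtain ⟨M, hM⟩ := hκ.bounded_above_of_compact_support hκc
    rw [setIntegral_refSimplex_one]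
    refine tendsto_setIntegral_approxDirac_edge hG (κ := fun _ x => κ (pr x)) (M := M)
      (κ₀ := fun s => κ fun _ => s) (fun _ _ => hκ.comp pr.continuous) (fun _ _ t => hM _) ?_
    intro s _ τ _
    exact tendsto_const_nhds
  have hφd : Continuous fun t => fderiv ℝ φ t (η 0) :=
    (hφ.continuous_fderiv (by simp)).clm_apply continuous_const
  have l1 := hlim φ H hφ.continuous hφc hHc
  have l2 := hlim (fun t => fderiv ℝ φ t (η 0)) F hφd (hφc.fderiv_apply ℝ (η 0)) hFc
  -- the support of the test function stays away from the endpoints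
  obtain ⟨δ, hδ, hsupp⟩ : ∃ δ > 0, ∀ s : ℝ, φ (fun _ => s) ≠ 0 → δ ≤ s ∧ s ≤ 1 - δ := by
    have hint : interior (refSimplex 1) ⊆ {t | 0 < t 0 ∧ t 0 < 1} := by
      intro t ht
      have e : (fun s : ℝ => (fun _ : Fin 1 => s)) ⁻¹' refSimplex 1 = Icc 0 1 := by
        ext s; simp [refSimplex]
      have hc : Continuous fun s : ℝ => (fun _ : Fin 1 => s) := by fun_prop
      have := preimage_interior_subset_interior_preimage (t := refSimplex 1) hc
      rw [e, interior_Icc] at this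
      have ht' : t = fun _ => t 0 := by ext i; fin_cases i; rfl
      exact this (show (fun _ : Fin 1 => t 0) ∈ _ from ht' ▸ ht)
    have hcont : Continuous fun t : Fin 1 → ℝ => min (t 0) (1 - t 0) := by fun_prop
    rcases (tsupport φ).eq_empty_or_nonempty with he | hne
    · refine ⟨1, one_pos, fun s hs => ?_⟩
      exact absurd (subset_tsupport φ hs) (by rw [he]; simp)
    · obtain ⟨t₀, ht₀, hmin⟩ := hφc.isCompact.exists_isMinOn hne hcont.continuousOn
      have h0 := hint (hφs ht₀)
      refine ⟨min (t₀ 0) (1 - t₀ 0), lt_min h0.1 (by linarith [h0.2]), fun s hs => ?_⟩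
      have := isMinOn_iff.1 hmin _ (subset_tsupport φ hs)
      rw [le_min_iff] at this
      exact ⟨this.1, by linarith [this.2]⟩
  -- Admissibility on the triangle is tested with `φ(x₀)` times an approximate Dirac mass in `x₁`.
  -- Differentiation along the edge does not act on the second factor, so both sides concentrate on
  -- the edge when `ε` tends to zero.
  have heq : ∀ᶠ ε in 𝓝[>] (0 : ℝ),
      ∫ x in refSimplex 2, approxDirac ε (x 1) * (φ (pr x) * H x) =
      - ∫ x in refSimplex 2, approxDirac ε (x 1) * (fderiv ℝ φ (pr x) (η 0) * F x) := by
    filter_upwards [Ioo_mem_nhdsGT (show 0 < δ / 4 by positivity)] with ε hε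
    let Φ : (Fin 2 → ℝ) → ℝ := fun x => φ (pr x) * approxDirac ε (x 1)
    let K : Set (Fin 2 → ℝ) := Icc ![δ, ε] ![1 - δ, 2 * ε]
    have hΦK : ∀ x, Φ x ≠ 0 → x ∈ K := by
      intro x hx
      have h1 := hsupp (x 0) (left_ne_zero_of_mul hx)
      have h2 : x 1 ∈ Icc ε (2 * ε) := by
        by_contra hcon
        exact right_ne_zero_of_mul hx (approxDirac_of_notMem hε.1 hcon)
      refine ⟨fun i => ?_, fun i => ?_⟩
      · fin_cases i
        · exact h1.1
        · exact h2.1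
      · fin_cases i
        · exact h1.2
        · exact h2.2
    have hKint : K ⊆ interior (refSimplex 2) := by
      have hopen : IsOpen {x : Fin 2 → ℝ | 0 < x 0 ∧ 0 < x 1 ∧ x 0 + x 1 < 1} :=
        (isOpen_lt continuous_const (continuous_apply 0)).inter
          ((isOpen_lt continuous_const (continuous_apply 1)).inter
            (isOpen_lt ((continuous_apply 0).add (continuous_apply 1)) continuous_const))
      refine Subset.trans ?_ (interior_maximal (t := {x : Fin 2 → ℝ | 0 < x 0 ∧ 0 < x 1 ∧
        x 0 + x 1 < 1}) ?_ hopen)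
      · rintro x ⟨hx, hx'⟩
        have h0 := hx 0
        have h1 := hx 1
        have h2 := hx' 0
        have h3 := hx' 1
        simp at h0 h1 h2 h3
        have := hε.1
        have := hε.2
        exact ⟨by linarith, by linarith, by linarith⟩
      · rintro x ⟨h0, h1, h2⟩
        exact mem_refSimplex_two'.2 ⟨h0.le, h1.le, h2.le⟩
    have haD : ContDiff ℝ ∞ (approxDirac ε) :=
      contDiff_const.mul ((contDiff_infty_iff_deriv.1 contDiff_cutoff).2.comp
        (contDiff_id.div_const ε))
    have hΦs : ContDiff ℝ ∞ Φ := (hφ.comp pr.contDiff).mul (haD.comp (contDiff_apply ℝ ℝ 1))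
    let Ai : (Fin 2 → ℝ) → (Fin 2 → ℝ) := fun y => L.symm (y - a)
    have hAi : Continuous Ai := by fun_prop
    have hAAi : ∀ y, L (Ai y) + a = y := fun y => by simp [Ai]
    have hAiA : ∀ x, Ai (L x + a) = x := fun x => by simp [Ai]
    -- The test function is built for the edge `t₁ = 0` and transported to the given edge by the
    -- affine symmetry.
    let Θ : (Fin 2 → ℝ) → ℝ := fun y => Φ (Ai y)
    have hΘs : ContDiff ℝ ∞ Θ :=
      hΦs.comp (L.symm.contDiff.comp (contDiff_id.sub contDiff_const))
    have hΘc : HasCompactSupport Θ := by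
      refine HasCompactSupport.of_support_subset_isCompact
        ((isCompact_Icc (a := ![δ, ε]) (b := ![1 - δ, 2 * ε])).image hLa) fun y hy => ?_
      exact ⟨Ai y, hΦK _ hy, hAAi y⟩
    have hΘi : tsupport Θ ⊆ interior (refSimplex 2) := by
      have h1 : tsupport Θ ⊆ Ai ⁻¹' K :=
        closure_minimal (fun y hy => hΦK _ hy) (isClosed_Icc.preimage hAi)
      refine (h1.trans (preimage_mono hKint)).trans
        (interior_maximal (fun y hy => ?_) (isOpen_interior.preimage hAi))
      have := (hA (Ai y)).2 (interior_subset hy)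
      rwa [hAAi] at this
    have key := hz 2 card_triTop Θ hΘs hΘc hΘi (fun i => L ![η i 0, 0])
    rw [← setIntegral_refSimplex_comp L a hA] at key
    simp only [← setIntegral_refSimplex_comp L a hA (fun t => fderiv ℝ Θ t _ * _)] at key
    simp only [Nat.reduceAdd, Finset.univ_unique, Fin.default_eq_zero, Finset.sum_singleton,
      Fin.val_zero, pow_zero, one_mul] at key
    have hdir : ∀ x, fderiv ℝ Θ (L x + a) (L ![η 0 0, 0]) =
        fderiv ℝ φ (pr x) (η 0) * approxDirac ε (x 1) := by
      intro x
      have h1 : HasFDerivAt Φ ((fderiv ℝ Θ (L x + a)).comp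
          (L : (Fin 2 → ℝ) →L[ℝ] (Fin 2 → ℝ))) x := by
        have := (hΘs.differentiable (by simp) (L x + a)).hasFDerivAt.comp x
          (L.hasFDerivAt.add_const a)
        refine this.congr_of_eventuallyEq (Eventually.of_forall fun y => ?_)
        simp only [Function.comp, Θ, hAiA]
      have h2 : HasFDerivAt Φ _ x :=
        (((hφ.differentiable (by simp) (pr x)).hasFDerivAt.comp x pr.hasFDerivAt).mul
          (HasFDerivAt.comp (g := approxDirac ε) x
            (haD.differentiable (by simp) (x 1)).hasFDerivAt
            (ContinuousLinearMap.proj (R := ℝ) (φ := fun _ : Fin 2 => ℝ) 1).hasFDerivAt))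
      have h3 := congrArg (fun A => A ![η 0 0, 0]) (h1.unique h2)
      simp only [ContinuousLinearMap.comp_apply, ContinuousLinearEquiv.coe_coe,
        add_apply, smul_apply,
        ContinuousLinearMap.proj_apply, smul_eq_mul] at h3
      rw [h3]
      have h4 : pr ![η 0 0, 0] = η 0 := by ext i; fin_cases i; rfl
      rw [h4]
      simp
      ring
    rw [← sub_eq_zero] at key ⊢
    rw [← key]
    congr 1
    · refine integral_congr_ae (Eventually.of_forall fun x => ?_)
      simp only [hH, Θ, hAiA, Φ, hT]
      ring
    · congr 1
      refine integral_congr_ae (Eventually.of_forall fun x => ?_)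
      simp only [hdir, hF]
      rw [Subsingleton.elim (fun j : Fin 0 => cellTangent v triTop card_triTop
        (L ![η ((0 : Fin 1).succAbove j) 0, 0])) ![]]
      ring
  have := tendsto_nhds_unique_of_eventuallyEq l1 l2.neg heq
  simp only [Nat.reduceAdd, Finset.univ_unique, Fin.default_eq_zero, Finset.sum_singleton,
      Fin.val_zero, pow_zero, one_mul]
  refine Eq.trans ?_ (this.trans ?_)
  · refine setIntegral_congr_fun (isCompact_refSimplex 1).measurableSet fun t ht => ?_
    simp only [hApply _ _ t ht, hH]
  · congr 1
    refine setIntegral_congr_fun (isCompact_refSimplex 1).measurableSet fun t ht => ?_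
    simp only [hApply _ _ t ht, hF]
    rw [Subsingleton.elim (fun j : Fin 0 => cellTangent v c h'
        (η ((0 : Fin 1).succAbove j))) ![]]

/-- Traces of admissible pairs are admissible. -/
lemma isAdmissible_trace (v : Fin 3 → Plane) {c' c : TriCell} (h : c' ≤ c) (k : ℕ)
    {z : FormPair v c k} (hz : IsAdmissible v c k z) :
    IsAdmissible v c' k (traceForm v h k z.1, traceForm v h (k + 1) z.2) := by
  rcases le_or_gt c'.1.card (k + 1) with hk | hk
  · exact isAdmissible_of_le v c' hk _
  · have h1 : c'.1.card ≤ c.1.card := Finset.card_le_card h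
    have h2 : c.1.card ≤ 3 := c.1.card_le_univ
    rcases h1.lt_or_eq with hlt | heq
    -- From `k + 1 < card c' < card c ≤ 3`, only traces of functions from the triangle to an edge
    -- remain.
    · obtain rfl : k = 0 := by omega
      obtain rfl : c = triTop := eq_triTop_of_card (by omega)
      exact isAdmissible_trace_edge v (by omega) hz
    · obtain rfl : c' = c := Subtype.ext (Finset.eq_of_subset_of_card_le h heq.ge)
      exact hz

end Trace

/-! ### Stokes' formula for admissible pairs -/

section Stokes

open Set MeasureTheory Filter Topology

lemma mem_interior_refSimplex {m : ℕ} {t : Fin m → ℝ} (h0 : ∀ i, 0 < t i) (h1 : ∑ i, t i < 1) :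
    t ∈ interior (refSimplex m) := by
  have hopen : IsOpen {t : Fin m → ℝ | (∀ i, 0 < t i) ∧ ∑ i, t i < 1} := by
    refine IsOpen.inter ?_ (isOpen_lt (f := fun t : Fin m → ℝ => ∑ i, t i) (by fun_prop)
      continuous_const)
    have : {t : Fin m → ℝ | ∀ i, 0 < t i} = ⋂ i, {t : Fin m → ℝ | 0 < t i} := by
      ext t; simp
    change IsOpen {t : Fin m → ℝ | ∀ i, 0 < t i}
    rw [this]
    exact isOpen_iInter_of_finite fun i => isOpen_lt continuous_const (continuous_apply i)
  have hsub : {t : Fin m → ℝ | (∀ i, 0 < t i) ∧ ∑ i, t i < 1} ⊆ refSimplex m :=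
    fun t ht => ⟨fun i => (ht.1 i).le, ht.2.le⟩
  exact interior_maximal hsub hopen ⟨h0, h1⟩

lemma exists_add_smul_mem_of_mem_interior {m : ℕ} {t : Fin m → ℝ} (ht : t ∈ interior (refSimplex m))
    (w : Fin m → ℝ) : ∃ s : ℝ, s > 0 ∧ t + s • w ∈ refSimplex m := by
  have hc : Continuous fun s : ℝ => t + s • w := by fun_prop
  have h1 : ∀ᶠ s in 𝓝 (0 : ℝ), t + s • w ∈ refSimplex m := by
    have := hc.continuousAt.preimage_mem_nhds (x := 0)
      (t := refSimplex m) (by simpa using mem_interior_iff_mem_nhds.1 ht)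
    exact this
  obtain ⟨s, hs, hs'⟩ := ((h1.filter_mono nhdsWithin_le_nhds).and
    (self_mem_nhdsWithin (s := Ioi (0 : ℝ)))).exists
  exact ⟨s, hs', hs⟩

lemma pos_of_mem_interior_refSimplex {m : ℕ} {t : Fin m → ℝ} (ht : t ∈ interior (refSimplex m))
    (i : Fin m) : 0 < t i := by
  obtain ⟨s, hs, h⟩ := exists_add_smul_mem_of_mem_interior ht (- Pi.single i 1)
  have := h.1 i
  simp at this
  linarith

lemma sum_lt_one_of_mem_interior_refSimplex {m : ℕ} {t : Fin (m + 1) → ℝ}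
    (ht : t ∈ interior (refSimplex (m + 1))) : ∑ i, t i < 1 := by
  obtain ⟨s, hs, h⟩ := exists_add_smul_mem_of_mem_interior ht (Pi.single 0 1)
  have := h.2
  simp [Finset.sum_add_distrib, ← Finset.mul_sum] at this
  linarith

lemma tendsto_cutoff_div {a : ℝ} (ha : 0 < a) :
    Tendsto (fun ε => cutoff (a / ε)) (𝓝[>] 0) (𝓝 1) := by
  refine tendsto_const_nhds.congr' ?_
  filter_upwards [Ioo_mem_nhdsGT (show 0 < a / 2 by positivity)] with ε hε
  rw [cutoff_of_ge]
  rw [le_div_iff₀ hε.1]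
  linarith [hε.2]

lemma continuous_cutoff_div (ε : ℝ) : Continuous fun a => cutoff (a / ε) :=
  contDiff_cutoff.continuous.comp (continuous_id.div_const ε)

lemma cutoff_div_eq_zero {a ε : ℝ} (hε : 0 < ε) (h : a ≤ ε) : cutoff (a / ε) = 0 :=
  cutoff_of_le ((div_le_one hε).2 h)

lemma abs_cutoff_mul_le (a b : ℝ) : |cutoff a * cutoff b| ≤ 1 := by
  rw [abs_mul]
  exact mul_le_one₀ (abs_cutoff_le a) (abs_nonneg _) (abs_cutoff_le b)

lemma hasDerivAt_cutoff_div (ε a : ℝ) :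
    HasDerivAt (fun a => cutoff (a / ε)) (approxDirac ε a) a := by
  have := (hasDerivAt_cutoff (a / ε)).comp a ((hasDerivAt_id a).div_const ε)
  refine HasDerivAt.congr_deriv this ?_
  unfold approxDirac
  ring

lemma tendsto_setIntegral_cutoff {m : ℕ} {H : (Fin m → ℝ) → ℝ} (hH : ContinuousOn H (refSimplex m))
    {κ : ℝ → (Fin m → ℝ) → ℝ} (hκ : ∀ ε, Continuous (κ ε)) (hM : ∀ ε t, |κ ε t| ≤ 1)
    (hlim : ∀ t ∈ interior (refSimplex m), Tendsto (fun ε => κ ε t) (𝓝[>] 0) (𝓝 1)) :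
    Tendsto (fun ε => ∫ t in refSimplex m, κ ε t * H t) (𝓝[>] 0)
      (𝓝 (∫ t in refSimplex m, H t)) := by
  have hm := (isCompact_refSimplex m).measurableSet
  have hint := hH.integrableOn_compact (μ := volume) (isCompact_refSimplex m)
  refine tendsto_integral_filter_of_dominated_convergence (fun t => |H t|) ?_ ?_ hint.abs ?_
  · exact Eventually.of_forall fun ε => ((hκ ε).continuousOn.mul hH).aestronglyMeasurable hm
  · refine Eventually.of_forall fun ε => Eventually.of_forall fun t => ?_
    rw [Real.norm_eq_abs, abs_mul]
    exact mul_le_of_le_one_left (abs_nonneg _) (hM ε t)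
  · rw [ae_restrict_iff' hm]
    filter_upwards [measure_eq_zero_iff_ae_notMem.1
      ((convex_refSimplex m).addHaar_frontier volume)] with t ht hts
    have hti : t ∈ interior (refSimplex m) := by
      rw [← self_sdiff_frontier]; exact ⟨hts, ht⟩
    simpa using (hlim t hti).mul_const (H t)

/-- The fundamental theorem of calculus for an admissible pair on an edge. -/
lemma stokes_edge (v : Fin 3 → Plane) {c : TriCell} (h : c.1.card = 1 + 1) {z : FormPair v c 0}
    (hz : IsAdmissible v c 0 z) :
    ∫ t in refSimplex 1, extZero z.2 (cellParam v c h t)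
      (fun _ => cellTangent v c h fun _ => 1) =
    extZero z.1 (cellParam v c h fun _ => 1) ![] - extZero z.1 (cellParam v c h fun _ => 0) ![] := by
  set F : ℝ → ℝ := fun s => extZero z.1 (cellParam v c h fun _ => s) ![] with hF
  set H : (Fin 1 → ℝ) → ℝ := fun t => extZero z.2 (cellParam v c h t)
    (fun _ => cellTangent v c h fun _ => 1) with hH
  have hmem : ∀ s ∈ Icc (0 : ℝ) 1, (fun _ : Fin 1 => s) ∈ refSimplex 1 := fun s hs =>
    ⟨fun _ => hs.1, by simpa using hs.2⟩
  have hFc : ContinuousOn F (Icc 0 1) :=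
    (continuousOn_extZero_cellParam v c h z.1 ![]).comp
      (f := fun s : ℝ => fun _ : Fin 1 => s) (by fun_prop) hmem
  have hHc : ContinuousOn H (refSimplex 1) := continuousOn_extZero_cellParam v c h z.2 _
  -- These test functions tend to `1` inside, while their derivatives are approximate Dirac masses
  -- of opposite signs at the two endpoints.
  let φ : ℝ → (Fin 1 → ℝ) → ℝ := fun ε t => cutoff (t 0 / ε) * cutoff ((1 - t 0) / ε)
  have l1 : Tendsto (fun ε => ∫ t in refSimplex 1, φ ε t * H t) (𝓝[>] 0)
      (𝓝 (∫ t in refSimplex 1, H t)) := by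
    refine tendsto_setIntegral_cutoff hHc (fun ε => ?_) (fun ε t => abs_cutoff_mul_le _ _) ?_
    · exact ((continuous_cutoff_div ε).comp (continuous_apply 0)).mul
        ((continuous_cutoff_div ε).comp (continuous_const.sub (continuous_apply 0)))
    · intro t ht
      have h0 := pos_of_mem_interior_refSimplex ht 0
      have h1 : t 0 < 1 := by simpa using sum_lt_one_of_mem_interior_refSimplex ht
      simpa using (tendsto_cutoff_div h0).mul (tendsto_cutoff_div (sub_pos.2 h1))
  have hone : ∀ τ ∈ Ioo (1 : ℝ) 2, Tendsto (fun ε : ℝ => cutoff ((1 - ε * τ) / ε)) (𝓝[>] 0)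
      (𝓝 1) := fun τ hτ => by
    refine tendsto_const_nhds.congr' ?_
    filter_upwards [Ioo_mem_nhdsGT (show (0 : ℝ) < 1 / 4 by norm_num)] with ε hε
    rw [cutoff_of_ge]
    rw [le_div_iff₀ hε.1]
    nlinarith [hε.1, hε.2, hτ.2]
  have l2 : ∀ G : ℝ → ℝ, ContinuousOn G (Icc 0 1) →
      Tendsto (fun ε => ∫ s in Icc 0 1, approxDirac ε s * (cutoff ((1 - s) / ε) * G s)) (𝓝[>] 0)
        (𝓝 (G 0)) := fun G hG => by
    refine tendsto_setIntegral_approxDirac hG (κ := fun ε s => cutoff ((1 - s) / ε)) (M := 1)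
      (fun ε _ => (continuous_cutoff_div ε).comp (continuous_const.sub continuous_id))
      (fun ε _ s => abs_cutoff_le _) hone
  have l3 := l2 F hFc
  -- The contribution of the other endpoint is obtained by reflection.
  have l4 := l2 (fun s => F (1 - s)) (hFc.comp (continuous_const.sub continuous_id).continuousOn
    fun s hs => ⟨by linarith [hs.2], by linarith [hs.1]⟩)
  have hrefl : ∀ ε, ∫ s in Icc (0 : ℝ) 1, approxDirac ε s * (cutoff ((1 - s) / ε) * F (1 - s)) =
      ∫ s in Icc (0 : ℝ) 1, approxDirac ε (1 - s) * (cutoff (s / ε) * F s) := fun ε => by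
    rw [integral_Icc_eq_integral_Ioc, integral_Icc_eq_integral_Ioc,
      ← intervalIntegral.integral_of_le zero_le_one, ← intervalIntegral.integral_of_le zero_le_one]
    have := intervalIntegral.integral_comp_sub_left (a := 0) (b := 1)
      (fun s => approxDirac ε (1 - s) * (cutoff (s / ε) * F s)) 1
    simpa using this
  simp only [hrefl, sub_zero] at l4
  have heq : ∀ᶠ ε in 𝓝[>] (0 : ℝ), ∫ t in refSimplex 1, φ ε t * H t =
      - ((∫ s in Icc 0 1, approxDirac ε s * (cutoff ((1 - s) / ε) * F s)) -
        ∫ s in Icc (0 : ℝ) 1, approxDirac ε (1 - s) * (cutoff (s / ε) * F s)) := by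
    filter_upwards [Ioo_mem_nhdsGT (show (0 : ℝ) < 1 / 4 by norm_num)] with ε hε
    have hK : ∀ t, φ ε t ≠ 0 → t ∈ Icc (fun _ : Fin 1 => ε) (fun _ => 1 - ε) := by
      intro t ht
      have h1 : ε ≤ t 0 := by
        by_contra hcon
        exact left_ne_zero_of_mul ht (cutoff_div_eq_zero hε.1 (by linarith))
      have h2 : ε ≤ 1 - t 0 := by
        by_contra hcon
        exact right_ne_zero_of_mul ht (cutoff_div_eq_zero hε.1 (by linarith))
      exact ⟨fun i => by fin_cases i; exact h1, fun i => by fin_cases i; simp; linarith⟩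
    have hs : ContDiff ℝ ∞ (φ ε) :=
      (contDiff_cutoff.comp ((contDiff_apply ℝ ℝ 0).div_const ε)).mul
        (contDiff_cutoff.comp ((contDiff_const.sub (contDiff_apply ℝ ℝ 0)).div_const ε))
    have key := hz 1 h (φ ε) hs
      (HasCompactSupport.of_support_subset_isCompact isCompact_Icc hK)
      ((closure_minimal hK isClosed_Icc).trans fun t ht => mem_interior_refSimplex
        (fun i => hε.1.trans_le (ht.1 i)) (by
          have := ht.2 0
          simp at this ⊢
          linarith [hε.1])) (fun _ _ => 1)
    simp only [Nat.reduceAdd, Finset.univ_unique, Fin.default_eq_zero, Finset.sum_singleton,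
      Fin.val_zero, pow_zero, one_mul] at key
    refine key.trans ?_
    congr 1
    have hd : ∀ s : ℝ, fderiv ℝ (φ ε) (fun _ => s) (fun _ => 1) =
        approxDirac ε s * cutoff ((1 - s) / ε) - approxDirac ε (1 - s) * cutoff (s / ε) := by
      intro s
      have h1 : HasDerivAt (fun s : ℝ => φ ε fun _ => s)
          (fderiv ℝ (φ ε) (fun _ => s) fun _ => 1) s := by
        have h0 : HasDerivAt (fun s : ℝ => fun _ : Fin 1 => s) (fun _ => 1) s :=
          hasDerivAt_pi.2 fun _ => hasDerivAt_id s
        exact HasFDerivAt.comp_hasDerivAt (l := φ ε) s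
          (hs.differentiable (by simp) fun _ => s).hasFDerivAt h0
      have h3 : HasDerivAt (fun s : ℝ => cutoff ((1 - s) / ε)) (approxDirac ε (1 - s) * -1) s :=
        (hasDerivAt_cutoff_div ε (1 - s)).comp s ((hasDerivAt_id s).const_sub 1)
      have h2 : HasDerivAt (fun s : ℝ => φ ε fun _ => s) _ s := (hasDerivAt_cutoff_div ε s).mul h3
      rw [h1.unique h2]
      simp
      ring
    rw [setIntegral_refSimplex_one]
    have hi : ∀ g : ℝ → ℝ, Continuous g → IntegrableOn (fun s => g s * F s) (Icc 0 1) :=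
      fun g hg => (hg.continuousOn.mul hFc).integrableOn_compact isCompact_Icc
    rw [← integral_sub]
    · refine integral_congr_ae (Eventually.of_forall fun s => ?_)
      simp only [hd, hF]
      rw [Subsingleton.elim (fun j : Fin 0 => cellTangent v c h fun _ => 1) ![]]
      ring
    · have := hi (fun s => approxDirac ε s * cutoff ((1 - s) / ε))
        ((continuous_approxDirac ε).mul ((continuous_cutoff_div ε).comp
          (continuous_const.sub continuous_id)))
      simp only [mul_assoc] at this
      exact this
    · have := hi (fun s => approxDirac ε (1 - s) * cutoff (s / ε))
        (((continuous_approxDirac ε).comp (continuous_const.sub continuous_id)).mul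
          (continuous_cutoff_div ε))
      simp only [mul_assoc] at this
      exact this
  have := tendsto_nhds_unique_of_eventuallyEq l1 (l3.sub l4).neg heq
  rw [this]
  ring

/-- Stokes' formula for an admissible pair of a `1`-form and a `2`-form on the triangle. -/
lemma stokes_triangle (v : Fin 3 → Plane) {z : FormPair v triTop 1}
    (hz : IsAdmissible v triTop 1 z) :
    ∫ t in refSimplex 2, extZero z.2 (cellParam v triTop card_triTop t)
      ![cellTangent v triTop card_triTop ![1, 0], cellTangent v triTop card_triTop ![0, 1]] =
    (∫ s in Icc (0 : ℝ) 1, extZero z.1 (cellParam v triTop card_triTop ![s, 0])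
      (fun _ => cellTangent v triTop card_triTop ![1, 0])) -
    (∫ s in Icc (0 : ℝ) 1, extZero z.1 (cellParam v triTop card_triTop ![0, s])
      (fun _ => cellTangent v triTop card_triTop ![0, 1])) +
    ∫ s in Icc (0 : ℝ) 1, (extZero z.1 (cellParam v triTop card_triTop ![1 - s, s])
      (fun _ => cellTangent v triTop card_triTop ![0, 1]) -
      extZero z.1 (cellParam v triTop card_triTop ![1 - s, s])
      (fun _ => cellTangent v triTop card_triTop ![1, 0])) := by
  set P := cellParam v triTop card_triTop with hP
  set T := cellTangent v triTop card_triTop with hT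
  set F₀ : (Fin 2 → ℝ) → ℝ := fun t => extZero z.1 (P t) (fun _ => T ![1, 0]) with hF₀
  set F₁ : (Fin 2 → ℝ) → ℝ := fun t => extZero z.1 (P t) (fun _ => T ![0, 1]) with hF₁
  set H : (Fin 2 → ℝ) → ℝ := fun t => extZero z.2 (P t) ![T ![1, 0], T ![0, 1]] with hH
  have hF₀c : ContinuousOn F₀ (refSimplex 2) := continuousOn_extZero_cellParam _ _ card_triTop z.1 _
  have hF₁c : ContinuousOn F₁ (refSimplex 2) := continuousOn_extZero_cellParam _ _ card_triTop z.1 _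
  have hHc : ContinuousOn H (refSimplex 2) := continuousOn_extZero_cellParam _ _ card_triTop z.2 _
  -- A product of cutoffs of the three barycentric coordinates: its gradient is made of three
  -- layers, one along each edge.
  let φ : ℝ → (Fin 2 → ℝ) → ℝ := fun ε t =>
    cutoff (t 0 / ε) * cutoff (t 1 / ε) * cutoff ((1 - t 0 - t 1) / ε)
  have c0 : Continuous fun t : Fin 2 → ℝ => t 0 := continuous_apply 0
  have c1 : Continuous fun t : Fin 2 → ℝ => t 1 := continuous_apply 1
  have l1 : Tendsto (fun ε => ∫ t in refSimplex 2, φ ε t * H t) (𝓝[>] 0)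
      (𝓝 (∫ t in refSimplex 2, H t)) := by
    refine tendsto_setIntegral_cutoff hHc (fun ε => ?_) (fun ε t => ?_) ?_
    · exact (((continuous_cutoff_div ε).comp c0).mul ((continuous_cutoff_div ε).comp c1)).mul
        ((continuous_cutoff_div ε).comp ((continuous_const.sub c0).sub c1))
    · rw [abs_mul]
      exact mul_le_one₀ (abs_cutoff_mul_le _ _) (abs_nonneg _) (abs_cutoff_le _)
    · intro t ht
      have h0 := pos_of_mem_interior_refSimplex ht 0
      have h1 := pos_of_mem_interior_refSimplex ht 1
      have h2 := sum_lt_one_of_mem_interior_refSimplex ht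
      rw [Fin.sum_univ_two] at h2
      simpa using ((tendsto_cutoff_div h0).mul (tendsto_cutoff_div h1)).mul
        (tendsto_cutoff_div (show 0 < 1 - t 0 - t 1 by linarith))
  have l2 : ∀ G : (Fin 2 → ℝ) → ℝ, ContinuousOn G (refSimplex 2) →
      Tendsto (fun ε => ∫ t in refSimplex 2, approxDirac ε (t 1) *
        ((cutoff (t 0 / ε) * cutoff ((1 - t 0 - t 1) / ε)) * G t)) (𝓝[>] 0)
        (𝓝 (∫ s in Icc (0 : ℝ) 1, G ![s, 0])) := fun G hG => by
    have := tendsto_setIntegral_approxDirac_edge hG (κ := fun ε t =>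
      cutoff (t 0 / ε) * cutoff ((1 - t 0 - t 1) / ε)) (M := 1) (κ₀ := fun _ => 1)
      (fun ε _ => ((continuous_cutoff_div ε).comp c0).mul
        ((continuous_cutoff_div ε).comp ((continuous_const.sub c0).sub c1)))
      (fun ε _ t => abs_cutoff_mul_le _ _) ?_
    · simpa using this
    · intro s hs τ hτ
      have h1 := tendsto_cutoff_div hs.1
      have h2 : Tendsto (fun ε : ℝ => cutoff ((1 - s - ε * τ) / ε)) (𝓝[>] 0) (𝓝 1) := by
        refine tendsto_const_nhds.congr' ?_
        filter_upwards [Ioo_mem_nhdsGT (show (0 : ℝ) < (1 - s) / 4 by linarith [hs.2])] with ε hε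
        rw [cutoff_of_ge]
        rw [le_div_iff₀ hε.1]
        nlinarith [hε.1, hε.2, hτ.2]
      simpa using h1.mul h2
  have l3 := l2 F₀ hF₀c
  -- The limits on the other two edges reduce to the edge `t₁ = 0` by the symmetries of the
  -- reference triangle.
  have l4 := l2 (fun t => F₁ (swapL t + 0)) (hF₁c.comp (by fun_prop) fun x hx => (swapL_mem x).2 hx)
  have l5 := l2 (fun t => F₁ (rotL t + ![1, 0]) - F₀ (rotL t + ![1, 0]))
    ((hF₁c.comp (by fun_prop) fun x hx => (rotL_mem x).2 hx).sub
      (hF₀c.comp (by fun_prop) fun x hx => (rotL_mem x).2 hx))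
  have hswap : ∀ ε, ∫ t in refSimplex 2, approxDirac ε (t 1) *
      ((cutoff (t 0 / ε) * cutoff ((1 - t 0 - t 1) / ε)) * F₁ (swapL t + 0)) =
      ∫ t in refSimplex 2, approxDirac ε (t 0) *
      ((cutoff (t 1 / ε) * cutoff ((1 - t 0 - t 1) / ε)) * F₁ t) := fun ε => by
    rw [← setIntegral_refSimplex_comp swapL 0 swapL_mem (fun t => approxDirac ε (t 0) *
      ((cutoff (t 1 / ε) * cutoff ((1 - t 0 - t 1) / ε)) * F₁ t))]
    refine integral_congr_ae (Eventually.of_forall fun t => ?_)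
    simp [swapL_apply, sub_right_comm]
  have hrot : ∀ ε, ∫ t in refSimplex 2, approxDirac ε (t 1) *
      ((cutoff (t 0 / ε) * cutoff ((1 - t 0 - t 1) / ε)) *
        (F₁ (rotL t + ![1, 0]) - F₀ (rotL t + ![1, 0]))) =
      ∫ t in refSimplex 2, approxDirac ε (1 - t 0 - t 1) *
      ((cutoff (t 0 / ε) * cutoff (t 1 / ε)) * (F₁ t - F₀ t)) := fun ε => by
    rw [← setIntegral_refSimplex_comp rotL ![1, 0] rotL_mem (fun t => approxDirac ε (1 - t 0 - t 1) *
      ((cutoff (t 0 / ε) * cutoff (t 1 / ε)) * (F₁ t - F₀ t)))]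
    refine integral_congr_ae (Eventually.of_forall fun t => ?_)
    have e0 : (rotL t + ![1, 0] : Fin 2 → ℝ) 0 = 1 - t 0 - t 1 := by simp [rotL_apply]; ring
    have e1 : (rotL t + ![1, 0] : Fin 2 → ℝ) 1 = t 0 := by simp [rotL_apply]
    have e2 : 1 - (1 - t 0 - t 1) - t 0 = t 1 := by ring
    simp only [e0, e1, e2]
    ring
  simp only [hswap] at l4
  simp only [hrot] at l5
  have heq : ∀ᶠ ε in 𝓝[>] (0 : ℝ), ∫ t in refSimplex 2, φ ε t * H t =
      (∫ t in refSimplex 2, approxDirac ε (t 1) *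
        ((cutoff (t 0 / ε) * cutoff ((1 - t 0 - t 1) / ε)) * F₀ t)) -
      (∫ t in refSimplex 2, approxDirac ε (t 0) *
      ((cutoff (t 1 / ε) * cutoff ((1 - t 0 - t 1) / ε)) * F₁ t)) +
      ∫ t in refSimplex 2, approxDirac ε (1 - t 0 - t 1) *
      ((cutoff (t 0 / ε) * cutoff (t 1 / ε)) * (F₁ t - F₀ t)) := by
    filter_upwards [self_mem_nhdsWithin] with ε hε
    let K : Set (Fin 2 → ℝ) := Icc (fun _ : Fin 2 => ε) (fun _ => 1) ∩ {t | t 0 + t 1 ≤ 1 - ε}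
    have hKc : IsCompact K := isCompact_Icc.inter_right (isClosed_le (c0.add c1) continuous_const)
    have hε : 0 < ε := hε
    have hK : ∀ t, φ ε t ≠ 0 → t ∈ K := by
      intro t ht
      have h1 : ε ≤ t 0 := by
        by_contra hcon
        exact left_ne_zero_of_mul (left_ne_zero_of_mul ht)
          (cutoff_div_eq_zero hε (by linarith))
      have h2 : ε ≤ t 1 := by
        by_contra hcon
        exact right_ne_zero_of_mul (left_ne_zero_of_mul ht)
          (cutoff_div_eq_zero hε (by linarith))
      have h3 : ε ≤ 1 - t 0 - t 1 := by
        by_contra hcon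
        exact right_ne_zero_of_mul ht (cutoff_div_eq_zero hε (by linarith))
      refine ⟨⟨fun i => ?_, fun i => ?_⟩, ?_⟩
      · fin_cases i <;> assumption
      · fin_cases i <;> simp <;> linarith
      · simp only [mem_ofPred_eq]; linarith
    have hs : ContDiff ℝ ∞ (φ ε) :=
      ((contDiff_cutoff.comp ((contDiff_apply ℝ ℝ 0).div_const ε)).mul
        (contDiff_cutoff.comp ((contDiff_apply ℝ ℝ 1).div_const ε))).mul
        (contDiff_cutoff.comp (((contDiff_const.sub (contDiff_apply ℝ ℝ 0)).sub
          (contDiff_apply ℝ ℝ 1)).div_const ε))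
    have key := hz 2 card_triTop (φ ε) hs (HasCompactSupport.of_support_subset_isCompact hKc hK)
      ((closure_minimal hK hKc.isClosed).trans fun t ht => mem_interior_refSimplex
        (fun i => hε.trans_le (ht.1.1 i)) (by
          have := ht.2
          simp only [mem_ofPred_eq] at this
          rw [Fin.sum_univ_two]
          linarith)) ![![1, 0], ![0, 1]]
    have f0 : (fun j : Fin 1 => T (![![1, 0], ![0, 1]] ((0 : Fin 2).succAbove j))) =
        fun _ => T ![0, 1] := by ext1 j; fin_cases j; rfl
    have f1 : (fun j : Fin 1 => T (![![1, 0], ![0, 1]] ((1 : Fin 2).succAbove j))) =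
        fun _ => T ![1, 0] := by ext1 j; fin_cases j; rfl
    have f2 : (fun j : Fin 2 => T (![![1, 0], ![0, 1]] j)) = ![T ![1, 0], T ![0, 1]] := by
      ext1 j; fin_cases j <;> rfl
    simp only [Nat.reduceAdd, Fin.sum_univ_two, ← hT, ← hP] at key
    simp only [f0, f1, f2] at key
    simp only [Fin.val_zero, pow_zero, one_mul, Fin.val_one, pow_one, neg_mul,
      Matrix.cons_val_zero, Matrix.cons_val_one] at key
    have key' : ∫ t in refSimplex 2, φ ε t * H t =
        - ((∫ t in refSimplex 2, fderiv ℝ (φ ε) t ![1, 0] * F₁ t) +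
          - ∫ t in refSimplex 2, fderiv ℝ (φ ε) t ![0, 1] * F₀ t) := key
    rw [key']
    have hd : ∀ (t : Fin 2 → ℝ) (a b : ℝ), fderiv ℝ (φ ε) t ![a, b] =
        a * (approxDirac ε (t 0) * (cutoff (t 1 / ε) * cutoff ((1 - t 0 - t 1) / ε))) +
        b * (approxDirac ε (t 1) * (cutoff (t 0 / ε) * cutoff ((1 - t 0 - t 1) / ε))) -
        (a + b) * (approxDirac ε (1 - t 0 - t 1) * (cutoff (t 0 / ε) * cutoff (t 1 / ε))) := by
      intro t a b
      have h1 : HasDerivAt (fun s : ℝ => φ ε (t + s • ![a, b])) (fderiv ℝ (φ ε) t ![a, b]) 0 := by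
        have h2 : HasDerivAt (fun s : ℝ => t + s • ![a, b]) ((1 : ℝ) • ![a, b]) 0 :=
          ((hasDerivAt_id (0 : ℝ)).smul_const ![a, b]).const_add t
        have h3 := HasFDerivAt.comp_hasDerivAt (l := φ ε) (0 : ℝ)
          (hs.differentiable (by simp) (t + (0 : ℝ) • ![a, b])).hasFDerivAt h2
        rw [zero_smul, add_zero, one_smul] at h3
        exact h3
      have e0 : HasDerivAt (fun s : ℝ => t 0 + s * a) a 0 := by
        simpa using ((hasDerivAt_id (0 : ℝ)).mul_const a).const_add (t 0)
      have e1 : HasDerivAt (fun s : ℝ => t 1 + s * b) b 0 := by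
        simpa using ((hasDerivAt_id (0 : ℝ)).mul_const b).const_add (t 1)
      have e2 : HasDerivAt (fun s : ℝ => 1 - (t 0 + s * a) - (t 1 + s * b)) (- a - b) 0 :=
        (e0.const_sub 1).sub e1
      have g : ∀ {q : ℝ → ℝ} {q' : ℝ}, HasDerivAt q q' 0 →
          HasDerivAt (fun s => cutoff (q s / ε)) (approxDirac ε (q 0) * q') 0 :=
        fun hq => (hasDerivAt_cutoff_div ε _).comp 0 hq
      have h2 : HasDerivAt (fun s : ℝ => φ ε (t + s • ![a, b])) _ 0 :=
        ((g e0).mul (g e1)).mul (g e2)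
      rw [h1.unique h2]
      simp
      ring
    have hi : ∀ g F : (Fin 2 → ℝ) → ℝ, Continuous g → ContinuousOn F (refSimplex 2) →
        IntegrableOn (fun t => g t * F t) (refSimplex 2) := fun g F hg hF =>
      (hg.continuousOn.mul hF).integrableOn_compact (isCompact_refSimplex 2)
    have k0 : Continuous fun t : Fin 2 → ℝ => cutoff (t 0 / ε) := (continuous_cutoff_div ε).comp c0
    have k1 : Continuous fun t : Fin 2 → ℝ => cutoff (t 1 / ε) := (continuous_cutoff_div ε).comp c1
    have kb : Continuous fun t : Fin 2 → ℝ => 1 - t 0 - t 1 := (continuous_const.sub c0).sub c1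
    have k2 : Continuous fun t : Fin 2 → ℝ => cutoff ((1 - t 0 - t 1) / ε) :=
      (continuous_cutoff_div ε).comp kb
    have d0 := (continuous_approxDirac ε).comp c0
    have d1 := (continuous_approxDirac ε).comp c1
    have d2 := (continuous_approxDirac ε).comp kb
    have i0 := hi _ F₀ (d1.mul (k0.mul k2)) hF₀c
    have i1 := hi _ F₁ (d0.mul (k1.mul k2)) hF₁c
    have i2 := hi _ (fun t => F₁ t - F₀ t) (d2.mul (k0.mul k1)) (hF₁c.sub hF₀c)
    have j0 : IntegrableOn (fun t => fderiv ℝ (φ ε) t ![0, 1] * F₀ t) (refSimplex 2) :=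
      hi _ _ ((hs.continuous_fderiv (by simp)).clm_apply continuous_const) hF₀c
    have j1 : IntegrableOn (fun t => fderiv ℝ (φ ε) t ![1, 0] * F₁ t) (refSimplex 2) :=
      hi _ _ ((hs.continuous_fderiv (by simp)).clm_apply continuous_const) hF₁c
    simp only [mul_assoc, Function.comp_apply, Pi.mul_apply] at i0 i1 i2
    simp only [mul_assoc]
    have i01 : IntegrableOn (fun t : Fin 2 → ℝ =>
        approxDirac ε (t 1) * (cutoff (t 0 / ε) * (cutoff ((1 - t 0 - t 1) / ε) * F₀ t)) -
        approxDirac ε (t 0) * (cutoff (t 1 / ε) * (cutoff ((1 - t 0 - t 1) / ε) * F₁ t)))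
        (refSimplex 2) := i0.sub i1
    rw [neg_add, neg_neg, neg_add_eq_sub, ← integral_sub j0 j1, ← integral_sub i0 i1,
      ← integral_add i01 i2]
    refine integral_congr_ae (Eventually.of_forall fun t => ?_)
    simp only [hd]
    ring
  have := tendsto_nhds_unique_of_eventuallyEq l1 ((l3.sub l4).add l5) heq
  rw [this]
  have e1 : ∀ s : ℝ, swapL ![s, 0] + 0 = ![0, s] := fun s => by simp [swapL_apply]
  have e2 : ∀ s : ℝ, rotL ![s, 0] + ![1, 0] = ![1 - s, s] := fun s => by
    ext i; fin_cases i <;> simp [rotL_apply]; ring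
  simp only [e1, e2, hF₀, hF₁]

end Stokes

/-! ### Stokes' formula in terms of the evaluation maps -/

section StokesFES

open MeasureTheory Set

/-- The integral of a `0`-form on a vertex is its value there. -/
lemma cellIntegral_vertex (v : Fin 3 → Plane) {c : TriCell} (h : c.1.card = 0 + 1) {i : Fin 3}
    (hc : c.1 = {i}) (u : C(cellSet v c, AltForm 0)) :
    cellIntegral v c h u = extZero u (v i) ![] := by
  have h1 : refSimplex 0 = univ := by ext t; simp [refSimplex]
  have h2 : ∀ t, cellParam v c h t = v i := fun t => by
    rw [cellParam, cellVertex_singleton v h hc]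
    simp [cellTangent]
  rw [cellIntegral, h1, Measure.restrict_univ]
  simp only [h2]
  rw [integral_const, measureReal_def, Measure.volume_pi_eq_dirac 0]
  simp [Subsingleton.elim _ (![] : Fin 0 → Plane)]

lemma extZero_traceForm (v : Fin 3 → Plane) {c' c : TriCell} (h : c' ≤ c) (k : ℕ)
    (u : C(cellSet v c, AltForm k)) {x : Plane} (hx : x ∈ cellSet v c') :
    extZero (traceForm v h k u) x = extZero u x := by
  rw [extZero_apply _ hx, extZero_apply _ (cellSet_mono v h hx)]
  rfl

/-- The integral of a trace over an edge. -/
lemma cellIntegral_trace_edge (v : Fin 3 → Plane) {c' c : TriCell} (hle : c' ≤ c)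
    (h : c'.1.card = 1 + 1) {i j : Fin 3} (hij : i < j) (hc : c'.1 = {i, j})
    (u : C(cellSet v c, AltForm 1)) :
    cellIntegral v c' h (traceForm v hle 1 u) =
      ∫ s in Icc (0 : ℝ) 1, extZero u (v i + s • (v j - v i)) (fun _ => v j - v i) := by
  obtain ⟨h0, h1⟩ := cellVertex_pair v h hij hc
  rw [cellIntegral, setIntegral_refSimplex_one]
  refine setIntegral_congr_fun measurableSet_Icc fun s hs => ?_
  have hm : (fun _ : Fin 1 => s) ∈ refSimplex 1 := by
    simp only [refSimplex, mem_ofPred_eq, Finset.univ_unique, Finset.sum_singleton]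
    exact ⟨fun _ => hs.1, hs.2⟩
  have e := cellParam_mem v c' h hm
  have e2 := cellParam_pair v h hij hc (fun _ => s)
  rw [extZero_traceForm v hle 1 u e, e2]
  congr 1
  ext1 l
  fin_cases l
  simp [h0, h1, show (Fin.succ (0 : Fin 1)) = 1 from rfl]

/-- Stokes' formula on an edge. -/
lemma cellIntegral_d_edge (v : Fin 3 → Plane) {c : TriCell} (h : c.1.card = 1 + 1) {i j : Fin 3}
    (hij : i < j) (hc : c.1 = {i, j}) {z : FormPair v c 0} (hz : IsAdmissible v c 0 z) :
    cellIntegral v c h z.2 = extZero z.1 (v j) ![] - extZero z.1 (v i) ![] := by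
  obtain ⟨h0, h1⟩ := cellVertex_pair v h hij hc
  have := stokes_edge v h hz
  simp only [cellParam_pair v h hij hc] at this
  rw [one_smul, add_sub_cancel, zero_smul, add_zero] at this
  rw [← this, cellIntegral]
  refine integral_congr_ae (Filter.Eventually.of_forall fun t => ?_)
  simp only [cellParam_pair v h hij hc]
  congr 1
  ext1 l
  fin_cases l
  simp [h0, h1, show (Fin.succ (0 : Fin 1)) = 1 from rfl, cellTangent_pair v h hij hc]

/-- Stokes' formula on the triangle. -/
lemma cellIntegral_d_triTop (v : Fin 3 → Plane) {z : FormPair v triTop 1}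
    (hz : IsAdmissible v triTop 1 z) :
    cellIntegral v triTop card_triTop z.2 =
      (∫ s in Icc (0 : ℝ) 1, extZero z.1 (v 0 + s • (v 1 - v 0)) (fun _ => v 1 - v 0)) -
      (∫ s in Icc (0 : ℝ) 1, extZero z.1 (v 0 + s • (v 2 - v 0)) (fun _ => v 2 - v 0)) +
      ∫ s in Icc (0 : ℝ) 1, extZero z.1 (v 1 + s • (v 2 - v 1)) (fun _ => v 2 - v 1) := by
  have := stokes_triangle v hz
  simp only [cellParam_triTop, cellTangent_triTop] at this
  simp only [Matrix.cons_val_zero, Matrix.cons_val_one, one_smul, zero_smul, add_zero,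
    zero_add] at this
  rw [cellIntegral]
  convert this using 1
  · refine integral_congr_ae (Filter.Eventually.of_forall fun t => ?_)
    simp only [cellParam_triTop]
    congr 1
    ext1 l
    fin_cases l <;> simp [cellVertex_triTop v]
  · congr 1
    refine integral_congr_ae (Filter.Eventually.of_forall fun s => ?_)
    have e1 : v 0 + ((1 - s) • (v 1 - v 0) + s • (v 2 - v 0)) = v 1 + s • (v 2 - v 1) := by
      module
    simp only [e1]
    have := (extZero z.1 (v 1 + s • (v 2 - v 1))).map_update_sub (fun _ => 0) 0 (v 2 - v 0)
      (v 1 - v 0)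
    have e : ∀ x : Plane, Function.update (fun _ : Fin 1 => (0 : Plane)) 0 x = fun _ => x := by
      intro x; ext1 l; fin_cases l; simp
    simp only [e, sub_sub_sub_cancel_right] at this
    exact this

lemma singleton_ssubset_pair : ∀ i j : Fin 3, i < j →
    ({i} : Finset (Fin 3)) ⊂ {i, j} ∧ ({j} : Finset (Fin 3)) ⊂ {i, j} := by decide

lemma eq_singleton_of_ssubset_pair : ∀ i j : Fin 3, i < j → ∀ s : Finset (Fin 3), s.Nonempty →
    s ⊂ {i, j} → s.card - 1 = 0 → s = {i} ∨ s = {j} := by decide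

lemma orient_pair : ∀ i j : Fin 3, i < j →
    TriCell.orient ⟨{i, j}, by simp⟩ ⟨{i}, by simp⟩ = -1 ∧
      TriCell.orient ⟨{i, j}, by simp⟩ ⟨{j}, by simp⟩ = 1 := by decide

open scoped Classical in
/-- Stokes' formula for admissible pairs. -/
lemma ctFES_stokes (p : ℕ) (v : Fin 3 → Plane) (W : Plane) (c : TriCell) (k : ℕ)
    (h : (ctFES p v W).dim c = k + 1) {u : FormPair v c k} (hu : IsAdmissible v c k u) :
    (ctFES p v W).ev c (k + 1) h ((ctFES p v W).d c k u) =
      ∑ c' : {c' : TriCell // c' < c ∧ (ctFES p v W).dim c' = k},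
        ((ctFES p v W).orient c c' : ℝ) *
          (ctFES p v W).ev c' k c'.2.2 ((ctFES p v W).r c'.2.1.le k u) := by
  have hcard : c.1.card = k + 1 + 1 := by
    have h' : c.1.card - 1 = k + 1 := h
    omega
  have hle : c.1.card ≤ 3 := c.1.card_le_univ
  obtain rfl | rfl : k = 0 ∨ k = 1 := by omega
  · have key : ∀ i j : Fin 3, i < j → c.1 = {i, j} →
        cellIntegral v c hcard u.2 = ∑ c' : {c' : TriCell // c' < c ∧ (ctFES p v W).dim c' = 0},
        ((ctFES p v W).orient c c' : ℝ) *
          (ctFES p v W).ev c' 0 c'.2.2 ((ctFES p v W).r c'.2.1.le 0 u) := by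
      intro i j hij hc
      obtain ⟨c, hc0⟩ := c
      obtain rfl : c = {i, j} := hc
      have hi : (⟨{i}, by simp⟩ : TriCell) < ⟨{i, j}, hc0⟩ := (singleton_ssubset_pair i j hij).1
      have hj : (⟨{j}, by simp⟩ : TriCell) < ⟨{i, j}, hc0⟩ := (singleton_ssubset_pair i j hij).2
      have huniv : (Finset.univ : Finset {c' : TriCell // c' < ⟨{i, j}, hc0⟩ ∧
          (ctFES p v W).dim c' = 0}) = {⟨⟨{i}, by simp⟩, hi, rfl⟩, ⟨⟨{j}, by simp⟩, hj, rfl⟩} := by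
        ext ⟨⟨s, hs⟩, h1, h2⟩
        simp only [Finset.mem_univ, Finset.mem_insert, Finset.mem_singleton, true_iff,
          Subtype.mk.injEq]
        have h1' : s ⊂ {i, j} := h1
        have h2' : s.card - 1 = 0 := h2
        exact eq_singleton_of_ssubset_pair i j hij s hs h1' h2'
      rw [huniv, Finset.sum_pair (by simp [hij.ne])]
      rw [cellIntegral_d_edge v hcard hij rfl hu]
      have ei : (ctFES p v W).ev ⟨{i}, by simp⟩ 0 rfl ((ctFES p v W).r hi.le 0 u) =
          extZero u.1 (v i) ![] :=
        (cellIntegral_vertex v _ rfl _).trans (by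
          rw [← extZero_traceForm v hi.le 0 u.1 (subset_convexHull ℝ _ (by simp))]; rfl)
      have ej : (ctFES p v W).ev ⟨{j}, by simp⟩ 0 rfl ((ctFES p v W).r hj.le 0 u) =
          extZero u.1 (v j) ![] :=
        (cellIntegral_vertex v _ rfl _).trans (by
          rw [← extZero_traceForm v hj.le 0 u.1 (subset_convexHull ℝ _ (by simp))]; rfl)
      rw [ei, ej]
      have oi' : (ctFES p v W).orient ⟨{i, j}, hc0⟩ ⟨{i}, by simp⟩ = -1 :=
        (orient_pair i j hij).1
      have oj' : (ctFES p v W).orient ⟨{i, j}, hc0⟩ ⟨{j}, by simp⟩ = 1 :=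
        (orient_pair i j hij).2
      simp only [oi', oj']
      push_cast
      ring
    rcases exists_pair_of_card hcard with hc | hc | hc
    · exact key 0 1 (by decide) hc
    · exact key 0 2 (by decide) hc
    · exact key 1 2 (by decide) hc
  · obtain rfl := eq_triTop_of_card hcard
    have h01 : (⟨{0, 1}, by simp⟩ : TriCell) < triTop := by decide
    have h02 : (⟨{0, 2}, by simp⟩ : TriCell) < triTop := by decide
    have h12 : (⟨{1, 2}, by simp⟩ : TriCell) < triTop := by decide
    have huniv : (Finset.univ : Finset {c' : TriCell // c' < triTop ∧
        (ctFES p v W).dim c' = 1}) = {⟨⟨{0, 1}, by simp⟩, h01, rfl⟩, ⟨⟨{0, 2}, by simp⟩, h02, rfl⟩,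
          ⟨⟨{1, 2}, by simp⟩, h12, rfl⟩} := by
      ext ⟨⟨s, hs⟩, h1, h2⟩
      simp only [Finset.mem_univ, Finset.mem_insert, Finset.mem_singleton, true_iff,
        Subtype.mk.injEq]
      have h2' : s.card - 1 = 1 := h2
      exact exists_pair_of_card (c := ⟨s, hs⟩) (by simp only; omega)
    have o01 : (ctFES p v W).orient triTop ⟨{0, 1}, by simp⟩ = 1 :=
      show TriCell.orient triTop ⟨{0, 1}, by simp⟩ = 1 by decide
    have o02 : (ctFES p v W).orient triTop ⟨{0, 2}, by simp⟩ = -1 :=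
      show TriCell.orient triTop ⟨{0, 2}, by simp⟩ = -1 by decide
    have o12 : (ctFES p v W).orient triTop ⟨{1, 2}, by simp⟩ = 1 :=
      show TriCell.orient triTop ⟨{1, 2}, by simp⟩ = 1 by decide
    have e : ∀ (i j : Fin 3) (hij : i < j) (hlt : (⟨{i, j}, by simp⟩ : TriCell) < triTop)
        (hd : (ctFES p v W).dim ⟨{i, j}, by simp⟩ = 1),
        (ctFES p v W).ev ⟨{i, j}, by simp⟩ 1 hd ((ctFES p v W).r hlt.le 1 u) =
        ∫ s in Icc (0 : ℝ) 1, extZero u.1 (v i + s • (v j - v i)) (fun _ => v j - v i) :=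
      fun i j hij hlt hd => cellIntegral_trace_edge v hlt.le _ hij rfl u.1
    rw [huniv, Finset.sum_insert (by simp; decide), Finset.sum_pair (by simp; decide)]
    rw [e 0 1 (by decide) h01, e 0 2 (by decide) h02, e 1 2 (by decide) h12]
    simp only [o01, o02, o12]
    push_cast
    refine (cellIntegral_d_triTop v hu).trans ?_
    ring

end StokesFES

/-! ### Polynomial functions on the plane and their primitives -/

section PolyFun

open MvPolynomial Set

/-- Polynomial functions on the plane, of degree at most `q`. -/
def IsPolyFun (q : ℕ) (f : Plane → ℝ) : Prop :=
  ∃ P : MvPolynomial (Fin 2) ℝ, P.totalDegree ≤ q ∧ ∀ x : Plane, f x = eval (fun i => x i) P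

namespace IsPolyFun

variable {q q' : ℕ} {f g : Plane → ℝ}

lemma mono (hf : IsPolyFun q f) (h : q ≤ q') : IsPolyFun q' f := by
  obtain ⟨P, hP, hf⟩ := hf
  exact ⟨P, hP.trans h, hf⟩

lemma const (q : ℕ) (a : ℝ) : IsPolyFun q fun _ => a := ⟨C a, by simp, by simp⟩

lemma add (hf : IsPolyFun q f) (hg : IsPolyFun q g) : IsPolyFun q fun x => f x + g x := by
  obtain ⟨P, hP, hf⟩ := hf
  obtain ⟨Q, hQ, hg⟩ := hg
  exact ⟨P + Q, (totalDegree_add P Q).trans (max_le hP hQ), fun x => by simp [hf, hg]⟩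

lemma mul (hf : IsPolyFun q f) (hg : IsPolyFun q' g) : IsPolyFun (q + q') fun x => f x * g x := by
  obtain ⟨P, hP, hf⟩ := hf
  obtain ⟨Q, hQ, hg⟩ := hg
  exact ⟨P * Q, (totalDegree_mul P Q).trans (add_le_add hP hQ), fun x => by simp [hf, hg]⟩

lemma const_mul (a : ℝ) (hf : IsPolyFun q f) : IsPolyFun q fun x => a * f x := by
  simpa using (const 0 a).mul hf

lemma neg (hf : IsPolyFun q f) : IsPolyFun q fun x => - f x := by
  simpa using hf.const_mul (-1)

lemma sub (hf : IsPolyFun q f) (hg : IsPolyFun q g) : IsPolyFun q fun x => f x - g x := by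
  simpa [sub_eq_add_neg] using hf.add hg.neg

lemma sum {ι : Type*} (s : Finset ι) {F : ι → Plane → ℝ} (h : ∀ i ∈ s, IsPolyFun q (F i)) :
    IsPolyFun q fun x => ∑ i ∈ s, F i x := by
  classical
  induction s using Finset.induction_on with
  | empty => simpa using const q 0
  | insert a s ha ih =>
    simp only [Finset.sum_insert ha]
    exact (h a (by simp)).add (ih fun i hi => h i (by simp [hi]))

lemma coord (i : Fin 2) : IsPolyFun 1 fun x => x i := ⟨X i, by simp, by simp⟩

lemma pow (hf : IsPolyFun q f) (n : ℕ) : IsPolyFun (n * q) fun x => f x ^ n := by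
  induction n with
  | zero => simpa using const 0 1
  | succ n ih =>
    simp only [pow_succ, Nat.succ_mul]
    exact ih.mul hf

/-- Affine functions are polynomial of degree one. -/
lemma affine (L : Plane →L[ℝ] ℝ) (a : ℝ) : IsPolyFun 1 fun x => L x + a := by
  refine IsPolyFun.add ?_ (const 1 a)
  have : ∀ x : Plane, L x = ∑ i, L (EuclideanSpace.single i 1) * x i := by
    intro x
    conv_lhs => rw [← (EuclideanSpace.basisFun (Fin 2) ℝ).sum_repr x, map_sum]
    refine Finset.sum_congr rfl fun i _ => ?_
    simp [mul_comm]
  rw [funext this]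
  exact sum _ fun i _ => (coord i).const_mul _

end IsPolyFun

/-- A polynomial of degree at most `q` in functions of degree at most one has degree at most `q`,
for any notion of degree compatible with sums and products. -/
lemma eval_of_graded {α : Type*} (D : ℕ → (α → ℝ) → Prop)
    (hmono : ∀ {m n f}, D m f → m ≤ n → D n f) (hconst : ∀ a, D 0 fun _ => a)
    (hadd : ∀ {n f g}, D n f → D n g → D n fun x => f x + g x)
    (hmul : ∀ {m n f g}, D m f → D n g → D (m + n) fun x => f x * g x)
    {F : Fin 2 → α → ℝ} (hF : ∀ i, D 1 (F i)) {P : MvPolynomial (Fin 2) ℝ} {q : ℕ}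
    (hP : P.totalDegree ≤ q) : D q fun x => eval (fun i => F i x) P := by
  have hpow : ∀ i n, D n fun x => F i x ^ n := by
    intro i n
    induction n with
    | zero => simpa using hconst 1
    | succ n ih =>
      simp only [pow_succ]
      exact hmul ih (hF i)
  have hmon : ∀ s ∈ P.support, D q fun x => P.coeff s * (F 0 x ^ s 0 * F 1 x ^ s 1) := by
    intro s hs
    have h1 : s 0 + s 1 ≤ q := by
      have := (le_totalDegree hs).trans hP
      rwa [Finsupp.sum_fintype _ _ (by simp), Fin.sum_univ_two] at this
    have h2 := hmul (hconst (P.coeff s)) (hmul (hpow 0 (s 0)) (hpow 1 (s 1)))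
    exact hmono h2 (by omega)
  have hsum : ∀ t ⊆ P.support, D q fun x => ∑ s ∈ t, P.coeff s * (F 0 x ^ s 0 * F 1 x ^ s 1) := by
    classical
    intro t
    induction t using Finset.induction_on with
    | empty => intro _; simpa using hmono (hconst 0) (Nat.zero_le q)
    | insert a s ha ih =>
      intro h
      simp only [Finset.sum_insert ha]
      exact hadd (hmon a (h (by simp))) (ih ((Finset.subset_insert _ _).trans h))
  have := hsum P.support subset_rfl
  simpa only [eval_eq', Fin.prod_univ_two] using this

namespace IsPolyFun

variable {q q' : ℕ} {f g : Plane → ℝ}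

/-- Composition with an affine map. -/
lemma comp_affine (hf : IsPolyFun q f) {A : Plane → Plane} (hA : ∀ i, IsPolyFun 1 fun x => A x i) :
    IsPolyFun q fun x => f (A x) := by
  obtain ⟨P, hP, hf⟩ := hf
  simp only [hf]
  exact eval_of_graded IsPolyFun mono (const 0) add mul hA hP

/-- Restriction to a line. -/
lemma comp_line (hf : IsPolyFun q f) (a d : Plane) :
    ∃ S : Polynomial ℝ, S.natDegree ≤ q ∧ ∀ s : ℝ, f (a + s • d) = S.eval s := by
  obtain ⟨P, hP, hf⟩ := hf
  simp only [hf]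
  refine eval_of_graded (fun n (r : ℝ → ℝ) => ∃ S : Polynomial ℝ, S.natDegree ≤ n ∧
    ∀ s, r s = S.eval s) ?_ ?_ ?_ ?_ (F := fun i s => (a + s • d) i) (fun i => ?_) hP
  · rintro m n f ⟨S, hS, h⟩ hmn
    exact ⟨S, hS.trans hmn, h⟩
  · exact fun a => ⟨Polynomial.C a, by simp, by simp⟩
  · rintro n f g ⟨S, hS, h⟩ ⟨R, hR, h'⟩
    exact ⟨S + R, Polynomial.natDegree_add_le_of_degree_le hS hR, by simp [h, h']⟩
  · rintro m n f g ⟨S, hS, h⟩ ⟨R, hR, h'⟩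
    exact ⟨S * R, Polynomial.natDegree_mul_le_of_le hS hR, by simp [h, h']⟩
  · refine ⟨Polynomial.C (d i) * Polynomial.X + Polynomial.C (a i),
      Polynomial.natDegree_linear_le, fun s => ?_⟩
    simp
    ring

/-- Composition of a univariate polynomial with an affine function. -/
lemma polynomial_comp {S : Polynomial ℝ} (hS : S.natDegree ≤ q) (hf : IsPolyFun 1 f) :
    IsPolyFun q fun x => S.eval (f x) := by
  simp only [Polynomial.eval_eq_sum_range]
  refine sum _ fun n hn => ((hf.pow n).mono ?_).const_mul _
  have := Finset.mem_range.1 hn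
  omega

end IsPolyFun

/-- The derivative of a polynomial function. -/
lemma hasFDerivAt_eval (P : MvPolynomial (Fin 2) ℝ) (x : Plane) :
    HasFDerivAt (fun x : Plane => eval (fun i => x i) P)
      (∑ i, eval (fun i => x i) (pderiv i P) • (EuclideanSpace.proj i : Plane →L[ℝ] ℝ)) x := by
  induction P using MvPolynomial.induction_on with
  | C a =>
    simp only [eval_C, pderiv_C, map_zero, zero_smul, Finset.sum_const_zero]
    exact hasFDerivAt_const a x
  | add p r hp hr =>
    simp only [map_add, add_smul, Finset.sum_add_distrib]
    exact hp.add hr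
  | mul_X p j hp =>
    have h := hp.mul (EuclideanSpace.proj j : Plane →L[ℝ] ℝ).hasFDerivAt
    simp only [map_mul, eval_X]
    refine h.congr_fderiv ?_
    ext y
    simp only [Fin.sum_univ_two, add_apply, smul_apply, pderiv_mul, map_add, map_mul, eval_X,
      smul_eq_mul]
    fin_cases j <;> simp [pderiv_X] <;> ring

lemma totalDegree_le_of_forall_monomial {F : MvPolynomial (Fin 2) ℝ →ₗ[ℝ] MvPolynomial (Fin 2) ℝ}
    {q q' : ℕ} (hF : ∀ s a, s.sum (fun _ e => e) ≤ q → (F (monomial s a)).totalDegree ≤ q')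
    {P : MvPolynomial (Fin 2) ℝ} (hP : P.totalDegree ≤ q) : (F P).totalDegree ≤ q' := by
  rw [P.as_sum, map_sum]
  exact totalDegree_finsetSum_le fun s hs => hF _ _ ((le_totalDegree hs).trans hP)

lemma totalDegree_pderiv_le (i : Fin 2) {q : ℕ} {P : MvPolynomial (Fin 2) ℝ}
    (hP : P.totalDegree ≤ q) : (pderiv i P).totalDegree ≤ q - 1 := by
  refine totalDegree_le_of_forall_monomial (F := (pderiv (R := ℝ) i).toLinearMap)
    (fun s a hs => ?_) hP
  change (pderiv i (monomial s a)).totalDegree ≤ _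
  rw [pderiv_monomial]
  -- Monomials without the variable `i` have zero derivative, so the truncated subtraction is
  -- harmless when `q = 0`.
  rcases Nat.eq_zero_or_pos (s i) with h | h
  · simp [h]
  refine (totalDegree_monomial_le _ _).trans ?_
  rw [Finsupp.sum_fintype _ _ (by simp), Fin.sum_univ_two] at *
  simp only [Finsupp.coe_tsub, Pi.sub_apply]
  fin_cases i <;> simp at h ⊢ <;> omega

namespace IsPolyFun

variable {q q' : ℕ} {f g : Plane → ℝ}

lemma contDiff (hf : IsPolyFun q f) {n : WithTop ℕ∞} : ContDiff ℝ n f := by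
  obtain ⟨P, -, hf⟩ := hf
  rw [funext hf]
  clear hf
  induction P using MvPolynomial.induction_on with
  | C a => simpa using contDiff_const
  | add p r hp hr => simpa using hp.add hr
  | mul_X p j hp => simpa using hp.mul (EuclideanSpace.proj j : Plane →L[ℝ] ℝ).contDiff

lemma differentiable (hf : IsPolyFun q f) : Differentiable ℝ f :=
  hf.contDiff.differentiable (n := 1) one_ne_zero

lemma continuous (hf : IsPolyFun q f) : Continuous f := hf.differentiable.continuous

lemma fderiv_apply (hf : IsPolyFun q f) (ξ : Plane) :
    IsPolyFun (q - 1) fun x => fderiv ℝ f x ξ := by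
  obtain ⟨P, hP, hf⟩ := hf
  have : ∀ x : Plane, fderiv ℝ f x ξ = ∑ i, ξ i * eval (fun i => x i) (pderiv i P) := fun x => by
    rw [funext hf, (hasFDerivAt_eval P x).fderiv]
    simp [mul_comm]
  simp only [this]
  exact sum _ fun i _ => const_mul _ ⟨pderiv i P, totalDegree_pderiv_le i hP, fun _ => rfl⟩

/-- A polynomial function which vanishes on a set with nonempty interior is zero. -/
lemma eq_zero_of_eqOn (hf : IsPolyFun q f) {K : Set Plane} (hK : (interior K).Nonempty)
    (h : ∀ x ∈ K, f x = 0) (x : Plane) : f x = 0 := by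
  obtain ⟨a, ha⟩ := hK
  obtain ⟨ε, hε, hb⟩ := Metric.isOpen_iff.1 isOpen_interior a ha
  -- On the line from an interior point `a` to `x`, the restriction vanishes near the parameter `0`,
  -- hence identically, in particular at the parameter `1`.
  obtain ⟨S, -, hS⟩ := hf.comp_line a (x - a)
  have hc : Filter.Tendsto (fun s : ℝ => a + s • (x - a)) (nhds 0) (nhds a) := by
    have : Continuous fun s : ℝ => a + s • (x - a) := by fun_prop
    simpa using this.tendsto 0
  have h0 : S = 0 := by
    refine Polynomial.eq_zero_of_infinite_isRoot S (Set.Infinite.mono ?_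
      (infinite_of_mem_nhds (0 : ℝ) (hc (Metric.ball_mem_nhds a hε))))
    intro s hs
    rw [mem_ofPred_eq, Polynomial.IsRoot.def, ← hS]
    exact h _ (interior_subset (hb hs))
  simpa [h0] using hS 1

end IsPolyFun

/-- Primitive of a polynomial with respect to the variable `i`. -/
noncomputable def mvPrimitive (i : Fin 2) : MvPolynomial (Fin 2) ℝ →ₗ[ℝ] MvPolynomial (Fin 2) ℝ :=
  (basisMonomials (Fin 2) ℝ).constr ℝ fun s =>
    monomial (s + Finsupp.single i 1) (1 / ((s i : ℝ) + 1))

lemma mvPrimitive_monomial (i : Fin 2) (s : Fin 2 →₀ ℕ) (a : ℝ) :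
    mvPrimitive i (monomial s a) = monomial (s + Finsupp.single i 1) (a / ((s i : ℝ) + 1)) := by
  have h1 : monomial s a = a • monomial s (1 : ℝ) := by simp [smul_monomial]
  have h2 := (basisMonomials (Fin 2) ℝ).constr_basis ℝ (fun s =>
    (monomial (s + Finsupp.single i 1) (1 / ((s i : ℝ) + 1)) : MvPolynomial (Fin 2) ℝ)) s
  rw [coe_basisMonomials] at h2
  rw [h1, map_smul, mvPrimitive, h2, smul_monomial]
  simp [div_eq_mul_inv]

lemma pderiv_mvPrimitive (i : Fin 2) (P : MvPolynomial (Fin 2) ℝ) :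
    pderiv i (mvPrimitive i P) = P := by
  induction P using MvPolynomial.induction_on' with
  | monomial s a =>
    rw [mvPrimitive_monomial, pderiv_monomial, add_tsub_cancel_right]
    congr 1
    simp
    field_simp
  | add p q hp hq => rw [map_add, map_add, hp, hq]

lemma pderiv_mvPrimitive_comm {i j : Fin 2} (hij : i ≠ j) (P : MvPolynomial (Fin 2) ℝ) :
    pderiv j (mvPrimitive i P) = mvPrimitive i (pderiv j P) := by
  induction P using MvPolynomial.induction_on' with
  | monomial s a =>
    rw [mvPrimitive_monomial, pderiv_monomial, pderiv_monomial, mvPrimitive_monomial]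
    have h1 : (s + Finsupp.single i 1 : Fin 2 →₀ ℕ) j = s j := by simp [hij]
    have h2 : (s - Finsupp.single j 1 : Fin 2 →₀ ℕ) i = s i := by simp [hij.symm]
    rw [h1, h2]
    rcases Nat.eq_zero_or_pos (s j) with h | h
    · simp [h]
    · have h3 : s + Finsupp.single i 1 - Finsupp.single j 1 =
          s - Finsupp.single j 1 + Finsupp.single i 1 := by
        ext l
        by_cases hl : l = j
        · subst hl; simp [hij]
        · simp [Ne.symm hl]
      rw [h3]
      congr 1
      ring
  | add p q hp hq => rw [map_add, map_add, map_add, map_add, hp, hq]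

lemma totalDegree_mvPrimitive_le (i : Fin 2) {q : ℕ} {P : MvPolynomial (Fin 2) ℝ}
    (hP : P.totalDegree ≤ q) : (mvPrimitive i P).totalDegree ≤ q + 1 := by
  refine totalDegree_le_of_forall_monomial (fun s a hs => ?_) hP
  rw [mvPrimitive_monomial]
  refine (totalDegree_monomial_le _ _).trans ?_
  rw [Finsupp.sum_fintype _ _ (by simp), Fin.sum_univ_two] at *
  simp only [Finsupp.coe_add, Pi.add_apply]
  fin_cases i <;> simp <;> omega

/-- Chaining the bounds for the derivative and for the primitive gives `q - 1 + 1`, which is too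
large for `q = 0`; monomials killed by the derivative are therefore set apart. -/
lemma totalDegree_mvPrimitive_pderiv_le {i j : Fin 2} (hij : i ≠ j) {q : ℕ}
    {P : MvPolynomial (Fin 2) ℝ} (hP : P.totalDegree ≤ q) :
    (mvPrimitive i (pderiv j P)).totalDegree ≤ q := by
  refine totalDegree_le_of_forall_monomial
    (F := mvPrimitive i ∘ₗ (pderiv (R := ℝ) j).toLinearMap) (fun s a hs => ?_) hP
  change (mvPrimitive i (pderiv j (monomial s a))).totalDegree ≤ _
  rw [pderiv_monomial, mvPrimitive_monomial]
  rcases Nat.eq_zero_or_pos (s j) with h | h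
  · simp [h]
  refine (totalDegree_monomial_le _ _).trans ?_
  rw [Finsupp.sum_fintype _ _ (by simp), Fin.sum_univ_two] at *
  simp only [Finsupp.coe_add, Finsupp.coe_tsub, Pi.add_apply, Pi.sub_apply]
  fin_cases i <;> fin_cases j <;> simp at h hij ⊢ <;> omega

/-- Integrate `P` in the first variable, then add the primitive in the second variable of what is
missing from `Q`; the hypothesis says that this remainder does not depend on the first variable. -/
lemma exists_pderiv_eq {q : ℕ} {P Q : MvPolynomial (Fin 2) ℝ} (hP : P.totalDegree ≤ q)
    (hQ : Q.totalDegree ≤ q) (hPQ : pderiv 1 P = pderiv 0 Q) :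
    ∃ R : MvPolynomial (Fin 2) ℝ, R.totalDegree ≤ q + 1 ∧ pderiv 0 R = P ∧ pderiv 1 R = Q := by
  refine ⟨mvPrimitive 0 P + mvPrimitive 1 (Q - mvPrimitive 0 (pderiv 1 P)), ?_, ?_, ?_⟩
  · refine (totalDegree_add _ _).trans (max_le (totalDegree_mvPrimitive_le 0 hP)
      (totalDegree_mvPrimitive_le 1 ((totalDegree_sub _ _).trans (max_le hQ
        (totalDegree_mvPrimitive_pderiv_le (by decide) hP)))))
  · rw [map_add, pderiv_mvPrimitive, pderiv_mvPrimitive_comm (by decide), map_sub,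
      pderiv_mvPrimitive, hPQ, sub_self, map_zero, add_zero]
  · rw [map_add, pderiv_mvPrimitive, pderiv_mvPrimitive_comm (by decide), add_sub_cancel]

/-- A closed polynomial `1`-form is exact. -/
lemma exists_primitive {q : ℕ} {a b : Plane → ℝ} (ha : IsPolyFun q a) (hb : IsPolyFun q b)
    (hab : ∀ x, fderiv ℝ a x (EuclideanSpace.single 1 1) =
      fderiv ℝ b x (EuclideanSpace.single 0 1)) :
    ∃ f, IsPolyFun (q + 1) f ∧ ∀ x ξ, fderiv ℝ f x ξ = ξ 0 * a x + ξ 1 * b x := by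
  obtain ⟨P, hP, ha⟩ := ha
  obtain ⟨Q, hQ, hb⟩ := hb
  rw [funext ha, funext hb] at hab
  have hPQ : pderiv 1 P = pderiv 0 Q := by
    refine MvPolynomial.funext fun y => ?_
    have := hab (WithLp.toLp 2 y)
    rw [(hasFDerivAt_eval P _).fderiv, (hasFDerivAt_eval Q _).fderiv] at this
    simpa using this
  obtain ⟨R, hR, h0, h1⟩ := exists_pderiv_eq hP hQ hPQ
  refine ⟨fun x => eval (fun i => x i) R, ⟨R, hR, fun _ => rfl⟩, fun x ξ => ?_⟩
  rw [(hasFDerivAt_eval _ x).fderiv, Fin.sum_univ_two, h0, h1]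
  simp [ha, hb, mul_comm]

/-- The inverse of `P ↦ 2 P + ∑ X_i ∂_i P`. -/
noncomputable def mvEulerInv : MvPolynomial (Fin 2) ℝ →ₗ[ℝ] MvPolynomial (Fin 2) ℝ :=
  (basisMonomials (Fin 2) ℝ).constr ℝ fun s => monomial s (1 / ((s 0 : ℝ) + s 1 + 2))

lemma mvEulerInv_monomial (s : Fin 2 →₀ ℕ) (a : ℝ) :
    mvEulerInv (monomial s a) = monomial s (a / ((s 0 : ℝ) + s 1 + 2)) := by
  have h1 : monomial s a = a • monomial s (1 : ℝ) := by simp [smul_monomial]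
  have h2 := (basisMonomials (Fin 2) ℝ).constr_basis ℝ (fun s =>
    (monomial s (1 / ((s 0 : ℝ) + s 1 + 2)) : MvPolynomial (Fin 2) ℝ)) s
  rw [coe_basisMonomials] at h2
  rw [h1, map_smul, mvEulerInv, h2, smul_monomial]
  simp [div_eq_mul_inv]

/-- By Euler's identity, monomials of degree `n` are eigenvectors with eigenvalue `n + 2`, which is
never zero. -/
lemma euler_mvEulerInv (P : MvPolynomial (Fin 2) ℝ) :
    2 * mvEulerInv P + (X 0 * pderiv 0 (mvEulerInv P) + X 1 * pderiv 1 (mvEulerInv P)) = P := by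
  induction P using MvPolynomial.induction_on' with
  | monomial s a =>
    rw [mvEulerInv_monomial, X_mul_pderiv_monomial, X_mul_pderiv_monomial]
    have : (2 : MvPolynomial (Fin 2) ℝ) = C 2 := (map_ofNat C 2).symm
    rw [this, C_mul_monomial, ← Nat.cast_smul_eq_nsmul ℝ, ← Nat.cast_smul_eq_nsmul ℝ,
      smul_monomial, smul_monomial, ← map_add, ← map_add]
    congr 1
    simp only [smul_eq_mul]
    field_simp
    ring
  | add p q hp hq =>
    conv_rhs => rw [← hp, ← hq]
    simp only [map_add]
    ring

/-- The equation `2 φ + Dφ(x) (x - W) = w` has polynomial solutions. -/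
lemma exists_euler {q : ℕ} {w : Plane → ℝ} (hw : IsPolyFun q w) (W : Plane) :
    ∃ φ, IsPolyFun q φ ∧ ∀ x, 2 * φ x + fderiv ℝ φ x (x - W) = w x := by
  -- The equation is translated so that `W` becomes the origin.
  obtain ⟨P, hP, hw'⟩ := hw.comp_affine (A := fun x => x + W) fun i =>
    (IsPolyFun.coord i).add (IsPolyFun.const 1 (W i))
  let ψ : Plane → ℝ := fun x => eval (fun i => x i) (mvEulerInv P)
  have hψ : IsPolyFun q ψ := by
    refine ⟨_, totalDegree_le_of_forall_monomial (fun s a hs => ?_) hP, fun _ => rfl⟩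
    rw [mvEulerInv_monomial]
    exact (totalDegree_monomial_le _ _).trans hs
  refine ⟨fun x => ψ (x - W), hψ.comp_affine fun i =>
    (IsPolyFun.coord i).sub (IsPolyFun.const 1 (W i)), fun x => ?_⟩
  have h1 : fderiv ℝ (fun x => ψ (x - W)) x = fderiv ℝ ψ (x - W) := by
    rw [fderiv_comp_sub]
  rw [h1, (hasFDerivAt_eval _ _).fderiv]
  have h2 := congr_arg (eval fun i => (x - W) i) (euler_mvEulerInv P)
  rw [← hw'] at h2
  simp only [sub_add_cancel] at h2
  rw [← h2]
  simp [Fin.sum_univ_two, ψ]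
  ring

end PolyFun

/-! ### Polynomial differential forms and their potentials -/

section PolyForm

open Set

/-- The components of a form with respect to the canonical basis. -/
noncomputable def altCoord (k : ℕ) : AltForm k →ₗ[ℝ] ((Fin k → Fin 2) → ℝ) where
  toFun u := fun f => u fun j => EuclideanSpace.single (f j) 1
  map_add' _ _ := rfl
  map_smul' _ _ := rfl

lemma altCoord_injective (k : ℕ) : Function.Injective (altCoord k) := by
  intro u w h
  apply ContinuousAlternatingMap.toAlternatingMap_injective
  refine Module.Basis.ext_alternating (EuclideanSpace.basisFun (Fin 2) ℝ).toBasis fun f _ => ?_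
  have h1 := congr_fun h f
  simp only [OrthonormalBasis.coe_toBasis, EuclideanSpace.basisFun_apply]
  exact h1

/-- Reconstruction of a form from its components. -/
noncomputable def altOfCoord (k : ℕ) : ((Fin k → Fin 2) → ℝ) →ₗ[ℝ] AltForm k :=
  ((altCoord k).exists_leftInverse_of_injective
    (LinearMap.ker_eq_bot.2 (altCoord_injective k))).choose

lemma altOfCoord_altCoord {k : ℕ} (u : AltForm k) : altOfCoord k (altCoord k u) = u :=
  LinearMap.congr_fun ((altCoord k).exists_leftInverse_of_injective
    (LinearMap.ker_eq_bot.2 (altCoord_injective k))).choose_spec u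

lemma altForm_eq_zero {k : ℕ} (hk : 3 ≤ k) (u : AltForm k) : u = 0 := by
  apply altCoord_injective k
  ext f
  obtain ⟨i, j, hij, hf⟩ := Fintype.exists_ne_map_eq_of_card_lt f (by simp; omega)
  exact (u.map_eq_zero_of_eq (fun j => EuclideanSpace.single (f j) (1 : ℝ)) (by simp [hf]) hij).trans
    (by simp)

/-- Polynomial forms on the plane, of degree at most `q`. -/
def IsPolyForm (q : ℕ) {k : ℕ} (g : Plane → AltForm k) : Prop := ∀ ξ, IsPolyFun q fun x => g x ξ

lemma IsPolyForm.isPolyOn {q k : ℕ} {g : Plane → AltForm k} (hg : IsPolyForm q g) (K : Set Plane) :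
    IsPolyOn q g K := fun ξ => by
  obtain ⟨P, hP, h⟩ := hg ξ
  exact ⟨P, hP, fun x _ => h x⟩

lemma isPolyForm_altOfCoord {q k : ℕ} {c : Plane → (Fin k → Fin 2) → ℝ}
    (hc : ∀ f, IsPolyFun q fun x => c x f) : IsPolyForm q fun x => altOfCoord k (c x) := by
  intro ξ
  have : ∀ x, altOfCoord k (c x) ξ = ∑ f, altOfCoord k (Pi.single f 1) ξ * c x f := by
    intro x
    have h1 : c x = ∑ f, c x f • (Pi.single f 1 : (Fin k → Fin 2) → ℝ) := by
      ext f
      simp [Pi.single_apply]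
    conv_lhs => rw [h1]
    simp [map_sum, mul_comm]
  simp only [this]
  exact IsPolyFun.sum _ fun f _ => (hc f).const_mul _

/-- `IsPolyOn` supplies unrelated polynomials for different tuples of vectors. Only those of basis
tuples are kept, and a form is rebuilt from them by linearity. -/
lemma IsPolyOn.exists_polyForm {q k : ℕ} {u : Plane → AltForm k} {K : Set Plane}
    (h : IsPolyOn q u K) : ∃ g, IsPolyForm q g ∧ ∀ x ∈ K, u x = g x := by
  choose P hP hu using fun f : Fin k → Fin 2 => h fun j => EuclideanSpace.single (f j) 1
  refine ⟨fun x => altOfCoord k fun f => MvPolynomial.eval (fun i => x i) (P f),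
    isPolyForm_altOfCoord fun f => ⟨P f, hP f, fun _ => rfl⟩, fun x hx => ?_⟩
  rw [← altOfCoord_altCoord (u x)]
  congr 1
  ext f
  exact hu f x hx

namespace IsPolyForm

variable {q q' k : ℕ} {g h : Plane → AltForm k}

lemma contDiff (hg : IsPolyForm q g) : ContDiff ℝ ∞ g := by
  have : g = fun x => (altOfCoord k).toContinuousLinearMap (altCoord k (g x)) := by
    ext1 x
    exact (altOfCoord_altCoord (g x)).symm
  rw [this]
  refine (altOfCoord k).toContinuousLinearMap.contDiff.comp (contDiff_pi.2 fun f => ?_)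
  exact (hg _).contDiff

lemma differentiable (hg : IsPolyForm q g) : Differentiable ℝ g :=
  hg.contDiff.differentiable (by simp)

lemma mono (hg : IsPolyForm q g) (hq : q ≤ q') : IsPolyForm q' g := fun ξ => (hg ξ).mono hq

lemma smul {f : Plane → ℝ} (hf : IsPolyFun q' f) (hg : IsPolyForm q g) :
    IsPolyForm (q' + q) fun x => f x • g x := fun ξ => hf.mul (hg ξ)

lemma zero (q k : ℕ) : IsPolyForm q fun _ => (0 : AltForm k) := fun _ => IsPolyFun.const q 0

lemma const (q : ℕ) (u : AltForm k) : IsPolyForm q fun _ => u := fun ξ => IsPolyFun.const q (u ξ)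

lemma eq_zero_of_eqOn (hg : IsPolyForm q g) {K : Set Plane} (hK : (interior K).Nonempty)
    (h : ∀ x ∈ K, g x = 0) (x : Plane) : g x = 0 := by
  ext ξ
  exact (hg ξ).eq_zero_of_eqOn hK (fun y hy => by simp [h y hy]) x

lemma extDeriv (hg : IsPolyForm q g) : IsPolyForm (q - 1) (extDeriv g) := by
  intro ξ
  have : ∀ x, _root_.extDeriv g x ξ = ∑ i : Fin (k + 1), (-1 : ℝ) ^ (i : ℕ) *
      fderiv ℝ (g · (i.removeNth ξ)) x (ξ i) := fun x => by
    rw [extDeriv_apply (hg.differentiable x)]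
    refine Finset.sum_congr rfl fun i _ => ?_
    simp only [zsmul_eq_mul, Int.cast_pow, Int.cast_neg, Int.cast_one]
  simp only [this]
  exact IsPolyFun.sum _ fun i _ => ((hg _).fderiv_apply _).const_mul _

end IsPolyForm

/-- The `0`-form given by a function. -/
noncomputable def form0 (φ : Plane → ℝ) (x : Plane) : AltForm 0 :=
  ContinuousAlternatingMap.constOfIsEmpty ℝ Plane (Fin 0) (φ x)

@[simp] lemma form0_apply (φ : Plane → ℝ) (x : Plane) (ξ : Fin 0 → Plane) : form0 φ x ξ = φ x := rfl

lemma eq_form0 (g : Plane → AltForm 0) : g = form0 fun x => g x ![] := by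
  ext x ξ
  rw [form0_apply, Subsingleton.elim ξ ![]]

lemma IsPolyFun.form0 {q : ℕ} {φ : Plane → ℝ} (h : IsPolyFun q φ) : IsPolyForm q (form0 φ) :=
  fun _ => h

/-- The `1`-form with given linear form as value. -/
noncomputable def form1 (L : Plane →L[ℝ] ℝ) : AltForm 1 :=
  ContinuousAlternatingMap.ofSubsingleton ℝ Plane ℝ (0 : Fin 1) L

@[simp] lemma form1_apply (L : Plane →L[ℝ] ℝ) (ξ : Fin 1 → Plane) : form1 L ξ = L (ξ 0) := rfl

lemma extDeriv_form0 (φ : Plane → ℝ) (x : Plane) : extDeriv (form0 φ) x = form1 (fderiv ℝ φ x) :=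
  extDeriv_constOfIsEmpty φ x

lemma fin_one_eq (ξ : Fin 1 → Plane) : ξ = fun _ => ξ 0 := by
  ext1 j
  rw [Subsingleton.elim j 0]

lemma altForm_one_ext {u w : AltForm 1} (h : ∀ ξ, u (fun _ => ξ) = w fun _ => ξ) : u = w := by
  ext ξ
  rw [fin_one_eq ξ, h]

lemma extDeriv_one_apply {q : ℕ} {g : Plane → AltForm 1} (hg : IsPolyForm q g) (x : Plane)
    (ξ : Fin 2 → Plane) : extDeriv g x ξ =
      fderiv ℝ (fun y => g y fun _ => ξ 1) x (ξ 0) - fderiv ℝ (fun y => g y fun _ => ξ 0) x (ξ 1) := by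
  rw [extDeriv_apply (hg.differentiable x), Fin.sum_univ_two]
  have h0 : (0 : Fin 2).removeNth ξ = fun _ => ξ 1 := by
    ext1 j; rw [Subsingleton.elim j 0]; rfl
  have h1 : (1 : Fin 2).removeNth ξ = fun _ => ξ 0 := by
    ext1 j; rw [Subsingleton.elim j 0]; rfl
  rw [h0, h1]
  simp [sub_eq_add_neg]

/-- The canonical area form. -/
noncomputable def vol2 : AltForm 2 :=
  ContinuousAlternatingMap.alternatizeUncurryFin
    ((EuclideanSpace.proj 0 : Plane →L[ℝ] ℝ).smulRight (form1 (EuclideanSpace.proj 1)))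

lemma vol2_apply (ξ : Fin 2 → Plane) : vol2 ξ = ξ 0 0 * ξ 1 1 - ξ 1 0 * ξ 0 1 := by
  rw [vol2, ContinuousAlternatingMap.alternatizeUncurryFin_apply, Fin.sum_univ_two]
  simp [Fin.removeNth, sub_eq_add_neg, Fin.tail,
    show (1 : Fin 2).succAbove (0 : Fin 1) = 0 from rfl]

lemma eq_smul_vol2 (u : AltForm 2) :
    u = u (fun j => EuclideanSpace.single j 1) • vol2 := by
  apply ContinuousAlternatingMap.toAlternatingMap_injective
  refine Module.Basis.ext_alternating (EuclideanSpace.basisFun (Fin 2) ℝ).toBasis fun f hf => ?_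
  have h : f = id ∨ f = ![1, 0] := by
    revert f; decide
  rcases h with rfl | rfl
  · simp [vol2_apply]
  · have h1 : (fun i => EuclideanSpace.single (![(1 : Fin 2), 0] i) (1 : ℝ)) =
        (fun j => EuclideanSpace.single j (1 : ℝ)) ∘ Equiv.swap (0 : Fin 2) 1 := by
      ext1 i
      fin_cases i <;> simp
    have h2 := u.toAlternatingMap.map_swap (fun j => EuclideanSpace.single j (1 : ℝ))
      (show (0 : Fin 2) ≠ 1 by decide)
    simp [vol2_apply]
    simp at h2
    rw [h1, h2]

/-- A closed polynomial `1`-form is the differential of a polynomial function. -/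
lemma exists_extDeriv_form0_eq {q : ℕ} {g : Plane → AltForm 1} (hg : IsPolyForm q g)
    (h : ∀ x, extDeriv g x = 0) :
    ∃ f, IsPolyFun (q + 1) f ∧ ∀ x, extDeriv (form0 f) x = g x := by
  obtain ⟨f, hf, hd⟩ := exists_primitive (hg fun _ => EuclideanSpace.single 0 1)
    (hg fun _ => EuclideanSpace.single 1 1) (fun x => by
      have := congr_arg (fun u => u fun j => EuclideanSpace.single j 1) (h x)
      simp only [extDeriv_one_apply hg] at this
      exact (sub_eq_zero.1 this).symm)
  refine ⟨f, hf, fun x => ?_⟩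
  rw [extDeriv_form0]
  refine altForm_one_ext fun ξ => ?_
  rw [form1_apply, hd]
  have h1 : ξ = ξ 0 • EuclideanSpace.single 0 1 + ξ 1 • EuclideanSpace.single 1 1 := by
    ext i; fin_cases i <;> simp
  let L := (ContinuousAlternatingMap.ofSubsingleton ℝ Plane ℝ (0 : Fin 1)).symm (g x)
  have hL : ∀ η, (g x fun _ => η) = L η := fun η => rfl
  simp only [hL]
  conv_rhs => rw [h1]
  simp

/-- The contraction of the area form with `x - W`. -/
noncomputable def koszul (W x : Plane) : AltForm 1 :=
  form1 ((x - W) 0 • EuclideanSpace.proj 1 - (x - W) 1 • EuclideanSpace.proj 0)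

lemma koszul_apply (W x : Plane) (ξ : Fin 1 → Plane) :
    koszul W x ξ = (x - W) 0 * ξ 0 1 - (x - W) 1 * ξ 0 0 := by
  simp [koszul]

lemma isPolyForm_koszul (W : Plane) : IsPolyForm 1 (koszul W) := by
  intro ξ
  simp only [koszul_apply]
  have : ∀ i, IsPolyFun 1 fun x : Plane => (x - W) i := fun i =>
    (IsPolyFun.coord i).sub (IsPolyFun.const 1 (W i))
  simp only [mul_comm _ (ξ 0 _)]
  exact ((this 0).const_mul _).sub ((this 1).const_mul _)

/-- The form is the contraction of the area form with the field `φ (x - W)`, and its exterior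
derivative is the divergence of that field, the plane contributing the factor `2`. -/
lemma extDeriv_smul_koszul {q : ℕ} {φ : Plane → ℝ} (hφ : IsPolyFun q φ) (W x : Plane) :
    extDeriv (fun y => φ y • koszul W y) x = (2 * φ x + fderiv ℝ φ x (x - W)) • vol2 := by
  ext ξ
  have hd : ∀ η ζ : Plane, fderiv ℝ (fun y => φ y * ((y - W) 0 * η 1 - (y - W) 1 * η 0)) x ζ =
      fderiv ℝ φ x ζ * ((x - W) 0 * η 1 - (x - W) 1 * η 0) + φ x * (ζ 0 * η 1 - ζ 1 * η 0) := by
    intro η ζ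
    have h1 := (hφ.differentiable x).hasFDerivAt
    have h2 : ∀ i, HasFDerivAt (fun y : Plane => (y - W) i)
        (EuclideanSpace.proj i : Plane →L[ℝ] ℝ) x := fun i =>
      (EuclideanSpace.proj i : Plane →L[ℝ] ℝ).hasFDerivAt.sub_const (W i)
    have h3 := h1.mul (((h2 0).mul_const (η 1)).sub ((h2 1).mul_const (η 0)))
    have h4 := congr_arg (fun L : Plane →L[ℝ] ℝ => L ζ) h3.fderiv
    refine Eq.trans h4 ?_
    simp
    ring
  rw [extDeriv_one_apply (IsPolyForm.smul hφ (isPolyForm_koszul W))]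
  simp only [ContinuousAlternatingMap.smul_apply, koszul_apply, smul_eq_mul, hd, vol2_apply]
  have h1 : ∀ ζ : Plane, fderiv ℝ φ x ζ = ζ 0 * fderiv ℝ φ x (EuclideanSpace.single 0 1) +
      ζ 1 * fderiv ℝ φ x (EuclideanSpace.single 1 1) := by
    intro ζ
    have h1 : ζ = ζ 0 • EuclideanSpace.single 0 1 + ζ 1 • EuclideanSpace.single 1 1 := by
      ext i; fin_cases i <;> simp
    conv_lhs => rw [h1]
    simp
  rw [h1 (ξ 0), h1 (ξ 1), h1 (x - W)]
  ring

/-- Uniqueness for the equation `2 φ + Dφ(x) (x - W) = w` along a ray from `W`. -/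
lemma euler_unique {q : ℕ} {φ : Plane → ℝ} (hφ : IsPolyFun q φ) {W x : Plane}
    (h : ∀ s ∈ Icc (0 : ℝ) 1, 2 * φ (W + s • (x - W)) +
      fderiv ℝ φ (W + s • (x - W)) (s • (x - W)) = 0) : φ x = 0 := by
  -- The factor `s ^ 2` is the integrating factor: the product is constant along the ray and
  -- vanishes at `W`.
  have hd : ∀ s : ℝ, HasDerivAt (fun s : ℝ => s ^ 2 * φ (W + s • (x - W)))
      (s * (2 * φ (W + s • (x - W)) + fderiv ℝ φ (W + s • (x - W)) (s • (x - W)))) s := by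
    intro s
    have h1 : HasDerivAt (fun s : ℝ => W + s • (x - W)) ((1 : ℝ) • (x - W)) s :=
      ((hasDerivAt_id s).smul_const (x - W)).const_add W
    have h2 := (hφ.differentiable (W + s • (x - W))).hasFDerivAt.comp_hasDerivAt s h1
    have h3 := (hasDerivAt_pow 2 s).mul h2
    refine h3.congr_deriv ?_
    simp
    ring
  have := (convex_Icc (0 : ℝ) 1).is_const_of_fderivWithin_eq_zero (𝕜 := ℝ)
    (f := fun s : ℝ => s ^ 2 * φ (W + s • (x - W)))
    (fun s _ => (hd s).differentiableAt.differentiableWithinAt) (fun s hs => by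
      rw [fderivWithin_eq_fderiv (uniqueDiffOn_Icc_zero_one s hs) (hd s).differentiableAt]
      rw [(hd s).hasFDerivAt.fderiv, h s hs, mul_zero]
      simp) (x := 1) (y := 0) (by simp) (by simp)
  simpa using this

end PolyForm

/-! ### Barycentric coordinates and the Clough–Tocher pieces -/

section Geometry

open Set

variable {v : Fin 3 → Plane} (hv : AffineIndependent ℝ v)

/-- The vertices of the triangle, as an affine basis of the plane. -/
noncomputable def triBasis : AffineBasis (Fin 3) ℝ Plane where
  toFun := v
  ind' := hv
  tot' := hv.affineSpan_eq_top_iff_card_eq_finrank_add_one.2 (by simp)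

/-- The barycentric coordinates with respect to the triangle. -/
noncomputable def bary (i : Fin 3) (x : Plane) : ℝ := (triBasis hv).coord i x

/-- The gradients of the barycentric coordinates. -/
noncomputable def baryGrad (i : Fin 3) : Plane →L[ℝ] ℝ :=
  ((triBasis hv).coord i).linear.toContinuousLinearMap

lemma bary_sum (x : Plane) : ∑ i, bary hv i x = 1 := (triBasis hv).sum_coord_apply_eq_one x

lemma sum_bary_smul (x : Plane) : ∑ i, bary hv i x • v i = x :=
  (triBasis hv).linear_combination_coord_eq_self x

lemma bary_vertex (i j : Fin 3) : bary hv i (v j) = if i = j then 1 else 0 :=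
  (triBasis hv).coord_apply i j

lemma bary_add (i : Fin 3) (x ξ : Plane) : bary hv i (x + ξ) = bary hv i x + baryGrad hv i ξ := by
  rw [add_comm x, add_comm (bary hv i x)]
  exact ((triBasis hv).coord i).map_vadd x ξ

lemma baryGrad_sub (i : Fin 3) (x y : Plane) : baryGrad hv i (x - y) = bary hv i x - bary hv i y := by
  rw [eq_sub_iff_add_eq', ← bary_add, add_sub_cancel]

lemma bary_eq (i : Fin 3) (x : Plane) : bary hv i x = baryGrad hv i x + bary hv i 0 := by
  rw [add_comm, ← bary_add, zero_add]

lemma isPolyFun_bary (i : Fin 3) : IsPolyFun 1 (bary hv i) := by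
  rw [funext (bary_eq hv i)]
  exact IsPolyFun.affine _ _

lemma hasFDerivAt_bary (i : Fin 3) (x : Plane) :
    HasFDerivAt (bary hv i) (baryGrad hv i) x := by
  rw [funext (bary_eq hv i)]
  exact (baryGrad hv i).hasFDerivAt.add_const _

lemma continuous_bary (i : Fin 3) : Continuous (bary hv i) := (isPolyFun_bary hv i).continuous

lemma sum_baryGrad (ξ : Plane) : ∑ i, baryGrad hv i ξ = 0 := by
  have h1 := bary_sum hv (0 + ξ)
  simp only [bary_add, Finset.sum_add_distrib, bary_sum] at h1
  linarith

lemma sum_baryGrad_smul (ξ : Plane) : ∑ i, baryGrad hv i ξ • v i = ξ := by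
  have h1 := sum_bary_smul hv (0 + ξ)
  simp only [bary_add, add_smul, Finset.sum_add_distrib] at h1
  rw [sum_bary_smul, zero_add, zero_add] at h1
  exact h1

lemma eq_baryGrad_smul (ξ : Plane) :
    ξ = baryGrad hv 1 ξ • (v 1 - v 0) + baryGrad hv 2 ξ • (v 2 - v 0) := by
  have h0 := sum_baryGrad hv ξ
  have h1 := sum_baryGrad_smul hv ξ
  rw [Fin.sum_univ_three] at h0 h1
  have h2 : baryGrad hv 0 ξ = - baryGrad hv 1 ξ - baryGrad hv 2 ξ := by linarith
  rw [h2] at h1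
  conv_lhs => rw [← h1]
  module

lemma bary_combo (i : Fin 3) {a b : ℝ} (hab : a + b = 1) (x y : Plane) :
    bary hv i (a • x + b • y) = a * bary hv i x + b * bary hv i y := by
  have h : a • x + b • y = x + b • (y - x) := by
    obtain rfl : a = 1 - b := by linarith
    module
  rw [h, bary_add, map_smul, baryGrad_sub, smul_eq_mul]
  obtain rfl : a = 1 - b := by linarith
  ring

lemma bary_line (i : Fin 3) (x y : Plane) (s : ℝ) :
    bary hv i (x + s • (y - x)) = (1 - s) * bary hv i x + s * bary hv i y := by
  rw [bary_add, map_smul, baryGrad_sub, smul_eq_mul]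
  ring

lemma bary_sum_smul (i : Fin 3) {a : Fin 3 → ℝ} (ha : ∑ j, a j = 1) :
    bary hv i (∑ j, a j • v j) = a i := by
  have h : ∑ j, a j • v j = v 0 + (a 1 • (v 1 - v 0) + a 2 • (v 2 - v 0)) := by
    rw [Fin.sum_univ_three] at ha ⊢
    obtain h0 : a 0 = 1 - a 1 - a 2 := by linarith
    rw [h0]
    module
  rw [Fin.sum_univ_three] at ha
  rw [h, bary_add, map_add, map_smul, map_smul, baryGrad_sub, baryGrad_sub]
  simp only [bary_vertex, smul_eq_mul]
  fin_cases i <;> (simp; try linarith)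

/-- Cells in barycentric coordinates. -/
lemma mem_cellSet_iff (c : TriCell) (x : Plane) :
    x ∈ cellSet v c ↔ (∀ i, 0 ≤ bary hv i x) ∧ ∀ i ∉ c.1, bary hv i x = 0 := by
  constructor
  · intro hx
    have hconv : Convex ℝ {x | (∀ i, 0 ≤ bary hv i x) ∧ ∀ i ∉ c.1, bary hv i x = 0} := by
      intro x hx y hy a b ha hb hab
      refine ⟨fun i => ?_, fun i hi => ?_⟩
      · rw [bary_combo hv i hab]
        exact add_nonneg (mul_nonneg ha (hx.1 i)) (mul_nonneg hb (hy.1 i))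
      · rw [bary_combo hv i hab, hx.2 i hi, hy.2 i hi]
        simp
    refine convexHull_min ?_ hconv hx
    rintro _ ⟨j, hj, rfl⟩
    refine ⟨fun i => ?_, fun i hi => ?_⟩
    · rw [bary_vertex]; split_ifs <;> norm_num
    · rw [bary_vertex, if_neg]
      rintro rfl
      exact hi hj
  · rintro ⟨h0, h1⟩
    rw [← sum_bary_smul hv x]
    have h2 : ∑ i, bary hv i x • v i = ∑ i ∈ c.1, bary hv i x • v i := by
      refine (Finset.sum_subset (Finset.subset_univ _) fun i _ hi => ?_).symm
      rw [h1 i hi, zero_smul]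
    rw [h2]
    refine (convex_convexHull ℝ _).sum_mem (fun i _ => h0 i) ?_ fun i hi =>
      subset_convexHull ℝ _ ⟨i, hi, rfl⟩
    rw [← bary_sum hv x]
    exact Finset.sum_subset (Finset.subset_univ _) fun i _ hi => h1 i hi

lemma mem_triTop_iff (x : Plane) : x ∈ cellSet v triTop ↔ ∀ i, 0 ≤ bary hv i x := by
  rw [mem_cellSet_iff hv]
  simp [triTop]

variable {W : Plane} (hW : W ∈ interior (convexHull ℝ (range v)))

lemma bary_inpoint_pos (hW : W ∈ interior (convexHull ℝ (range v))) (i : Fin 3) :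
    0 < bary hv i W := by
  have : interior (convexHull ℝ (range (triBasis hv))) = _ := (triBasis hv).interior_convexHull
  rw [show (range (triBasis hv)) = range v from rfl] at this
  rw [this] at hW
  exact hW i

/-- The subtriangle opposite to a vertex. -/
def piece (v : Fin 3 → Plane) (W : Plane) (i : Fin 3) : Set Plane :=
  convexHull ℝ (insert W (v '' {j | j ≠ i}))

lemma cellPieces_triTop : cellPieces v W triTop = range (piece v W) := by
  rw [cellPieces, if_pos rfl]
  rfl

/-- Barycentric coordinates scaled to the value one at the inpoint. -/
noncomputable def mu (W : Plane) (i : Fin 3) (x : Plane) : ℝ := bary hv i x / bary hv i W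

lemma isPolyFun_mu (W : Plane) (i : Fin 3) : IsPolyFun 1 (mu hv W i) := by
  have : mu hv W i = fun x => (bary hv i W)⁻¹ * bary hv i x := by
    ext1 x; rw [mu, div_eq_inv_mul]
  rw [this]
  exact (isPolyFun_bary hv i).const_mul _

lemma hasFDerivAt_mu (W : Plane) (i : Fin 3) (x : Plane) :
    HasFDerivAt (mu hv W i) ((bary hv i W)⁻¹ • baryGrad hv i) x := by
  have : mu hv W i = fun x => (bary hv i W)⁻¹ * bary hv i x := by
    ext1 x; rw [mu, div_eq_inv_mul]
  rw [this]
  exact (hasFDerivAt_bary hv i x).const_mul _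

include hW in
-- The functions `mu` all equal one at `W`, and the piece opposite to a vertex is the part of the
-- triangle where the corresponding `mu` is least. Indeed, subtracting `mu i x` times `W` from `x`
-- leaves a combination of vertices without the `i`-th one, with coefficients that are nonnegative
-- exactly under these inequalities.
lemma mem_piece_iff (i : Fin 3) (x : Plane) :
    x ∈ piece v W i ↔ 0 ≤ bary hv i x ∧ ∀ j, mu hv W i x ≤ mu hv W j x := by
  have hpos := bary_inpoint_pos hv hW
  constructor
  · intro hx
    have hconv : Convex ℝ {x | 0 ≤ bary hv i x ∧ ∀ j, mu hv W i x ≤ mu hv W j x} := by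
      intro x hx y hy a b ha hb hab
      refine ⟨?_, fun j => ?_⟩
      · rw [bary_combo hv i hab]
        exact add_nonneg (mul_nonneg ha hx.1) (mul_nonneg hb hy.1)
      · have h1 : ∀ j, mu hv W j (a • x + b • y) = a * mu hv W j x + b * mu hv W j y := by
          intro j
          simp only [mu, bary_combo hv j hab]
          ring
        rw [h1, h1]
        exact add_le_add (mul_le_mul_of_nonneg_left (hx.2 j) ha)
          (mul_le_mul_of_nonneg_left (hy.2 j) hb)
    refine convexHull_min ?_ hconv hx
    rintro _ (rfl | ⟨j, hj, rfl⟩)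
    · refine ⟨(hpos i).le, fun j => ?_⟩
      rw [mu, mu, div_self (hpos i).ne', div_self (hpos j).ne']
    · have hj : i ≠ j := fun h => hj h.symm
      refine ⟨by simp [bary_vertex, hj], fun l => ?_⟩
      rw [mu, bary_vertex, if_neg hj, zero_div, mu, bary_vertex]
      split_ifs
      · exact div_nonneg zero_le_one (hpos l).le
      · simp
  · rintro ⟨h0, h1⟩
    have h2 : x = mu hv W i x • W + ∑ j, (bary hv j x - mu hv W i x * bary hv j W) • v j := by
      simp only [sub_smul, Finset.sum_sub_distrib, sum_bary_smul, mul_smul, ← Finset.smul_sum]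
      abel
    have hmi : 0 ≤ mu hv W i x := div_nonneg h0 (hpos i).le
    have h3 : ∀ j, 0 ≤ bary hv j x - mu hv W i x * bary hv j W := fun j => by
      have := h1 j
      rw [mu, mu, le_div_iff₀ (hpos j)] at this
      rw [mu]
      linarith
    have h4 : bary hv i x - mu hv W i x * bary hv i W = 0 := by
      rw [mu, div_mul_cancel₀ _ (hpos i).ne', sub_self]
    have h5 : ∑ j, (bary hv j x - mu hv W i x * bary hv j W) = 1 - mu hv W i x := by
      rw [Finset.sum_sub_distrib, ← Finset.mul_sum, bary_sum, bary_sum, mul_one]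
    -- The `i`-th coefficient is zero, so its point may be replaced by `W`; all points of the
    -- combination then belong to the piece.
    have h6 : x = ∑ j : Option (Fin 3),
        (Option.elim j (mu hv W i x) fun j => bary hv j x - mu hv W i x * bary hv j W) •
          (Option.elim j W fun j => if j = i then W else v j) := by
      rw [Fintype.sum_option]
      simp only [Option.elim]
      conv_lhs => rw [h2]
      congr 1
      refine Finset.sum_congr rfl fun j _ => ?_
      split_ifs with h
      · rw [h, h4, zero_smul, zero_smul]
      · rfl
    rw [h6]
    refine (convex_convexHull ℝ _).sum_mem ?_ ?_ ?_
    · rintro (_ | j) _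
      · exact hmi
      · exact h3 j
    · rw [Fintype.sum_option]
      simp only [Option.elim]
      rw [h5]
      ring
    · rintro (_ | j) _
      · exact subset_convexHull ℝ _ (mem_insert _ _)
      · simp only [Option.elim]
        split_ifs with h
        · exact subset_convexHull ℝ _ (mem_insert _ _)
        · exact subset_convexHull ℝ _ (mem_insert_of_mem _ ⟨j, h, rfl⟩)

lemma isClosed_piece (v : Fin 3 → Plane) (W : Plane) (i : Fin 3) : IsClosed (piece v W i) :=
  (toFinite (insert W (v '' {j | j ≠ i}))).isClosed_convexHull ℝ

lemma convex_piece (v : Fin 3 → Plane) (W : Plane) (i : Fin 3) : Convex ℝ (piece v W i) :=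
  convex_convexHull ℝ _

include hv hW in
lemma cellSet_subset_iUnion_piece : cellSet v triTop ⊆ ⋃ i, piece v W i := by
  intro x hx
  obtain ⟨i, -, hi⟩ := Finset.exists_min_image Finset.univ (fun i => mu hv W i x) ⟨0, by simp⟩
  exact mem_iUnion.2 ⟨i, (mem_piece_iff hv hW i x).2 ⟨(mem_triTop_iff hv x).1 hx i,
    fun j => hi j (by simp)⟩⟩

include hv hW in
lemma piece_subset_cellSet (i : Fin 3) : piece v W i ⊆ cellSet v triTop := by
  refine convexHull_min ?_ (convex_convexHull ℝ _)
  rintro _ (rfl | ⟨j, -, rfl⟩)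
  · exact (mem_triTop_iff hv _).2 fun i => (bary_inpoint_pos hv hW i).le
  · exact subset_convexHull ℝ _ ⟨j, by simp [triTop], rfl⟩

include hv hW in
lemma nonempty_interior_piece (i : Fin 3) : (interior (piece v W i)).Nonempty := by
  have hpos := bary_inpoint_pos hv hW
  have hopen : IsOpen ({x | 0 < bary hv i x} ∩ ⋂ j ∈ {j : Fin 3 | j ≠ i},
      {x | mu hv W i x < mu hv W j x}) := by
    refine (isOpen_lt continuous_const (continuous_bary hv i)).inter
      ((toFinite _).isOpen_biInter fun j _ => ?_)
    exact isOpen_lt (isPolyFun_mu hv W i).continuous (isPolyFun_mu hv W j).continuous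
  -- The witness is the middle of the segment joining `W` to the midpoint of the edge opposite to
  -- vertex `i`.
  have ha : ∑ j, (bary hv j W / 2 + if j = i then 0 else 1 / 4) = 1 := by
    rw [Finset.sum_add_distrib, ← Finset.sum_div, bary_sum, Fin.sum_univ_three]
    fin_cases i <;> simp <;> norm_num
  refine ⟨∑ j, (bary hv j W / 2 + if j = i then 0 else 1 / 4) • v j,
    interior_maximal ?_ hopen ?_⟩
  · rintro x ⟨h0, h1⟩
    refine (mem_piece_iff hv hW i x).2 ⟨(show 0 < bary hv i x from h0).le, fun j => ?_⟩
    by_cases h : j = i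
    · rw [h]
    · exact (mem_iInter₂.1 h1 j h : mu hv W i x < mu hv W j x).le
  · refine ⟨?_, mem_iInter₂.2 fun j hj => ?_⟩
    · simp only [mem_ofPred_eq]
      rw [bary_sum_smul hv i ha, if_pos rfl]
      linarith [hpos i]
    · have hj : j ≠ i := hj
      simp only [mem_ofPred_eq, mu]
      rw [bary_sum_smul hv i ha, bary_sum_smul hv j ha, if_pos rfl, if_neg hj]
      rw [div_lt_div_iff₀ (hpos i) (hpos j)]
      nlinarith [hpos i, hpos j]

include hv hW in
-- The preimage of the interior of a piece meets the closed simplex, hence also its dense interior.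
lemma nonempty_interior_preimage_piece (i : Fin 3) :
    (interior (cellParam v triTop card_triTop ⁻¹' piece v W i ∩ refSimplex 2)).Nonempty := by
  obtain ⟨x, hx⟩ := nonempty_interior_piece hv hW i
  obtain ⟨t, ht, rfl⟩ := exists_cellParam_eq v triTop card_triTop
    (piece_subset_cellSet hv hW i (interior_subset hx))
  have h1 : IsOpen (cellParam v triTop card_triTop ⁻¹' interior (piece v W i)) :=
    isOpen_interior.preimage (continuous_cellParam v triTop card_triTop)
  have h2 : t ∈ closure (interior (refSimplex 2)) := by
    rw [(convex_refSimplex 2).closure_interior_eq_closure_of_nonempty_interior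
      (nonempty_interior_refSimplex 2)]
    exact subset_closure ht
  obtain ⟨s, hs1, hs2⟩ := mem_closure_iff.1 h2 _ h1 hx
  exact ⟨s, interior_maximal (inter_subset_inter (preimage_mono interior_subset) interior_subset)
    (h1.inter isOpen_interior) ⟨hs1, hs2⟩⟩

include hv hW in
/-- Gluing of continuous forms defined piecewise. -/
lemma exists_glue {k : ℕ} (g : Fin 3 → Plane → AltForm k) (hg : ∀ i, Continuous (g i))
    (h : ∀ i j x, x ∈ piece v W i → x ∈ piece v W j → g i x = g j x) :
    ∃ u : C(cellSet v triTop, AltForm k), ∀ i x (hx : x ∈ cellSet v triTop), x ∈ piece v W i →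
      u ⟨x, hx⟩ = g i x := by
  choose! idx hidx using fun x hx => mem_iUnion.1 (cellSet_subset_iUnion_piece hv hW (a := x) hx)
  let f : cellSet v triTop → AltForm k := fun x => g (idx x) x
  have hf : ∀ i (x : cellSet v triTop), (x : Plane) ∈ piece v W i → f x = g i x := fun i x hx =>
    h _ _ _ (hidx x x.2) hx
  have hc : Continuous f := by
    refine (locallyFinite_of_finite fun i => ((↑) : cellSet v triTop → Plane) ⁻¹'
      piece v W i).continuous ?_ (fun i => (isClosed_piece v W i).preimage continuous_subtype_val)
      fun i => ?_
    · rw [eq_univ_iff_forall]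
      exact fun x => mem_iUnion.2 ⟨idx x, hidx x x.2⟩
    · exact ((hg i).comp continuous_subtype_val).continuousOn.congr fun x hx => hf i x hx
  exact ⟨⟨f, hc⟩, fun i x hx hi => hf i ⟨x, hx⟩ hi⟩

include hv in
lemma exists_cellTangent_triTop (ξ : Plane) : ∃ η, cellTangent v triTop card_triTop η = ξ :=
  ⟨![baryGrad hv 1 ξ, baryGrad hv 2 ξ], by
    rw [cellTangent_triTop]
    exact (eq_baryGrad_smul hv ξ).symm⟩

include hv hW in
/-- On the triangle, a pair whose first component is piecewise smooth is admissible if and only if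
its second component is the piecewise exterior derivative of the first one. -/
lemma isAdmissible_triTop_iff {k : ℕ} (z : FormPair v triTop k) (g : Fin 3 → Plane → AltForm k)
    (hg : ∀ i, ContDiff ℝ ∞ (g i))
    (hz : ∀ i x (hx : x ∈ cellSet v triTop), x ∈ piece v W i → z.1 ⟨x, hx⟩ = g i x) :
    IsAdmissible v triTop k z ↔ ∀ i x (hx : x ∈ cellSet v triTop), x ∈ piece v W i →
      z.2 ⟨x, hx⟩ = extDeriv (g i) x := by
  rw [isAdmissible_iff_of_pieces v triTop card_triTop z (piece v W) (isClosed_piece v W)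
    (convex_piece v W) (cellSet_subset_iUnion_piece hv hW) (nonempty_interior_preimage_piece hv hW)
    g hg hz]
  refine forall_congr' fun i => forall_congr' fun x => forall_congr' fun hx => forall_congr' fun _ =>
    ⟨fun h => ?_, fun h η => by rw [h]⟩
  ext ξ
  -- Every vector of the plane is tangent to the triangle, so equality of pullbacks is equality of
  -- forms.
  choose η hη using fun j => exists_cellTangent_triTop hv (ξ j)
  simpa only [hη] using h η

include hv hW in
/-- Construction of elements of `A^k(T)` from their polynomial pieces. -/
lemma exists_mem_ctSpace_triTop {p k : ℕ} (g : Fin 3 → Plane → AltForm k)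
    (hg : ∀ i, IsPolyForm (p - k) (g i))
    (h : ∀ i j x, x ∈ piece v W i → x ∈ piece v W j → g i x = g j x)
    (h' : ∀ i j x, x ∈ piece v W i → x ∈ piece v W j → extDeriv (g i) x = extDeriv (g j) x) :
    ∃ z ∈ ctSpace p v W triTop k, ∀ i x (hx : x ∈ cellSet v triTop), x ∈ piece v W i →
      z.1 ⟨x, hx⟩ = g i x ∧ z.2 ⟨x, hx⟩ = extDeriv (g i) x := by
  obtain ⟨u, hu⟩ := exists_glue hv hW g (fun i => (hg i).contDiff.continuous) h
  obtain ⟨w, hw⟩ := exists_glue hv hW (fun i => extDeriv (g i))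
    (fun i => (hg i).extDeriv.contDiff.continuous) h'
  refine ⟨(u, w), ⟨(isAdmissible_triTop_iff hv hW (u, w) g (fun i => (hg i).contDiff) hu).2 hw,
    ?_, ?_⟩, fun i x hx hi => ⟨hu i x hx hi, hw i x hx hi⟩⟩
  · intro K hK ξ
    rw [cellPieces_triTop] at hK
    obtain ⟨i, rfl⟩ := hK
    obtain ⟨P, hP, hP'⟩ := hg i ξ
    refine ⟨P, hP, fun x hx => ?_⟩
    rw [← hP', extZero_apply _ (piece_subset_cellSet hv hW i hx), hu i x _ hx]
  · intro K hK ξ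
    rw [cellPieces_triTop] at hK
    obtain ⟨i, rfl⟩ := hK
    obtain ⟨P, hP, hP'⟩ := (hg i).extDeriv ξ
    refine ⟨P, by omega, fun x hx => ?_⟩
    rw [← hP', extZero_apply _ (piece_subset_cellSet hv hW i hx), hw i x _ hx]

include hv hW in
/-- The polynomial pieces of an element of `A^k(T)`. -/
lemma exists_pieces_of_mem_ctSpace {p k : ℕ} {z : FormPair v triTop k}
    (hz : z ∈ ctSpace p v W triTop k) :
    ∃ g : Fin 3 → Plane → AltForm k, (∀ i, IsPolyForm (p - k) (g i)) ∧
      ∀ i x (hx : x ∈ cellSet v triTop), x ∈ piece v W i →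
        z.1 ⟨x, hx⟩ = g i x ∧ z.2 ⟨x, hx⟩ = extDeriv (g i) x := by
  obtain ⟨hadm, h1, -⟩ := hz
  choose g hg hgz using fun i => IsPolyOn.exists_polyForm
    (h1 (piece v W i) (by rw [cellPieces_triTop]; exact ⟨i, rfl⟩))
  have h2 : ∀ i x (hx : x ∈ cellSet v triTop), x ∈ piece v W i → z.1 ⟨x, hx⟩ = g i x :=
    fun i x hx hi => by rw [← hgz i x hi, extZero_apply _ hx]
  exact ⟨g, hg, fun i x hx hi => ⟨h2 i x hx hi,
    (isAdmissible_triTop_iff hv hW z g (fun i => (hg i).contDiff) h2).1 hadm i x hx hi⟩⟩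

end Geometry

/-! ### The axioms of a finite element system for the Clough–Tocher spaces -/

section FES

open Set

variable {p : ℕ} {v : Fin 3 → Plane} {W : Plane}

lemma mem_polyForms_of_ne {c : TriCell} (hc : c ≠ triTop) {q k : ℕ} {u : C(cellSet v c, AltForm k)} :
    u ∈ polyForms v W c q k ↔ IsPolyOn q (extZero u) (cellSet v c) := by
  change (∀ K ∈ cellPieces v W c, _) ↔ _
  rw [cellPieces, if_neg hc]
  simp

lemma IsPolyOn.mono_set {q k : ℕ} {u : Plane → AltForm k} {K K' : Set Plane} (h : IsPolyOn q u K)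
    (hK : K' ⊆ K) : IsPolyOn q u K' := fun ξ => by
  obtain ⟨P, hP, h⟩ := h ξ
  exact ⟨P, hP, fun x hx => h x (hK hx)⟩

lemma IsPolyOn.congr {q k : ℕ} {u w : Plane → AltForm k} {K : Set Plane} (h : IsPolyOn q u K)
    (hK : ∀ x ∈ K, w x = u x) : IsPolyOn q w K := fun ξ => by
  obtain ⟨P, hP, h⟩ := h ξ
  exact ⟨P, hP, fun x hx => by rw [hK x hx, h x hx]⟩

lemma exists_notMem_of_ne {c : TriCell} (hc : c ≠ triTop) : ∃ i, i ∉ c.1 := by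
  by_contra! h
  exact hc (Subtype.ext (Finset.eq_univ_iff_forall.2 h))

/-- Each cell of the boundary lies in a single piece, so that traces of piecewise polynomials on it
are polynomial. -/
lemma cellSet_subset_piece {c : TriCell} {i : Fin 3} (hi : i ∉ c.1) :
    cellSet v c ⊆ piece v W i := by
  refine convexHull_mono (Subset.trans (image_mono ?_) (subset_insert _ _))
  rintro j hj rfl
  exact hi hj

lemma traceForm_mem_polyForms {c' c : TriCell} (h : c' ≤ c) {q k : ℕ}
    {u : C(cellSet v c, AltForm k)} (hu : u ∈ polyForms v W c q k) :
    traceForm v h k u ∈ polyForms v W c' q k := by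
  obtain rfl | hne := eq_or_ne c' c
  · exact hu
  have hc' : c' ≠ triTop := by
    rintro rfl
    exact hne (le_antisymm h c.le_triTop)
  rw [mem_polyForms_of_ne hc']
  have key : IsPolyOn q (extZero u) (cellSet v c') := by
    obtain rfl | hc := eq_or_ne c triTop
    · obtain ⟨i, hi⟩ := exists_notMem_of_ne hc'
      exact IsPolyOn.mono_set (hu (piece v W i) (by rw [cellPieces_triTop]; exact ⟨i, rfl⟩))
        (cellSet_subset_piece hi)
    · exact ((mem_polyForms_of_ne hc).1 hu).mono_set (cellSet_mono v h)
  exact key.congr fun x hx => extZero_traceForm v h k u hx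

/-- Checked on the triangle by the piecewise criterion and carried to all cells by traces. -/
lemma isAdmissible_const (hv : AffineIndependent ℝ v)
    (hW : W ∈ interior (convexHull ℝ (range v))) (c : TriCell) (a : ℝ) :
    IsAdmissible v c 0 ((ctFES p v W).const c a) := by
  have h1 : IsAdmissible v triTop 0 ((ctFES p v W).const triTop a) := by
    refine (isAdmissible_triTop_iff hv hW _ (fun _ => form0 fun _ => a)
      (fun _ => (IsPolyFun.const 0 a).form0.contDiff) fun _ _ _ _ => rfl).2 fun _ x _ _ => ?_
    rw [extDeriv_form0, fderiv_const_apply]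
    rfl
  exact isAdmissible_trace v c.le_triTop 0 h1

lemma subset_cellSet_of_mem_cellPieces (hv : AffineIndependent ℝ v)
    (hW : W ∈ interior (convexHull ℝ (range v))) {c : TriCell} {K : Set Plane}
    (hK : K ∈ cellPieces v W c) : K ⊆ cellSet v c := by
  obtain rfl | hc := eq_or_ne c triTop
  · rw [cellPieces_triTop] at hK
    obtain ⟨i, rfl⟩ := hK
    exact piece_subset_cellSet hv hW i
  · rw [cellPieces, if_neg hc] at hK
    rw [hK]

/-- A form given by a single polynomial form is piecewise polynomial. -/
lemma mem_polyForms_of_polyForm (hv : AffineIndependent ℝ v)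
    (hW : W ∈ interior (convexHull ℝ (range v))) {c : TriCell} {q k : ℕ} {g : Plane → AltForm k}
    (hg : IsPolyForm q g) {u : C(cellSet v c, AltForm k)} (hu : ∀ x hx, u ⟨x, hx⟩ = g x) :
    u ∈ polyForms v W c q k := fun K hK =>
  (hg.isPolyOn K).congr fun x hx => by
    rw [extZero_apply _ (subset_cellSet_of_mem_cellPieces hv hW hK hx), hu]

/-- The Clough-Tocher system is a finite element system. -/
theorem isFES_ctFES (hv : AffineIndependent ℝ v)
    (hW : W ∈ interior (convexHull ℝ (range v))) : (ctFES p v W).IsFES where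
  d_mem c k u hu := ⟨isAdmissible_d v c k hu.1, hu.2.2, (polyForms v W c _ _).zero_mem⟩
  d_d c k u _ := rfl
  r_mem h k u hu := ⟨isAdmissible_trace v h k hu.1, traceForm_mem_polyForms h hu.2.1,
    traceForm_mem_polyForms h hu.2.2⟩
  r_d h k u _ := Prod.ext rfl rfl
  r_refl c k u _ := rfl
  r_r h' h k u _ := rfl
  const_mem c a := by
    refine ⟨isAdmissible_const hv hW c a, ?_, (polyForms v W c _ _).zero_mem⟩
    exact mem_polyForms_of_polyForm hv hW (IsPolyFun.const _ a).form0 fun _ _ => rfl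
  d_const c a := rfl
  r_const h a := rfl
  stokes c k h u hu := by convert ctFES_stokes p v W c k h hu.1

end FES

/-! ### Exactness on each cell -/

section Exactness

open Set

variable {p : ℕ} {v : Fin 3 → Plane} {W : Plane}

lemma ctFES_d (c : TriCell) (k : ℕ) (z : FormPair v c k) :
    (ctFES p v W).d c k z = (z.2, 0) := rfl

lemma ctFES_r {c' c : TriCell} (h : c' ≤ c) (k : ℕ) (z : FormPair v c k) :
    (ctFES p v W).r h k z = (traceForm v h k z.1, traceForm v h (k + 1) z.2) := rfl

lemma traceForm_apply {c' c : TriCell} (h : c' ≤ c) (k : ℕ) (u : C(cellSet v c, AltForm k))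
    (x : Plane) (hx : x ∈ cellSet v c') :
    traceForm v h k u ⟨x, hx⟩ = u ⟨x, cellSet_mono v h hx⟩ := rfl

lemma formPair_ext {c : TriCell} {k : ℕ} {z w : FormPair v c k}
    (h1 : ∀ x hx, z.1 ⟨x, hx⟩ = w.1 ⟨x, hx⟩) (h2 : ∀ x hx, z.2 ⟨x, hx⟩ = w.2 ⟨x, hx⟩) : z = w :=
  Prod.ext (ContinuousMap.ext fun x => h1 x x.2) (ContinuousMap.ext fun x => h2 x x.2)

lemma formPair_eq_zero {c : TriCell} {k : ℕ} (hk : 3 ≤ k) (z : FormPair v c k) : z = 0 :=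
  formPair_ext (fun _ _ => (altForm_eq_zero hk _).trans rfl)
    fun _ _ => (altForm_eq_zero (hk.trans (Nat.le_succ k)) _).trans rfl

lemma vertex_mem_cellSet {c : TriCell} {i : Fin 3} (hi : i ∈ c.1) : v i ∈ cellSet v c :=
  subset_convexHull ℝ _ ⟨i, hi, rfl⟩

/-- The elements of `A^k(c)` for `c` not the triangle, in terms of polynomial forms. -/
lemma mem_ctSpace_of_ne {c : TriCell} (hc : c ≠ triTop) {k : ℕ} {z : FormPair v c k}
    (hz : IsAdmissible v c k z) {g : Plane → AltForm k} {h : Plane → AltForm (k + 1)}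
    (hg : IsPolyForm (p - k) g) (hh : IsPolyForm (p - (k + 1)) h)
    (h1 : ∀ x hx, z.1 ⟨x, hx⟩ = g x) (h2 : ∀ x hx, z.2 ⟨x, hx⟩ = h x) :
    z ∈ ctSpace p v W c k := by
  refine ⟨hz, (mem_polyForms_of_ne hc).2 ?_, (mem_polyForms_of_ne hc).2 ?_⟩
  · exact (hg.isPolyOn _).congr fun x hx => by rw [extZero_apply _ hx, h1]
  · exact (hh.isPolyOn _).congr fun x hx => by rw [extZero_apply _ hx, h2]

lemma exists_polyForm_of_mem_ctSpace {c : TriCell} (hc : c ≠ triTop) {k : ℕ} {z : FormPair v c k}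
    (hz : z ∈ ctSpace p v W c k) : ∃ (g : Plane → AltForm k) (h : Plane → AltForm (k + 1)),
      IsPolyForm (p - k) g ∧ IsPolyForm (p - (k + 1)) h ∧
      (∀ x hx, z.1 ⟨x, hx⟩ = g x) ∧ ∀ x hx, z.2 ⟨x, hx⟩ = h x := by
  obtain ⟨g, hg, hgz⟩ := ((mem_polyForms_of_ne hc).1 hz.2.1).exists_polyForm
  obtain ⟨h, hh, hhz⟩ := ((mem_polyForms_of_ne hc).1 hz.2.2).exists_polyForm
  exact ⟨g, h, hg, hh, fun x hx => by rw [← hgz x hx, extZero_apply _ hx],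
    fun x hx => by rw [← hhz x hx, extZero_apply _ hx]⟩

lemma altForm_one_smul (u : AltForm 1) (a : ℝ) (ξ : Plane) :
    (u fun _ => a • ξ) = a * u fun _ => ξ :=
  ((ContinuousAlternatingMap.ofSubsingleton ℝ Plane ℝ (0 : Fin 1)).symm u).map_smul a ξ

/-- Admissibility on an edge. -/
lemma isAdmissible_edge_iff {c : TriCell} {i j : Fin 3} (hij : i ≠ j) (hc : c.1 = {i, j})
    (z : FormPair v c 0) {φ : Plane → ℝ} (hφ : ContDiff ℝ ∞ (form0 φ))
    (hz : ∀ x hx, z.1 ⟨x, hx⟩ = form0 φ x) :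
    IsAdmissible v c 0 z ↔ ∀ x hx, (z.2 ⟨x, hx⟩ fun _ => v j - v i) = fderiv ℝ φ x (v j - v i) := by
  have hcard : c.1.card = 1 + 1 := by rw [hc, Finset.card_pair hij]
  -- The vertices `i` and `j` are not assumed ordered, so the parametrization may run backwards
  -- along `v j - v i`, whence a sign `r`.
  obtain ⟨r, hr, hT⟩ : ∃ r : ℝ, r ≠ 0 ∧ ∀ η, cellTangent v c hcard η = (η 0 * r) • (v j - v i) := by
    rcases lt_or_gt_of_ne hij with h | h
    · exact ⟨1, one_ne_zero, fun η => by rw [cellTangent_pair v hcard h hc, mul_one]⟩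
    · refine ⟨-1, by norm_num, fun η => ?_⟩
      rw [cellTangent_pair v hcard h (by rw [hc, Finset.pair_comm])]
      module
  have hpre : cellParam v c hcard ⁻¹' cellSet v c ∩ refSimplex 1 = refSimplex 1 :=
    inter_eq_right.2 fun t ht => cellParam_mem v c hcard ht
  rw [isAdmissible_iff_of_pieces v c hcard z (fun _ : Unit => cellSet v c)
    (fun _ => ((toFinite (v '' (c.1 : Set (Fin 3)))).isClosed_convexHull ℝ))
    (fun _ => convex_convexHull ℝ _) (fun x hx => mem_iUnion.2 ⟨(), hx⟩)
    (fun _ => by rw [hpre]; exact nonempty_interior_refSimplex 1) (fun _ => form0 φ) (fun _ => hφ)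
    fun _ x hx _ => hz x hx]
  constructor
  · intro h x hx
    have h1 := h () x hx hx fun _ _ => r⁻¹
    simp only [hT, extDeriv_form0, inv_mul_cancel₀ hr, one_smul] at h1
    exact h1
  · intro h _ x hx _ η
    simp only [hT, extDeriv_form0]
    rw [fin_one_eq fun l : Fin (0 + 1) => (η l 0 * r) • (v j - v i)]
    rw [altForm_one_smul, altForm_one_smul, h x hx]
    rfl

/-- Points of an edge. -/
lemma mem_edge_iff {c : TriCell} {i j : Fin 3} (hc : c.1 = {i, j}) (x : Plane) :
    x ∈ cellSet v c ↔ ∃ s ∈ Icc (0 : ℝ) 1, v i + s • (v j - v i) = x := by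
  rw [cellSet, hc, Finset.coe_pair, image_pair, convexHull_pair, segment_eq_image']
  simp

lemma exists_polynomial_primitive {q : ℕ} {S : Polynomial ℝ} (hS : S.natDegree ≤ q) :
    ∃ R : Polynomial ℝ, R.natDegree ≤ q + 1 ∧ R.derivative = S := by
  refine ⟨∑ n ∈ Finset.range (q + 1), Polynomial.monomial (n + 1) (S.coeff n / (n + 1)), ?_, ?_⟩
  · refine Polynomial.natDegree_sum_le_of_forall_le _ _ fun n hn => ?_
    refine (Polynomial.natDegree_monomial_le _).trans ?_
    have := Finset.mem_range.1 hn
    omega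
  · rw [Polynomial.derivative_sum]
    conv_rhs => rw [S.as_sum_range' (q + 1) (Nat.lt_succ_of_le hS)]
    refine Finset.sum_congr rfl fun n _ => ?_
    rw [Polynomial.derivative_monomial, Nat.add_sub_cancel]
    congr 1
    push_cast
    field_simp

lemma fderiv_polynomial_comp_bary (hv : AffineIndependent ℝ v) (S : Polynomial ℝ) (i : Fin 3)
    (x : Plane) : HasFDerivAt (fun x => S.eval (bary hv i x))
      (S.derivative.eval (bary hv i x) • baryGrad hv i) x :=
  (S.hasDerivAt (bary hv i x)).comp_hasFDerivAt x (hasFDerivAt_bary hv i x)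

/-- Exactness on edges. -/
lemma exists_d_eq_edge (hp : 1 ≤ p) (hv : AffineIndependent ℝ v) {c : TriCell}
    (hcard : c.1.card = 1 + 1) {u : FormPair v c 1} (hu : u ∈ ctSpace p v W c 1) :
    ∃ w ∈ ctSpace p v W c 0, w.2 = u.1 := by
  obtain ⟨i, j, hij, hc⟩ := Finset.card_eq_two.1 hcard
  have hne : c ≠ triTop := by rintro rfl; simp [triTop] at hcard
  obtain ⟨g, -, hg, -, hgu, -⟩ := exists_polyForm_of_mem_ctSpace hne hu
  -- Only the tangential component matters on an edge. Its primitive in the parameter `s` becomes a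
  -- function on the plane by substituting `bary j`, which equals `s` on the edge.
  obtain ⟨S, hS, hS'⟩ := (hg fun _ => v j - v i).comp_line (v i) (v j - v i)
  obtain ⟨R, hR, hRS⟩ := exists_polynomial_primitive hS
  have hφ : IsPolyFun p fun x => R.eval (bary hv j x) :=
    IsPolyFun.polynomial_comp (by omega) (isPolyFun_bary hv j)
  let w : FormPair v c 0 := (⟨fun x => form0 (fun x => R.eval (bary hv j x)) x,
    (hφ.form0.contDiff.continuous).comp continuous_subtype_val⟩, u.1)
  have hw : IsAdmissible v c 0 w := by
    refine (isAdmissible_edge_iff hij hc w hφ.form0.contDiff fun x hx => rfl).2 fun x hx => ?_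
    rw [(fderiv_polynomial_comp_bary hv R j x).fderiv]
    change (u.1 ⟨x, hx⟩ fun _ => v j - v i) = _
    obtain ⟨s, hs, rfl⟩ := (mem_edge_iff hc x).1 hx
    rw [hgu, hS', hRS, bary_line, bary_vertex, bary_vertex, if_neg hij.symm, if_pos rfl]
    simp [baryGrad_sub, bary_vertex, hij.symm]
  exact ⟨w, mem_ctSpace_of_ne hne hw (hφ.form0.mono le_rfl) (hg.mono le_rfl) (fun _ _ => rfl) hgu, rfl⟩

/-- Closed forms of degree at least the dimension are exact. -/
lemma mem_ctSpace_zero_prod {c : TriCell} {k : ℕ} (hk : c.1.card ≤ k + 1)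
    {u : FormPair v c (k + 1)} (hu : u ∈ ctSpace p v W c (k + 1)) :
    ((0, u.1) : FormPair v c k) ∈ ctSpace p v W c k :=
  ⟨isAdmissible_of_le v c hk _, (polyForms v W c _ _).zero_mem, hu.2.1⟩

lemma inpoint_mem_piece (v : Fin 3 → Plane) (W : Plane) (i : Fin 3) : W ∈ piece v W i :=
  subset_convexHull ℝ _ (mem_insert _ _)

lemma line_mem_piece {i : Fin 3} {x : Plane} (hx : x ∈ piece v W i) {s : ℝ}
    (hs : s ∈ Icc (0 : ℝ) 1) : W + s • (x - W) ∈ piece v W i := by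
  have := convex_piece v W i (inpoint_mem_piece v W i) hx (sub_nonneg.2 hs.2) hs.1
    (sub_add_cancel 1 s)
  convert this using 1
  module

/-- A function with vanishing derivative along a segment takes equal values at its ends. -/
lemma eq_of_fderiv_line_eq_zero {f : Plane → ℝ} (hf : Differentiable ℝ f) {x y : Plane}
    (h : ∀ s ∈ Icc (0 : ℝ) 1, fderiv ℝ f (x + s • (y - x)) (y - x) = 0) : f y = f x := by
  have hd : ∀ s : ℝ, HasDerivAt (fun s : ℝ => f (x + s • (y - x)))
      (fderiv ℝ f (x + s • (y - x)) (y - x)) s := by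
    intro s
    have h1 : HasDerivAt (fun s : ℝ => x + s • (y - x)) ((1 : ℝ) • (y - x)) s :=
      ((hasDerivAt_id s).smul_const (y - x)).const_add x
    rw [one_smul] at h1
    exact (hf (x + s • (y - x))).hasFDerivAt.comp_hasDerivAt s h1
  have := (convex_Icc (0 : ℝ) 1).is_const_of_fderivWithin_eq_zero (𝕜 := ℝ)
    (f := fun s : ℝ => f (x + s • (y - x)))
    (fun s _ => (hd s).differentiableAt.differentiableWithinAt) (fun s hs => by
      rw [fderivWithin_eq_fderiv (uniqueDiffOn_Icc_zero_one s hs) (hd s).differentiableAt]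
      rw [(hd s).hasFDerivAt.fderiv, h s hs]
      simp) (x := 1) (y := 0) (by simp) (by simp)
  simpa using this

/-- Exactness on the triangle, for `1`-forms. -/
lemma exists_d_eq_triTop_one (hp : 1 ≤ p) (hv : AffineIndependent ℝ v)
    (hW : W ∈ interior (convexHull ℝ (range v))) {u : FormPair v triTop 1}
    (hu : u ∈ ctSpace p v W triTop 1) (hdu : u.2 = 0) :
    ∃ w ∈ ctSpace p v W triTop 0, w.2 = u.1 := by
  obtain ⟨g, hg, hgu⟩ := exists_pieces_of_mem_ctSpace hv hW hu
  have hsub := fun i => piece_subset_cellSet hv hW i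
  have hclosed : ∀ i x, extDeriv (g i) x = 0 := fun i =>
    (hg i).extDeriv.eq_zero_of_eqOn (nonempty_interior_piece hv hW i) fun x hx => by
      rw [← (hgu i x (hsub i hx) hx).2, hdu]; rfl
  choose f₀ hf₀ hfg₀ using fun i => exists_extDeriv_form0_eq (hg i) (hclosed i)
  -- Potentials on the pieces are normalized at the common point `W`. On an interface their
  -- differentials agree along the segment to `W`, so the potentials agree as well.
  let f : Fin 3 → Plane → ℝ := fun i x => f₀ i x - f₀ i W
  have hf : ∀ i, IsPolyFun (p - 0) (f i) := fun i =>
    ((hf₀ i).sub (IsPolyFun.const _ (f₀ i W))).mono (by omega)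
  have hfd : ∀ i x, fderiv ℝ (f i) x = fderiv ℝ (f₀ i) x := fun i x => by
    simp only [f]; rw [fderiv_sub_const]
  have hfg : ∀ i x, extDeriv (form0 (f i)) x = g i x := fun i x => by
    rw [← hfg₀, extDeriv_form0, extDeriv_form0, hfd]
  have hgg : ∀ i j x, x ∈ piece v W i → x ∈ piece v W j → g i x = g j x := fun i j x hi hj => by
    rw [← (hgu i x (hsub i hi) hi).1, (hgu j x (hsub i hi) hj).1]
  obtain ⟨w, hw, hwf⟩ := exists_mem_ctSpace_triTop (p := p) (k := 0) hv hW (fun i => form0 (f i))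
    (fun i => (hf i).form0) (fun i j x hi hj => by
      have h0 : f i x - f j x = f i W - f j W := by
        refine eq_of_fderiv_line_eq_zero (f := fun x => f i x - f j x)
          ((hf i).differentiable.sub (hf j).differentiable) fun s hs => ?_
        have h1 := hgg i j _ (line_mem_piece hi hs) (line_mem_piece hj hs)
        rw [← hfg i, ← hfg j, extDeriv_form0, extDeriv_form0] at h1
        have h2 := congr_arg (fun u : AltForm 1 => u fun _ => x - W) h1
        simp only [form1_apply] at h2
        rw [fderiv_fun_sub ((hf i).differentiable _) ((hf j).differentiable _), sub_apply, h2, sub_self]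
      have h3 : f i x = f j x := by simp only [f, sub_self] at h0 ⊢; linarith
      ext ξ
      rw [form0_apply, form0_apply, h3]) (fun i j x hi hj => by
      rw [hfg, hfg, hgg i j x hi hj])
  refine ⟨w, hw, ContinuousMap.ext fun ⟨x, hx⟩ => ?_⟩
  obtain ⟨i, hi⟩ := mem_iUnion.1 (cellSet_subset_iUnion_piece hv hW hx)
  rw [(hwf i x hx hi).2, hfg, (hgu i x hx hi).1]

/-- Exactness on the triangle, for `2`-forms. -/
lemma exists_d_eq_triTop_two (hp : 2 ≤ p) (hv : AffineIndependent ℝ v)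
    (hW : W ∈ interior (convexHull ℝ (range v))) {u : FormPair v triTop 2}
    (hu : u ∈ ctSpace p v W triTop 2) :
    ∃ w ∈ ctSpace p v W triTop 1, w.2 = u.1 := by
  obtain ⟨g, hg, hgu⟩ := exists_pieces_of_mem_ctSpace hv hW hu
  have hsub := fun i => piece_subset_cellSet hv hW i
  have hgg : ∀ i j x, x ∈ piece v W i → x ∈ piece v W j → g i x = g j x := fun i j x hi hj => by
    rw [← (hgu i x (hsub i hi) hi).1, (hgu j x (hsub i hi) hj).1]
  -- The primitive on each piece is the homotopy formula centred at `W`. It raises the degree by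
  -- one, and its coefficient is unique along rays from `W`, which gives continuity across
  -- interfaces.
  choose φ hφ hφg using fun i => exists_euler (hg i fun j => EuclideanSpace.single j 1) W
  have hd : ∀ i x, extDeriv (fun y => φ i y • koszul W y) x = g i x := fun i x => by
    rw [extDeriv_smul_koszul (hφ i), hφg, ← eq_smul_vol2]
  obtain ⟨w, hw, hwf⟩ := exists_mem_ctSpace_triTop (p := p) (k := 1) hv hW
    (fun i y => φ i y • koszul W y)
    (fun i => (IsPolyForm.smul (hφ i) (isPolyForm_koszul W)).mono (by omega))
    (fun i j x hi hj => by
      have h0 : φ i x - φ j x = 0 := by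
        refine euler_unique (W := W) ((hφ i).sub (hφ j)) fun s hs => ?_
        have h1 := hgg i j _ (line_mem_piece hi hs) (line_mem_piece hj hs)
        have h2 := hφg i (W + s • (x - W))
        have h3 := hφg j (W + s • (x - W))
        rw [add_sub_cancel_left] at h2 h3
        rw [fderiv_fun_sub ((hφ i).differentiable _) ((hφ j).differentiable _), sub_apply]
        rw [h1] at h2
        linarith
      rw [sub_eq_zero.1 h0]) (fun i j x hi hj => by
      rw [hd, hd, hgg i j x hi hj])
  refine ⟨w, hw, ContinuousMap.ext fun ⟨x, hx⟩ => ?_⟩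
  obtain ⟨i, hi⟩ := mem_iUnion.1 (cellSet_subset_iUnion_piece hv hW hx)
  rw [(hwf i x hx hi).2, hd, (hgu i x hx hi).1]

/-- Closed `0`-forms are constant. -/
lemma eq_of_snd_eq_zero (hv : AffineIndependent ℝ v)
    (hW : W ∈ interior (convexHull ℝ (range v))) {c : TriCell} {z : FormPair v c 0}
    (hz : z ∈ ctSpace p v W c 0) (h : z.2 = 0) {x y : Plane} (hx : x ∈ cellSet v c)
    (hy : y ∈ cellSet v c) : z.1 ⟨x, hx⟩ = z.1 ⟨y, hy⟩ := by
  have hle : c.1.card ≤ 3 := c.1.card_le_univ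
  have h0 := c.2.card_pos
  obtain h1 | h1 | h1 : c.1.card = 1 ∨ c.1.card = 1 + 1 ∨ c.1.card = 2 + 1 := by omega
  · obtain ⟨i, hi⟩ := Finset.card_eq_one.1 h1
    have : cellSet v c = {v i} := by simp [cellSet, hi]
    have hxy : x = y := by
      rw [this] at hx hy
      rw [mem_singleton_iff.1 hx, mem_singleton_iff.1 hy]
    subst hxy
    rfl
  · obtain ⟨i, j, hij, hc⟩ := Finset.card_eq_two.1 h1
    have hne : c ≠ triTop := by rintro rfl; simp [triTop] at h1
    obtain ⟨g, -, hg, -, hgz, -⟩ := exists_polyForm_of_mem_ctSpace hne hz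
    rw [eq_form0 g] at hg hgz
    have hadm := (isAdmissible_edge_iff hij hc z hg.contDiff hgz).1 hz.1
    have key : ∀ y ∈ cellSet v c, g y ![] = g (v i) ![] := by
      intro y hy
      refine eq_of_fderiv_line_eq_zero (f := fun x => g x ![]) (hg ![]).differentiable fun s hs => ?_
      obtain ⟨t, ht, rfl⟩ := (mem_edge_iff hc y).1 hy
      have hm : v i + s • (v i + t • (v j - v i) - v i) ∈ cellSet v c := by
        refine (mem_edge_iff hc _).2 ⟨s * t, ⟨mul_nonneg hs.1 ht.1, mul_le_one₀ hs.2 ht.1 ht.2⟩, ?_⟩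
        module
      have h2 := hadm _ hm
      rw [h] at h2
      have e : v i + t • (v j - v i) - v i = t • (v j - v i) := by module
      have h3 := (fderiv ℝ (fun x => g x ![]) (v i + s • (v i + t • (v j - v i) - v i))).map_smul t
        (v j - v i)
      rw [← h2] at h3
      exact (congr_arg _ e).trans (h3.trans (smul_zero t))
    ext ξ
    rw [hgz, hgz, form0_apply, form0_apply, key x hx, key y hy]
  · obtain rfl := eq_triTop_of_card h1
    obtain ⟨g, hg, hgz⟩ := exists_pieces_of_mem_ctSpace hv hW hz
    have key : ∀ y (hy : y ∈ cellSet v triTop), z.1 ⟨y, hy⟩ =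
        z.1 ⟨W, piece_subset_cellSet hv hW 0 (inpoint_mem_piece v W 0)⟩ := by
      intro y hy
      obtain ⟨i, hi⟩ := mem_iUnion.1 (cellSet_subset_iUnion_piece hv hW hy)
      rw [(hgz i y hy hi).1, (hgz i W _ (inpoint_mem_piece v W i)).1]
      rw [eq_form0 (g i)]
      ext ξ
      rw [form0_apply, form0_apply]
      refine eq_of_fderiv_line_eq_zero (f := fun x => g i x ![]) (hg i ![]).differentiable
        fun s hs => ?_
      have h2 := (hgz i _ (piece_subset_cellSet hv hW i (line_mem_piece hi hs))
        (line_mem_piece hi hs)).2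
      rw [h, eq_form0 (g i), extDeriv_form0] at h2
      exact (congr_arg (fun u : AltForm 1 => u fun _ => y - W) h2).symm
    rw [key x hx, key y hy]

lemma exists_const_eq (hv : AffineIndependent ℝ v)
    (hW : W ∈ interior (convexHull ℝ (range v))) {c : TriCell} {z : FormPair v c 0}
    (hz : z ∈ ctSpace p v W c 0) (h : z.2 = 0) {x : Plane} (hx : x ∈ cellSet v c) :
    (ctFES p v W).const c (z.1 ⟨x, hx⟩ ![]) = z := by
  refine formPair_ext (fun y hy => ?_) fun y hy => by rw [h]; rfl
  rw [← eq_of_snd_eq_zero hv hW hz h hx hy]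
  ext ξ
  rw [Subsingleton.elim ξ ![]]
  rfl

/-- The Clough-Tocher system is exact on each cell. -/
theorem isExactOn_ctFES (hp : 2 ≤ p) (hv : AffineIndependent ℝ v)
    (hW : W ∈ interior (convexHull ℝ (range v))) (c : TriCell) : (ctFES p v W).IsExactOn c := by
  obtain ⟨i, hi⟩ := c.2
  refine ⟨fun a b hab => ?_, fun u hu hdu => ⟨_, exists_const_eq hv hW hu
    (congr_arg Prod.fst hdu) (vertex_mem_cellSet hi)⟩, fun k u hu hdu => ?_⟩
  · exact congr_arg (fun z : FormPair v c 0 => z.1 ⟨v i, vertex_mem_cellSet hi⟩ ![]) hab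
  · have hdu : u.2 = 0 := congr_arg Prod.fst hdu
    suffices h : ∃ w ∈ ctSpace p v W c k, w.2 = u.1 by
      obtain ⟨w, hw, hwu⟩ := h
      exact ⟨w, hw, Prod.ext hwu hdu.symm⟩
    -- When `k` is at least the dimension of the cell, all pairs in degree `k` are admissible and
    -- `(0, u.1)` is a primitive.
    rcases le_or_gt c.1.card (k + 1) with hk | hk
    · exact ⟨_, mem_ctSpace_zero_prod hk hu, rfl⟩
    have hle : c.1.card ≤ 3 := c.1.card_le_univ
    obtain ⟨rfl, h1⟩ | ⟨rfl, h1⟩ | ⟨rfl, h1⟩ : k = 0 ∧ c.1.card = 1 + 1 ∨ k = 0 ∧ c.1.card = 2 + 1 ∨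
        k = 1 ∧ c.1.card = 2 + 1 := by omega
    · exact exists_d_eq_edge (by omega) hv h1 hu
    · obtain rfl := eq_triTop_of_card h1
      exact exists_d_eq_triTop_one (by omega) hv hW hu hdu
    · obtain rfl := eq_triTop_of_card h1
      exact exists_d_eq_triTop_two hp hv hW hu

end Exactness

/-! ### Polynomials vanishing at the ends of the unit interval -/

section Factor

open Polynomial

/-- The case `S = 0` is separate because the natural degree of zero is `0`, and `q` may be less than
`2`. -/
lemma exists_factor_two {q : ℕ} {R : ℝ[X]} (hR : R.natDegree ≤ q) (h0 : R.eval 0 = 0)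
    (h1 : R.eval 1 = 0) : ∃ S : ℝ[X], R = X * (1 - X) * S ∧ (S = 0 ∨ S.natDegree + 2 ≤ q) := by
  obtain ⟨S, rfl⟩ := dvd_iff_isRoot.2 (IsRoot.def.2 h0)
  have h2 : S.eval 1 = 0 := by simpa using h1
  obtain ⟨T, rfl⟩ := dvd_iff_isRoot.2 (IsRoot.def.2 h2)
  refine ⟨-T, ?_, ?_⟩
  · simp only [map_zero, map_one]
    ring
  · rcases eq_or_ne T 0 with rfl | hT
    · simp
    right
    rw [natDegree_mul (X_sub_C_ne_zero 0) (mul_ne_zero (X_sub_C_ne_zero 1) hT),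
      natDegree_mul (X_sub_C_ne_zero 1) hT, natDegree_X_sub_C, natDegree_X_sub_C] at hR
    rw [natDegree_neg]
    omega

lemma exists_factor_four {q : ℕ} {R : ℝ[X]} (hR : R.natDegree ≤ q) (h0 : R.eval 0 = 0)
    (h1 : R.eval 1 = 0) (h0' : R.derivative.eval 0 = 0) (h1' : R.derivative.eval 1 = 0) :
    ∃ S : ℝ[X], R = X ^ 2 * (1 - X) ^ 2 * S ∧ (S = 0 ∨ S.natDegree + 4 ≤ q) := by
  obtain ⟨S, rfl, hS⟩ := exists_factor_two hR h0 h1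
  simp [derivative_mul] at h0' h1'
  rcases hS with rfl | hS
  · exact ⟨0, by simp, Or.inl rfl⟩
  -- Once `X (1 - X)` is factored out, the derivatives at the ends are, up to sign, the end values
  -- of the quotient, which can be factored again.
  obtain ⟨T, rfl, hT⟩ := exists_factor_two (q := q - 2) (by omega) h0' h1'
  refine ⟨T, by ring, hT.imp id fun h => by omega⟩

end Factor

/-! ### Extension of functions from vertices and of two-forms from vertices and edges -/

section Extension

open Set

variable {p : ℕ} {v : Fin 3 → Plane} {W : Plane}

/-- The restriction to the triangle of a polynomial form. -/
lemma exists_mem_ctSpace_of_polyForm (hv : AffineIndependent ℝ v)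
    (hW : W ∈ interior (convexHull ℝ (range v))) {k : ℕ} {g : Plane → AltForm k}
    (hg : IsPolyForm (p - k) g) : ∃ z ∈ ctSpace p v W triTop k, ∀ x hx,
      z.1 ⟨x, hx⟩ = g x ∧ z.2 ⟨x, hx⟩ = extDeriv g x := by
  obtain ⟨z, hz, h⟩ := exists_mem_ctSpace_triTop (p := p) hv hW (fun _ => g) (fun _ => hg)
    (fun _ _ _ _ _ => rfl) (fun _ _ _ _ _ => rfl)
  refine ⟨z, hz, fun x hx => ?_⟩
  obtain ⟨i, hi⟩ := mem_iUnion.1 (cellSet_subset_iUnion_piece hv hW hx)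
  exact h i x hx hi

lemma hasFDerivAt_sq_mul {m r : Plane → ℝ} {q q' : ℕ} (hm : IsPolyFun q m) (hr : IsPolyFun q' r)
    {x : Plane} (hx : m x = 0) : fderiv ℝ (fun y => m y ^ 2 * r y) x = 0 := by
  have h1 := (hm.differentiable x).hasFDerivAt
  have h2 : HasFDerivAt (fun y => m y ^ 2 * r y) _ x :=
    (h1.pow 2).mul (hr.differentiable x).hasFDerivAt
  rw [h2.fderiv]
  simp [hx]

lemma altForm_one_add (u : AltForm 1) (ξ ζ : Plane) :
    (u fun _ => ξ + ζ) = (u fun _ => ξ) + u fun _ => ζ :=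
  ((ContinuousAlternatingMap.ofSubsingleton ℝ Plane ℝ (0 : Fin 1)).symm u).map_add ξ ζ

/-- The linear form underlying a `1`-form. -/
noncomputable def altForm_toLinear (u : AltForm 1) : Plane →L[ℝ] ℝ :=
  (ContinuousAlternatingMap.ofSubsingleton ℝ Plane ℝ (0 : Fin 1)).symm u

lemma form1_toLinear (u : AltForm 1) : form1 (altForm_toLinear u) = u :=
  (ContinuousAlternatingMap.ofSubsingleton ℝ Plane ℝ (0 : Fin 1)).apply_symm_apply u

lemma cellSet_singleton {c : TriCell} {i : Fin 3} (hc : c.1 = {i}) : cellSet v c = {v i} := by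
  simp [cellSet, hc]

/-- Extension of double-traces of functions from a vertex. -/
lemma exists_extension_vertex_zero (hp : 3 ≤ p) (hv : AffineIndependent ℝ v)
    (hW : W ∈ interior (convexHull ℝ (range v))) {c : TriCell} {i : Fin 3} (hc : c.1 = {i})
    (e : FormPair v c 0) : ∃ u ∈ ctSpace p v W triTop 0, (ctFES p v W).r c.le_triTop 0 u = e ∧
      ∀ l ∈ c.1, ∀ x hx, bary hv l x = 0 → u.1 ⟨x, hx⟩ = 0 ∧ u.2 ⟨x, hx⟩ = 0 := by
  have hi : v i ∈ cellSet v c := vertex_mem_cellSet (by simp [hc])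
  let a : ℝ := e.1 ⟨v i, hi⟩ ![]
  -- At `v i` the cubic `bary i ^ 2 * ℓ` has value `ℓ (v i) = a` and gradient `L + 2 a` times the
  -- gradient of `bary i`; `L` is corrected accordingly. The square makes value and gradient vanish
  -- on the opposite edge.
  let L : Plane →L[ℝ] ℝ := altForm_toLinear (e.2 ⟨v i, hi⟩) - (2 * a) • baryGrad hv i
  let ℓ : Plane → ℝ := fun x => L x + (a - L (v i))
  have hℓ : IsPolyFun 1 ℓ := IsPolyFun.affine _ _
  have hφ : IsPolyFun (p - 0) fun x => bary hv i x ^ 2 * ℓ x :=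
    (((isPolyFun_bary hv i).pow 2).mul hℓ).mono (by omega)
  obtain ⟨z, hz, h⟩ := exists_mem_ctSpace_of_polyForm hv hW hφ.form0
  refine ⟨z, hz, formPair_ext (fun x hx => ?_) (fun x hx => ?_), fun l hl x hx hxl => ?_⟩
  · rw [ctFES_r, traceForm_apply, (h _ _).1]
    obtain rfl : x = v i := by rwa [cellSet_singleton hc] at hx
    ext ξ
    rw [form0_apply, Subsingleton.elim ξ ![]]
    simp [bary_vertex, ℓ, a]
  · rw [ctFES_r, traceForm_apply, (h _ _).2, extDeriv_form0]
    obtain rfl : x = v i := by rwa [cellSet_singleton hc] at hx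
    rw [← form1_toLinear (e.2 ⟨v i, hx⟩)]
    congr 1
    have h2 := ((hasFDerivAt_bary hv i (v i)).pow 2).mul (L.hasFDerivAt.add_const (a - L (v i)))
    refine h2.fderiv.trans ?_
    ext ξ
    simp [bary_vertex, L]
    ring
  · obtain rfl : l = i := by rw [hc] at hl; simpa using hl
    refine ⟨?_, ?_⟩
    · rw [(h _ _).1]
      ext ξ
      simp [hxl]
    · rw [(h _ _).2, extDeriv_form0, hasFDerivAt_sq_mul (isPolyFun_bary hv l) hℓ hxl]
      rfl

/-- Extension of `2`-forms from a vertex. -/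
lemma exists_extension_vertex_two (hp : 3 ≤ p) (hv : AffineIndependent ℝ v)
    (hW : W ∈ interior (convexHull ℝ (range v))) {c : TriCell} {i : Fin 3} (hc : c.1 = {i})
    (e : FormPair v c 2) : ∃ u ∈ ctSpace p v W triTop 2, (ctFES p v W).r c.le_triTop 2 u = e ∧
      ∀ l ∈ c.1, ∀ x hx, bary hv l x = 0 → u.1 ⟨x, hx⟩ = 0 ∧ u.2 ⟨x, hx⟩ = 0 := by
  have hi : v i ∈ cellSet v c := vertex_mem_cellSet (by simp [hc])
  obtain ⟨z, hz, h⟩ := exists_mem_ctSpace_of_polyForm (p := p) hv hW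
    (g := fun x => bary hv i x • e.1 ⟨v i, hi⟩)
    ((IsPolyForm.smul (isPolyFun_bary hv i) (IsPolyForm.const 0 _)).mono (by omega))
  refine ⟨z, hz, formPair_ext (fun x hx => ?_)
    (fun x hx => (altForm_eq_zero le_rfl _).trans (altForm_eq_zero le_rfl _).symm),
    fun l hl x hx hxl => ⟨?_, altForm_eq_zero le_rfl _⟩⟩
  · rw [ctFES_r, traceForm_apply, (h _ _).1]
    obtain rfl : x = v i := by rwa [cellSet_singleton hc] at hx
    simp [bary_vertex]
  · obtain rfl : l = i := by rw [hc] at hl; simpa using hl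
    rw [(h _ _).1, hxl, zero_smul]

lemma exists_edge_vertices {c : TriCell} (h : c.1.card = 1 + 1) :
    ∃ i j k : Fin 3, i ≠ j ∧ i ≠ k ∧ j ≠ k ∧ c.1 = {j, k} := by
  rcases exists_pair_of_card h with hc | hc | hc
  · exact ⟨2, 0, 1, by decide, by decide, by decide, hc⟩
  · exact ⟨1, 0, 2, by decide, by decide, by decide, hc⟩
  · exact ⟨0, 1, 2, by decide, by decide, by decide, hc⟩

/-- Elements of `A₀^k` of an edge vanish at its vertices. -/
lemma A₀_edge_vertex {c : TriCell} (h : c.1.card = 1 + 1) {k : ℕ} {e : FormPair v c k}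
    (he : e ∈ (ctFES p v W).A₀ c k) {l : Fin 3} (hl : l ∈ c.1) :
    e.1 ⟨v l, vertex_mem_cellSet hl⟩ = 0 ∧ e.2 ⟨v l, vertex_mem_cellSet hl⟩ = 0 := by
  have hlt : (⟨{l}, by simp⟩ : TriCell) < c := by
    refine lt_of_le_of_ne (Finset.singleton_subset_iff.2 hl) ?_
    rintro rfl
    simp at h
  have h1 : (ctFES p v W).r hlt.le k e = 0 := (FESData.mem_A₀.1 he).2 _ hlt
  rw [ctFES_r] at h1
  have h2 : traceForm v hlt.le k e.1 = 0 := congr_arg Prod.fst h1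
  have h3 : traceForm v hlt.le (k + 1) e.2 = 0 := congr_arg Prod.snd h1
  have hm : v l ∈ cellSet v ⟨{l}, by simp⟩ := vertex_mem_cellSet (by simp)
  constructor
  · rw [← traceForm_apply hlt.le k e.1 _ hm, h2]
    rfl
  · rw [← traceForm_apply hlt.le (k + 1) e.2 _ hm, h3]
    rfl

/-- Extension of `2`-forms from an edge. -/
lemma exists_extension_edge_two (hv : AffineIndependent ℝ v)
    (hW : W ∈ interior (convexHull ℝ (range v))) {c : TriCell} (hcard : c.1.card = 1 + 1)
    {e : FormPair v c 2} (he : e ∈ (ctFES p v W).A₀ c 2) :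
    ∃ u ∈ ctSpace p v W triTop 2, (ctFES p v W).r c.le_triTop 2 u = e ∧
      ∀ l ∈ c.1, ∀ x hx, bary hv l x = 0 → u.1 ⟨x, hx⟩ = 0 ∧ u.2 ⟨x, hx⟩ = 0 := by
  obtain ⟨i, j, k, hij, hik, hjk, hc⟩ := exists_edge_vertices hcard
  have hne : c ≠ triTop := by rintro rfl; simp [triTop] at hcard
  have hj : j ∈ c.1 := by simp [hc]
  have hk : k ∈ c.1 := by simp [hc]
  obtain ⟨g, -, hg, -, hge, -⟩ := exists_polyForm_of_mem_ctSpace hne (FESData.mem_A₀.1 he).1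
  obtain ⟨R, hR, hR'⟩ := (hg fun j => EuclideanSpace.single j 1).comp_line (v j) (v k - v j)
  have h0 : R.eval 0 = 0 := by
    rw [← hR', zero_smul, add_zero, ← hge _ (vertex_mem_cellSet hj), (A₀_edge_vertex hcard he hj).1]
    rfl
  have h1 : R.eval 1 = 0 := by
    rw [← hR', one_smul, add_sub_cancel, ← hge _ (vertex_mem_cellSet hk),
      (A₀_edge_vertex hcard he hk).1]
    rfl
  obtain ⟨S, rfl, hS⟩ := exists_factor_two hR h0 h1
  -- On the edge `X (1 - X)` is the product of `bary k` and `bary j`, and this product vanishes on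
  -- the other two edges.
  have hψ : IsPolyFun (p - 2) fun x => bary hv j x * bary hv k x * S.eval (bary hv k x) := by
    rcases hS with rfl | hS
    · simpa using IsPolyFun.const (p - 2) 0
    · exact (((isPolyFun_bary hv j).mul (isPolyFun_bary hv k)).mul
        (IsPolyFun.polynomial_comp le_rfl (isPolyFun_bary hv k))).mono (by omega)
  obtain ⟨z, hz, h⟩ := exists_mem_ctSpace_of_polyForm (p := p) hv hW
    (g := fun x => (bary hv j x * bary hv k x * S.eval (bary hv k x)) • vol2)
    ((IsPolyForm.smul hψ (IsPolyForm.const 0 _)).mono (by omega))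
  refine ⟨z, hz, formPair_ext (fun x hx => ?_)
    (fun x hx => (altForm_eq_zero le_rfl _).trans (altForm_eq_zero le_rfl _).symm),
    fun l hl x hx hxl => ⟨?_, altForm_eq_zero le_rfl _⟩⟩
  · rw [ctFES_r, traceForm_apply, (h _ _).1]
    obtain ⟨s, hs, rfl⟩ := (mem_edge_iff hc x).1 hx
    rw [hge, eq_smul_vol2 (g _), hR']
    congr 1
    simp only [bary_line, bary_vertex, hjk, hjk.symm, if_true, if_false, Polynomial.eval_mul,
      Polynomial.eval_X, Polynomial.eval_sub, Polynomial.eval_one, mul_zero, mul_one, zero_add,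
      add_zero]
    ring
  · rw [(h _ _).1]
    have hl : l = j ∨ l = k := by rw [hc] at hl; simpa using hl
    rcases hl with rfl | rfl <;> simp [hxl]

end Extension

/-! ### The piecewise cubic bubble of class `C¹` attached to an edge -/

section Bubble

open Set

variable {p : ℕ} {v : Fin 3 → Plane} {W : Plane} (hv : AffineIndependent ℝ v)

/-- The piecewise cubic function of class `C¹`, which vanishes on the boundary of the triangle, with
gradient vanishing on the edges other than the one opposite to the vertex `i`. -/
noncomputable def bubble (W : Plane) (i j k l : Fin 3) (x : Plane) : ℝ :=
  if l = j then mu hv W j x ^ 2 * (3 * mu hv W k x - mu hv W j x)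
  else if l = k then mu hv W k x ^ 2 * (3 * mu hv W j x - mu hv W k x)
  else mu hv W i x * (6 * mu hv W j x * mu hv W k x - 3 * mu hv W k x * mu hv W i x -
    3 * mu hv W j x * mu hv W i x + 2 * mu hv W i x ^ 2)

/-- The gradient of `mu`. -/
noncomputable def muGrad (W : Plane) (i : Fin 3) : Plane →L[ℝ] ℝ :=
  (bary hv i W)⁻¹ • baryGrad hv i

/-- The gradient of `bubble`. -/
noncomputable def bubbleGrad (W : Plane) (i j k l : Fin 3) (x : Plane) : Plane →L[ℝ] ℝ :=
  if l = j then (6 * mu hv W j x * mu hv W k x - 3 * mu hv W j x ^ 2) • muGrad hv W j +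
    (3 * mu hv W j x ^ 2) • muGrad hv W k
  else if l = k then (6 * mu hv W j x * mu hv W k x - 3 * mu hv W k x ^ 2) • muGrad hv W k +
    (3 * mu hv W k x ^ 2) • muGrad hv W j
  else (6 * mu hv W j x * mu hv W k x - 6 * mu hv W k x * mu hv W i x -
      6 * mu hv W j x * mu hv W i x + 6 * mu hv W i x ^ 2) • muGrad hv W i +
    (6 * mu hv W k x * mu hv W i x - 3 * mu hv W i x ^ 2) • muGrad hv W j +
    (6 * mu hv W j x * mu hv W i x - 3 * mu hv W i x ^ 2) • muGrad hv W k

lemma isPolyFun_bubble (W : Plane) (i j k l : Fin 3) : IsPolyFun 3 (bubble hv W i j k l) := by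
  have h := isPolyFun_mu hv W
  unfold bubble
  split_ifs
  · exact ((h j).pow 2).mul (((h k).const_mul 3).sub (h j))
  · exact ((h k).pow 2).mul (((h j).const_mul 3).sub (h k))
  · exact (h i).mul ((((((h j).const_mul 6).mul (h k)).sub (((h k).const_mul 3).mul (h i))).sub
      (((h j).const_mul 3).mul (h i))).add (((h i).pow 2).const_mul 2))

lemma hasFDerivAt_bubble (W : Plane) (i j k l : Fin 3) (x : Plane) :
    HasFDerivAt (bubble hv W i j k l) (bubbleGrad hv W i j k l x) x := by
  have h : ∀ i, HasFDerivAt (mu hv W i) (muGrad hv W i) x := fun i => hasFDerivAt_mu hv W i x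
  unfold bubble bubbleGrad
  split_ifs
  · refine (((h j).pow 2).mul (((h k).const_mul 3).sub (h j))).congr_fderiv ?_
    ext ξ
    simp
    ring
  · refine (((h k).pow 2).mul (((h j).const_mul 3).sub (h k))).congr_fderiv ?_
    ext ξ
    simp
    ring
  · refine ((h i).mul ((((((h j).const_mul 6).mul (h k)).sub (((h k).const_mul 3).mul (h i))).sub
      (((h j).const_mul 3).mul (h i))).add (((h i).pow 2).const_mul 2))).congr_fderiv ?_
    ext ξ
    simp
    ring

lemma eq_or_eq_or_eq : ∀ {i j k : Fin 3}, i ≠ j → i ≠ k → j ≠ k → ∀ l, l = i ∨ l = j ∨ l = k := by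
  decide

lemma mu_eq_of_mem_piece (hW : W ∈ interior (convexHull ℝ (range v))) {l l' : Fin 3} {x : Plane}
    (h : x ∈ piece v W l) (h' : x ∈ piece v W l') : mu hv W l x = mu hv W l' x :=
  le_antisymm (((mem_piece_iff hv hW l x).1 h).2 l') (((mem_piece_iff hv hW l' x).1 h').2 l)

/-- On the interface of two pieces the two corresponding `mu` coincide; with this single
substitution the cubics and their gradients agree as polynomials, which is the `C¹` property. -/
lemma bubble_eq (hW : W ∈ interior (convexHull ℝ (range v))) {i j k : Fin 3} (hij : i ≠ j)
    (hik : i ≠ k) (hjk : j ≠ k) {l l' : Fin 3} {x : Plane}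
    (h : x ∈ piece v W l) (h' : x ∈ piece v W l') :
    bubble hv W i j k l x = bubble hv W i j k l' x ∧
      bubbleGrad hv W i j k l x = bubbleGrad hv W i j k l' x := by
  have key := mu_eq_of_mem_piece hv hW h h'
  unfold bubble bubbleGrad
  have e := eq_or_eq_or_eq hij hik hjk
  rcases e l with h1 | h1 | h1 <;> rcases e l' with h2 | h2 | h2 <;> rw [h1, h2] at key ⊢ <;>
    simp only [hij, hik, hjk, hjk.symm, if_true, if_false] <;> (try rw [key]) <;>
    refine ⟨?_, ?_⟩ <;> first | trivial | ring1 | module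

end Bubble

/-! ### Extension of double-traces of functions from an edge -/

section EdgeExtension

open Set

variable {p : ℕ} {v : Fin 3 → Plane} {W : Plane}

/-- Elements of `A^0(T)` from piecewise polynomial functions. -/
lemma exists_mem_ctSpace_zero (hv : AffineIndependent ℝ v)
    (hW : W ∈ interior (convexHull ℝ (range v))) {φ : Fin 3 → Plane → ℝ}
    {φ' : Fin 3 → Plane → Plane →L[ℝ] ℝ} (hφ : ∀ i, IsPolyFun p (φ i))
    (hφ' : ∀ i x, HasFDerivAt (φ i) (φ' i x) x)
    (h : ∀ i j x, x ∈ piece v W i → x ∈ piece v W j → φ i x = φ j x ∧ φ' i x = φ' j x) :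
    ∃ z ∈ ctSpace p v W triTop 0, ∀ i x (hx : x ∈ cellSet v triTop), x ∈ piece v W i →
      z.1 ⟨x, hx⟩ = form0 (φ i) x ∧ z.2 ⟨x, hx⟩ = form1 (φ' i x) := by
  have hd : ∀ i x, extDeriv (form0 (φ i)) x = form1 (φ' i x) := fun i x => by
    rw [extDeriv_form0, (hφ' i x).fderiv]
  obtain ⟨z, hz, hz'⟩ := exists_mem_ctSpace_triTop (p := p) (k := 0) hv hW (fun i => form0 (φ i))
    (fun i => (hφ i).form0) (fun i j x hi hj => by
      ext ξ
      exact (h i j x hi hj).1) (fun i j x hi hj => by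
      rw [hd, hd, (h i j x hi hj).2])
  refine ⟨z, hz, fun i x hx hi => ⟨(hz' i x hx hi).1, ?_⟩⟩
  rw [(hz' i x hx hi).2, hd]

/-- Extension of double-traces of functions from an edge. -/
lemma exists_extension_edge_zero (hp : 3 ≤ p) (hv : AffineIndependent ℝ v)
    (hW : W ∈ interior (convexHull ℝ (range v))) {c : TriCell} (hcard : c.1.card = 1 + 1)
    {e : FormPair v c 0} (he : e ∈ (ctFES p v W).A₀ c 0) :
    ∃ u ∈ ctSpace p v W triTop 0, (ctFES p v W).r c.le_triTop 0 u = e ∧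
      ∀ l ∈ c.1, ∀ x hx, bary hv l x = 0 → u.1 ⟨x, hx⟩ = 0 ∧ u.2 ⟨x, hx⟩ = 0 := by
  obtain ⟨i, j, k, hij, hik, hjk, hc⟩ := exists_edge_vertices hcard
  have hne : c ≠ triTop := by rintro rfl; simp [triTop] at hcard
  have hj : j ∈ c.1 := by simp [hc]
  have hk : k ∈ c.1 := by simp [hc]
  have hi : i ∉ c.1 := by simp [hc, hij, hik]
  have hpos := bary_inpoint_pos hv hW
  have hemem := (FESData.mem_A₀.1 he).1
  obtain ⟨g, h, hg, hh, hge, hhe⟩ := exists_polyForm_of_mem_ctSpace hne hemem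
  rw [eq_form0 g] at hg hge
  have hadm := (isAdmissible_edge_iff hjk hc e hg.contDiff hge).1 hemem.1
  obtain ⟨hj1, hj2⟩ := A₀_edge_vertex hcard he hj
  obtain ⟨hk1, hk2⟩ := A₀_edge_vertex hcard he hk
  set d : Plane := v k - v j with hd
  have hline : ∀ s : ℝ, v j + s • d = v j + s • (v k - v j) := fun s => rfl
  have hmem : ∀ s ∈ Icc (0 : ℝ) 1, v j + s • d ∈ cellSet v c := fun s hs =>
    (mem_edge_iff hc _).2 ⟨s, hs, rfl⟩
  have hend : v j + (1 : ℝ) • d = v k := by rw [one_smul, hd, add_sub_cancel]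
  have hstart : v j + (0 : ℝ) • d = v j := by rw [zero_smul, add_zero]
  have hbi : ∀ s : ℝ, bary hv i (v j + s • d) = 0 := fun s => by
    rw [hline, bary_line, bary_vertex, bary_vertex, if_neg hij, if_neg hik]; ring
  have hbj : ∀ s : ℝ, bary hv j (v j + s • d) = 1 - s := fun s => by
    rw [hline, bary_line, bary_vertex, bary_vertex, if_pos rfl, if_neg hjk]; ring
  have hbk : ∀ s : ℝ, bary hv k (v j + s • d) = s := fun s => by
    rw [hline, bary_line, bary_vertex, bary_vertex, if_pos rfl, if_neg hjk.symm]; ring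
  -- the values
  obtain ⟨R, hR, hR'⟩ := (hg ![]).comp_line (v j) d
  have hder : ∀ (f : Plane → ℝ) (s : ℝ), Differentiable ℝ f →
      HasDerivAt (fun s : ℝ => f (v j + s • d)) (fderiv ℝ f (v j + s • d) d) s := by
    intro f s hf
    have h1 : HasDerivAt (fun s : ℝ => v j + s • d) ((1 : ℝ) • d) s :=
      ((hasDerivAt_id s).smul_const d).const_add (v j)
    rw [one_smul] at h1
    exact (hf (v j + s • d)).hasFDerivAt.comp_hasDerivAt s h1
  have hRd : ∀ s ∈ Icc (0 : ℝ) 1, R.derivative.eval s = h (v j + s • d) fun _ => d := by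
    intro s hs
    have h1 := hder (fun x => g x ![]) s (hg ![]).differentiable
    have h2 : (fun s : ℝ => g (v j + s • d) ![]) = fun s => R.eval s := funext hR'
    rw [h2] at h1
    rw [(R.hasDerivAt s).unique h1, ← hhe _ (hmem s hs), hadm]
  have hz0 : ∀ ξ : Plane, (h (v j) fun _ => ξ) = 0 := fun ξ => by
    rw [← hhe _ (vertex_mem_cellSet hj), hj2]; rfl
  have hz1 : ∀ ξ : Plane, (h (v k) fun _ => ξ) = 0 := fun ξ => by
    rw [← hhe _ (vertex_mem_cellSet hk), hk2]; rfl
  -- The value and the differential of `e` vanish at both vertices, so the restriction to the edge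
  -- has double zeros there.
  obtain ⟨S, hRS, hS⟩ := exists_factor_four hR
    (by rw [← hR', hstart]; exact (congr_arg (fun u : AltForm 0 => u ![])
      ((hge _ (vertex_mem_cellSet hj)).symm.trans hj1)))
    (by rw [← hR', hend]; exact (congr_arg (fun u : AltForm 0 => u ![])
      ((hge _ (vertex_mem_cellSet hk)).symm.trans hk1)))
    (by rw [hRd 0 (by simp), hstart, hz0]) (by rw [hRd 1 (by simp), hend, hz1])
  -- On the edge this is `R`. The squares make `ψ` vanish with its gradient on the other two edges.
  let ψ : Plane → ℝ := fun x => bary hv j x ^ 2 * (bary hv k x ^ 2 * S.eval (bary hv k x))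
  have hψ : IsPolyFun p ψ := by
    rcases hS with rfl | hS
    · simpa [ψ] using IsPolyFun.const p 0
    · exact (((isPolyFun_bary hv j).pow 2).mul (((isPolyFun_bary hv k).pow 2).mul
        (IsPolyFun.polynomial_comp le_rfl (isPolyFun_bary hv k)))).mono (by omega)
  have hψR : ∀ s : ℝ, ψ (v j + s • d) = R.eval s := fun s => by
    simp only [ψ, hbj, hbk, hRS, Polynomial.eval_mul, Polynomial.eval_pow, Polynomial.eval_X,
      Polynomial.eval_sub, Polynomial.eval_one]
    ring
  have hψd : ∀ s ∈ Icc (0 : ℝ) 1, fderiv ℝ ψ (v j + s • d) d = h (v j + s • d) fun _ => d := by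
    intro s hs
    have h1 := hder ψ s hψ.differentiable
    rw [funext hψR] at h1
    rw [← hRd s hs, (R.hasDerivAt s).unique h1]
  have hψj : ∀ x, bary hv j x = 0 → ψ x = 0 ∧ fderiv ℝ ψ x = 0 := fun x hx =>
    ⟨by simp [ψ, hx], hasFDerivAt_sq_mul (isPolyFun_bary hv j) (((isPolyFun_bary hv k).pow 2).mul
      (IsPolyFun.polynomial_comp le_rfl (isPolyFun_bary hv k))) hx⟩
  have hψk : ∀ x, bary hv k x = 0 → ψ x = 0 ∧ fderiv ℝ ψ x = 0 := fun x hx => by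
    have h1 := hasFDerivAt_sq_mul (isPolyFun_bary hv k) (((isPolyFun_bary hv j).pow 2).mul
      (IsPolyFun.polynomial_comp (S := S) le_rfl (isPolyFun_bary hv k))) hx
    have h2 : (fun y => bary hv k y ^ 2 * (bary hv j y ^ 2 * S.eval (bary hv k y))) = ψ := by
      ext1 y; simp only [ψ]; ring
    rw [h2] at h1
    exact ⟨by simp [ψ, hx], h1⟩
  -- the normal derivatives
  obtain ⟨N, hN, hN'⟩ := IsPolyFun.comp_line
    ((hh fun _ => v i - v j).sub (hψ.fderiv_apply (v i - v j))) (v j) d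
  -- `N` is the error in the derivative along `v i - v j`, transversal to the edge; it vanishes at
  -- both ends because the prescribed form and the gradient of `ψ` do.
  obtain ⟨S₂, hNS, hS₂⟩ := exists_factor_two hN
    (by rw [← hN', hstart, hz0, (hψk _ (by simp [bary_vertex, hjk.symm])).2]; simp)
    (by rw [← hN', hend, hz1, (hψj _ (by simp [bary_vertex, hjk])).2]; simp)
  -- On the edge the gradient of the bubble is `6 mu j * mu k` times that of `mu i`. The constant
  -- undoes the factor `6` and the scalings, so that `q` times this gradient is `N` times the
  -- gradient of `bary i`.
  let κ : ℝ := bary hv i W * bary hv j W * bary hv k W / 6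
  let q : Plane → ℝ := fun x => κ * S₂.eval (bary hv k x)
  have hq : IsPolyFun S₂.natDegree q :=
    (IsPolyFun.polynomial_comp le_rfl (isPolyFun_bary hv k)).const_mul κ
  have hφ : ∀ l, IsPolyFun p fun x => ψ x + bubble hv W i j k l x * q x := fun l => by
    refine hψ.add ?_
    rcases hS₂ with h0 | hS₂
    · simpa [q, h0] using IsPolyFun.const p 0
    -- The degree of `N` is at most `p - 1`, hence that of `S₂` at most `p - 3`, and the cubic
    -- bubble brings the total to `p`.
    · exact ((isPolyFun_bubble hv W i j k l).mul hq).mono (by omega)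
  obtain ⟨z, hz, hz'⟩ := exists_mem_ctSpace_zero (φ := fun l x => ψ x + bubble hv W i j k l x * q x)
    (φ' := fun l x => fderiv ℝ ψ x +
      (bubble hv W i j k l x • fderiv ℝ q x + q x • bubbleGrad hv W i j k l x))
    hv hW hφ (fun l x => (hψ.differentiable x).hasFDerivAt.add
      ((hasFDerivAt_bubble hv W i j k l x).mul (hq.differentiable x).hasFDerivAt))
    (fun l l' x hl hl' => by
      obtain ⟨h1, h2⟩ := bubble_eq hv hW hij hik hjk hl hl'
      simp only [h1, h2, and_self])
  have hsub := cellSet_subset_piece (v := v) (W := W) hi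
  refine ⟨z, hz, formPair_ext (fun x hx => ?_) (fun x hx => ?_), fun l hl x hx hxl => ?_⟩
  · rw [ctFES_r, traceForm_apply, (hz' i _ _ (hsub hx)).1, hge]
    obtain ⟨s, hs, rfl⟩ := (mem_edge_iff hc x).1 hx
    ext ξ
    rw [form0_apply, form0_apply, ← hline, show g (v j + s • d) ![] = R.eval s from hR' s, hψR]
    simp [bubble, mu, hij, hik, hbi]
  · rw [ctFES_r, traceForm_apply, (hz' i _ _ (hsub hx)).2, hhe]
    obtain ⟨s, hs, rfl⟩ := (mem_edge_iff hc x).1 hx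
    refine altForm_one_ext fun ξ => ?_
    rw [form1_apply, ← hline]
    have hb0 : bubble hv W i j k i (v j + s • d) = 0 := by
      simp [bubble, mu, hij, hik, hbi]
    have hbg : q (v j + s • d) • bubbleGrad hv W i j k i (v j + s • d) =
        N.eval s • baryGrad hv i := by
      have h1 := (hpos i).ne'
      have h2 := (hpos j).ne'
      have h3 := (hpos k).ne'
      simp only [bubbleGrad, if_neg hij, if_neg hik, mu, hbi, hbj, hbk, muGrad, q, κ, hNS,
        Polynomial.eval_mul, Polynomial.eval_X, Polynomial.eval_sub, Polynomial.eval_one]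
      ext ξ
      simp
      field_simp
    rw [hb0, hbg]
    -- Vectors are split into a transversal part, where `N` supplies the correction, and a part
    -- tangent to the edge, where `ψ` alone is already right by admissibility of `e`.
    have hξ : ξ = baryGrad hv i ξ • (v i - v j) + baryGrad hv k ξ • d := by
      have e1 := sum_baryGrad_smul hv ξ
      have e0 := sum_baryGrad hv ξ
      have hu : (Finset.univ : Finset (Fin 3)) = {i, j, k} :=
        (Finset.eq_univ_of_forall fun l => by
          simpa using eq_or_eq_or_eq hij hik hjk l).symm
      rw [hu, Finset.sum_insert (by simp [hij, hik]), Finset.sum_pair hjk] at e0 e1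
      have e2 : baryGrad hv j ξ = - baryGrad hv i ξ - baryGrad hv k ξ := by linarith
      rw [e2] at e1
      conv_lhs => rw [← e1]
      rw [hd]
      module
    have h1 := hN' s
    have h2 := hψd s hs
    simp only [add_apply, smul_apply, zero_smul, zero_add]
    conv_rhs => rw [hξ, altForm_one_add, altForm_one_smul, altForm_one_smul, ← h2]
    rw [← h1]
    conv_lhs => rw [hξ]
    have g1 : baryGrad hv i (v i - v j) = 1 := by
      rw [baryGrad_sub, bary_vertex, bary_vertex, if_pos rfl, if_neg hij, sub_zero]
    have g2 : baryGrad hv i d = 0 := by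
      rw [hd, baryGrad_sub, bary_vertex, bary_vertex, if_neg hij, if_neg hik, sub_zero]
    simp only [map_add, map_smul, g1, g2, smul_eq_mul]
    ring
  · have hl' : l = j ∨ l = k := by rw [hc] at hl; simpa using hl
    -- A point of the triangle on the edge opposite to vertex `l` lies in piece `l`, where the
    -- bubble is divisible by the square of `mu l`.
    have hml : x ∈ piece v W l := by
      have h0 := (mem_triTop_iff hv x).1 hx
      refine (mem_piece_iff hv hW l x).2 ⟨hxl.ge, fun m => ?_⟩
      rw [mu, hxl, zero_div]
      exact div_nonneg (h0 m) (hpos m).le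
    have hb : bubble hv W i j k l x = 0 ∧ bubbleGrad hv W i j k l x = 0 := by
      rcases hl' with rfl | rfl <;> simp [bubble, bubbleGrad, mu, hxl, hjk.symm]
    have hψ0 : ψ x = 0 ∧ fderiv ℝ ψ x = 0 := by
      rcases hl' with rfl | rfl
      exacts [hψj x hxl, hψk x hxl]
    refine ⟨?_, ?_⟩
    · rw [(hz' l _ _ hml).1]
      ext ξ
      simp [hb.1, hψ0.1]
    · rw [(hz' l _ _ hml).2, hb.1, hb.2, hψ0.2]
      refine altForm_one_ext fun ξ => ?_
      simp

end EdgeExtension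

/-! ### Extension of one-forms and compatibility of the system -/

section Compatible

open Set MeasureTheory

variable {p : ℕ} {v : Fin 3 → Plane} {W : Plane}

lemma strictMono_card : StrictMono fun c : TriCell => c.1.card := fun _ _ h => Finset.card_lt_card h

lemma exists_mem_notMem {c c' : TriCell} (hne : c ≠ c') (h : c.1.card ≤ c'.1.card) :
    ∃ l ∈ c'.1, l ∉ c.1 := by
  by_contra! hcon
  exact hne (Subtype.ext (Finset.eq_of_subset_of_card_le hcon h).symm)

/-- A pair vanishing where a barycentric coordinate vanishes has zero trace on the cells which do
not contain the corresponding vertex. -/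
lemma r_eq_zero_of_bary (hv : AffineIndependent ℝ v) {c : TriCell} {k : ℕ}
    {u : FormPair v triTop k} {l : Fin 3} (hl : l ∉ c.1)
    (h : ∀ x hx, bary hv l x = 0 → u.1 ⟨x, hx⟩ = 0 ∧ u.2 ⟨x, hx⟩ = 0) :
    (ctFES p v W).r c.le_triTop k u = 0 := by
  rw [ctFES_r]
  refine formPair_ext (fun x hx => ?_) fun x hx => ?_
  · exact (h x _ (((mem_cellSet_iff hv c x).1 hx).2 l hl)).1
  · exact (h x _ (((mem_cellSet_iff hv c x).1 hx).2 l hl)).2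

/-- Extension from a vertex, for degrees other than one. -/
lemma exists_extension_vertex (hp : 3 ≤ p) (hv : AffineIndependent ℝ v)
    (hW : W ∈ interior (convexHull ℝ (range v))) {c : TriCell} (hc : c.1.card = 1) {k : ℕ}
    (hk : k ≠ 1) (e : FormPair v c k) :
    ∃ u ∈ ctSpace p v W triTop k, (ctFES p v W).r c.le_triTop k u = e ∧
      ∀ l ∈ c.1, ∀ x hx, bary hv l x = 0 → u.1 ⟨x, hx⟩ = 0 ∧ u.2 ⟨x, hx⟩ = 0 := by
  obtain ⟨i, hi⟩ := Finset.card_eq_one.1 hc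
  obtain rfl | rfl | hk : k = 0 ∨ k = 2 ∨ 3 ≤ k := by omega
  · exact exists_extension_vertex_zero hp hv hW hi e
  · exact exists_extension_vertex_two hp hv hW hi e
  · exact ⟨0, Submodule.zero_mem _, (map_zero _).trans (formPair_eq_zero hk e).symm,
      fun _ _ _ _ _ => ⟨rfl, rfl⟩⟩

/-- Extension from the boundary of the triangle, for degrees other than one. -/
lemma exists_extension_of_ne_one (hp : 3 ≤ p) (hv : AffineIndependent ℝ v)
    (hW : W ∈ interior (convexHull ℝ (range v))) {k : ℕ} (hk : k ≠ 1)
    (f : ∀ c' : TriCell, c' < triTop → FormPair v c' k)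
    (hf : (ctFES p v W).IsBoundaryFamily triTop k f) :
    ∃ u ∈ ctSpace p v W triTop k, ∀ c' (h : c' < triTop), (ctFES p v W).r h.le k u = f c' h := by
  refine FESData.admitsExtensionsOn_of_step (isFES_ctFES hv hW) _ strictMono_card
    (fun c h e he => ?_) f hf
  -- It suffices to vanish on the edges opposite to the vertices of `c`: a different cell with at
  -- most as many vertices misses some vertex of `c` and lies in the opposite edge.
  suffices hs : ∃ u ∈ ctSpace p v W triTop k, (ctFES p v W).r c.le_triTop k u = e ∧
      ∀ l ∈ c.1, ∀ x hx, bary hv l x = 0 → u.1 ⟨x, hx⟩ = 0 ∧ u.2 ⟨x, hx⟩ = 0 by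
    obtain ⟨u, hu, hue, hu0⟩ := hs
    refine ⟨u, hu, hue, fun c' h' hne hcard => ?_⟩
    obtain ⟨l, hl, hl'⟩ := exists_mem_notMem hne hcard
    exact r_eq_zero_of_bary hv hl' (hu0 l hl)
  have h1 : c.1.card < 3 := strictMono_card h
  have h0 := c.2.card_pos
  obtain h1 | h1 : c.1.card = 1 ∨ c.1.card = 1 + 1 := by omega
  · exact exists_extension_vertex hp hv hW h1 hk e
  obtain rfl | rfl | hk : k = 0 ∨ k = 2 ∨ 3 ≤ k := by omega
  · exact exists_extension_edge_zero hp hv hW h1 he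
  · exact exists_extension_edge_two hv hW h1 he
  · exact ⟨0, Submodule.zero_mem _, (map_zero _).trans (formPair_eq_zero hk e).symm,
      fun _ _ _ _ _ => ⟨rfl, rfl⟩⟩

lemma vol2_ne_zero (hv : AffineIndependent ℝ v) : vol2 ![v 1 - v 0, v 2 - v 0] ≠ 0 := by
  intro h
  rw [vol2_apply] at h
  have h0 := eq_baryGrad_smul hv (EuclideanSpace.single 0 1)
  have h1 := eq_baryGrad_smul hv (EuclideanSpace.single 1 1)
  set P := v 1 - v 0
  set Q := v 2 - v 0
  have e00 := congr_arg (fun x : Plane => x 0) h0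
  have e01 := congr_arg (fun x : Plane => x 1) h0
  have e10 := congr_arg (fun x : Plane => x 0) h1
  have e11 := congr_arg (fun x : Plane => x 1) h1
  simp at e00 e01 e10 e11 h
  set a := baryGrad hv 1 (EuclideanSpace.single 0 1)
  set b := baryGrad hv 2 (EuclideanSpace.single 0 1)
  set a' := baryGrad hv 1 (EuclideanSpace.single 1 1)
  set b' := baryGrad hv 2 (EuclideanSpace.single 1 1)
  -- Multiplicativity of determinants: the canonical basis, of determinant one, is expressed through
  -- the edge vectors, whose determinant would be zero.
  have key : (a * P 0 + b * Q 0) * (a' * P 1 + b' * Q 1) -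
      (a' * P 0 + b' * Q 0) * (a * P 1 + b * Q 1) = (a * b' - b * a') * (P 0 * Q 1 - Q 0 * P 1) := by
    ring
  rw [h, ← e00, ← e01, ← e10, ← e11] at key
  norm_num at key

lemma cellParam_triTop_bary (hv : AffineIndependent ℝ v) (t : Fin 2 → ℝ) (i : Fin 3) :
    bary hv i (cellParam v triTop card_triTop t) = ![1 - t 0 - t 1, t 0, t 1] i := by
  rw [cellParam_triTop, bary_add, map_add, map_smul, map_smul, baryGrad_sub, baryGrad_sub]
  simp only [bary_vertex, smul_eq_mul]
  fin_cases i <;> simp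
  ring

/-- A `2`-form with zero boundary values and nonzero integral. -/
lemma exists_hat (hp : 3 ≤ p) (hv : AffineIndependent ℝ v)
    (hW : W ∈ interior (convexHull ℝ (range v))) :
    ∃ u ∈ ctSpace p v W triTop 2, (∀ c (h : c < triTop), (ctFES p v W).r h.le 2 u = 0) ∧
      cellIntegral v triTop card_triTop u.1 ≠ 0 := by
  have hpos := bary_inpoint_pos hv hW
  -- The hat function of `W`, that is the least of the three `mu`: positive inside the triangle and
  -- zero on the boundary.
  obtain ⟨z, hz, hz'⟩ := exists_mem_ctSpace_triTop (p := p) (k := 2) hv hW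
    (fun i x => mu hv W i x • vol2)
    (fun i => (IsPolyForm.smul (isPolyFun_mu hv W i) (IsPolyForm.const 0 _)).mono (by omega))
    (fun i j x hi hj => by rw [mu_eq_of_mem_piece hv hW hi hj])
    (fun i j x hi hj => (altForm_eq_zero le_rfl _).trans (altForm_eq_zero le_rfl _).symm)
  refine ⟨z, hz, fun c h => ?_, ?_⟩
  · obtain ⟨i, hi⟩ := exists_notMem_of_ne h.ne
    rw [ctFES_r]
    refine formPair_ext (fun x hx => ?_) fun x hx =>
      (altForm_eq_zero le_rfl _).trans (altForm_eq_zero le_rfl _).symm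
    refine ((hz' i x _ (cellSet_subset_piece hi hx)).1).trans ?_
    rw [mu, ((mem_cellSet_iff hv c x).1 hx).2 i hi, zero_div, zero_smul]
    rfl
  · have hξ : (fun i : Fin 2 => cellVertex v triTop card_triTop i.succ -
        cellVertex v triTop card_triTop 0) = ![v 1 - v 0, v 2 - v 0] := by
      ext1 l
      fin_cases l <;> simp [cellVertex_triTop v]
    set D := vol2 ![v 1 - v 0, v 2 - v 0] with hD
    have hD0 : D ≠ 0 := vol2_ne_zero hv
    let m : (Fin 2 → ℝ) → ℝ := fun t =>
      extZero z.1 (cellParam v triTop card_triTop t) ![v 1 - v 0, v 2 - v 0] / D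
    have hm : ∀ t ∈ refSimplex 2, ∃ i, m t = mu hv W i (cellParam v triTop card_triTop t) := by
      intro t ht
      have hx := cellParam_mem v triTop card_triTop ht
      obtain ⟨i, hi⟩ := mem_iUnion.1 (cellSet_subset_iUnion_piece hv hW hx)
      refine ⟨i, ?_⟩
      simp only [m]
      rw [extZero_apply _ hx, (hz' i _ hx hi).1, ContinuousAlternatingMap.smul_apply, ← hD,
        smul_eq_mul, mul_div_assoc, div_self hD0, mul_one]
    have hint : 0 < ∫ t in refSimplex 2, m t := by
      have hmeas : MeasurableSet (refSimplex 2) := (isCompact_refSimplex 2).isClosed.measurableSet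
      rw [setIntegral_pos_iff_support_of_nonneg_ae]
      · refine lt_of_lt_of_le ?_ (measure_mono (μ := volume) (s := interior (refSimplex 2)) ?_)
        · exact isOpen_interior.measure_pos _ (nonempty_interior_refSimplex 2)
        · intro t ht
          obtain ⟨i, hi⟩ := hm t (interior_subset ht)
          refine ⟨?_, interior_subset ht⟩
          rw [Function.mem_support, hi, mu]
          refine (div_pos ?_ (hpos i)).ne'
          have h0 := pos_of_mem_interior_refSimplex ht 0
          have h1 := pos_of_mem_interior_refSimplex ht 1
          have h2 := sum_lt_one_of_mem_interior_refSimplex ht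
          rw [Fin.sum_univ_two] at h2
          rw [cellParam_triTop_bary]
          fin_cases i <;> simp <;> linarith
      · refine (ae_restrict_iff' hmeas).2 (Filter.Eventually.of_forall fun t ht => ?_)
        obtain ⟨i, hi⟩ := hm t ht
        rw [hi]
        exact div_nonneg ((mem_triTop_iff hv _).1 (cellParam_mem v triTop card_triTop ht) i)
          (hpos i).le
      · exact ((continuousOn_extZero_cellParam v triTop card_triTop z.1 _).div_const
          D).integrableOn_compact (isCompact_refSimplex 2)
    have heq : cellIntegral v triTop card_triTop z.1 = D * ∫ t in refSimplex 2, m t := by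
      rw [cellIntegral, ← integral_const_mul]
      refine integral_congr_ae (Filter.Eventually.of_forall fun t => ?_)
      simp only [m]
      rw [hξ]
      field_simp
    rw [heq]
    exact mul_ne_zero hD0 hint.ne'

/-- The edge joining two vertices. -/
def edgeCell (i j : Fin 3) : TriCell := ⟨{i, j}, by simp⟩

lemma card_edgeCell {i j : Fin 3} (h : i ≠ j) : (edgeCell i j).1.card = 1 + 1 := Finset.card_pair h

lemma edgeCell_lt {i j : Fin 3} (h : i ≠ j) : edgeCell i j < triTop := by
  refine lt_of_le_of_ne (TriCell.le_triTop _) fun he => ?_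
  have := card_edgeCell h
  rw [he] at this
  simp [triTop] at this

/-- Stokes' formula on the triangle, in terms of traces. -/
lemma cellIntegral_d_triTop_trace (v : Fin 3 → Plane) {z : FormPair v triTop 1}
    (hz : IsAdmissible v triTop 1 z) : cellIntegral v triTop card_triTop z.2 =
      cellIntegral v (edgeCell 0 1) rfl (traceForm v (TriCell.le_triTop _) 1 z.1) -
      cellIntegral v (edgeCell 0 2) rfl (traceForm v (TriCell.le_triTop _) 1 z.1) +
      cellIntegral v (edgeCell 1 2) rfl (traceForm v (TriCell.le_triTop _) 1 z.1) := by
  rw [cellIntegral_d_triTop v hz, cellIntegral_trace_edge v _ rfl (by decide) rfl,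
    cellIntegral_trace_edge v _ rfl (by decide) rfl, cellIntegral_trace_edge v _ rfl (by decide) rfl]

lemma cellIntegral_add (v : Fin 3 → Plane) (c : TriCell) {m : ℕ} (h : c.1.card = m + 1)
    (u w : C(cellSet v c, AltForm m)) :
    cellIntegral v c h (u + w) = cellIntegral v c h u + cellIntegral v c h w := by
  have := integral_cell_add v c h u w (continuous_const (y := (1 : ℝ)))
  simpa [cellIntegral] using this _

lemma cellIntegral_smul (v : Fin 3 → Plane) (c : TriCell) {m : ℕ} (h : c.1.card = m + 1)
    (a : ℝ) (u : C(cellSet v c, AltForm m)) :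
    cellIntegral v c h (a • u) = a * cellIntegral v c h u := by
  have := integral_cell_smul v c h a u (fun _ => (1 : ℝ))
  simpa [cellIntegral] using this _

lemma cellIntegral_sub (v : Fin 3 → Plane) (c : TriCell) {m : ℕ} (h : c.1.card = m + 1)
    (u w : C(cellSet v c, AltForm m)) :
    cellIntegral v c h (u - w) = cellIntegral v c h u - cellIntegral v c h w := by
  have h1 : u - w = u + (-1 : ℝ) • w := by module
  rw [h1, cellIntegral_add, cellIntegral_smul]
  ring

/-- Elements of `A^0(c)` are determined by their differential and one value. -/
lemma eq_of_snd_eq (hv : AffineIndependent ℝ v)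
    (hW : W ∈ interior (convexHull ℝ (range v))) {c : TriCell} {z w : FormPair v c 0}
    (hz : z ∈ ctSpace p v W c 0) (hw : w ∈ ctSpace p v W c 0) (h : z.2 = w.2) {x : Plane}
    (hx : x ∈ cellSet v c) (hxx : z.1 ⟨x, hx⟩ ![] = w.1 ⟨x, hx⟩ ![]) : z = w := by
  have h1 := exists_const_eq (p := p) hv hW (Submodule.sub_mem _ hz hw) (sub_eq_zero.2 h) hx
  have h2 : (z - w).1 ⟨x, hx⟩ ![] = 0 := sub_eq_zero.2 hxx
  rw [h2, map_zero] at h1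
  exact (sub_eq_zero.1 h1.symm)

/-- Potentials of closed `1`-forms on cells of the boundary, with prescribed values. -/
lemma exists_potential (hp : 1 ≤ p) (hv : AffineIndependent ℝ v)
    (hW : W ∈ interior (convexHull ℝ (range v))) {c : TriCell} (hc : c < triTop)
    {h : FormPair v c 1} (hh : h ∈ ctSpace p v W c 1) {a : Fin 3 → ℝ}
    (ha : ∀ (hcard : c.1.card = 1 + 1) (i j : Fin 3), i < j → c.1 = {i, j} →
      cellIntegral v c hcard h.1 = a j - a i) :
    ∃ φ ∈ ctSpace p v W c 0, φ.2 = h.1 ∧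
      ∀ l (hl : l ∈ c.1), φ.1 ⟨v l, vertex_mem_cellSet hl⟩ ![] = a l := by
  have hF := isFES_ctFES (p := p) hv hW
  have h1 : c.1.card < 3 := strictMono_card hc
  have h0 := c.2.card_pos
  obtain h1 | h1 : c.1.card = 1 ∨ c.1.card = 1 + 1 := by omega
  · obtain ⟨i, hi⟩ := Finset.card_eq_one.1 h1
    -- At a vertex all pairs are admissible, so value and differential are prescribed independently.
    refine ⟨(0, h.1) + (ctFES p v W).const c (a i),
      Submodule.add_mem _ (mem_ctSpace_zero_prod h1.le hh) (hF.const_mem c (a i)), add_zero _, ?_⟩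
    intro l hl
    obtain rfl : l = i := by rw [hi] at hl; simpa using hl
    exact zero_add _
  · obtain ⟨i, j, hij, hc2⟩ : ∃ i j : Fin 3, i < j ∧ c.1 = {i, j} := by
      rcases exists_pair_of_card h1 with h | h | h
      exacts [⟨0, 1, by decide, h⟩, ⟨0, 2, by decide, h⟩, ⟨1, 2, by decide, h⟩]
    obtain ⟨φ, hφ, hφh⟩ := exists_d_eq_edge (W := W) hp hv h1 hh
    have hi : i ∈ c.1 := by simp [hc2]
    have hj : j ∈ c.1 := by simp [hc2]
    refine ⟨φ + (ctFES p v W).const c (a i - φ.1 ⟨v i, vertex_mem_cellSet hi⟩ ![]),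
      Submodule.add_mem _ hφ (hF.const_mem c _), (add_zero _).trans hφh, ?_⟩
    -- After adjustment at one end by a constant, the hypothesis on the circulation gives the right
    -- value at the other end.
    have hst := cellIntegral_d_edge v h1 hij hc2 hφ.1
    rw [hφh, ha h1 i j hij hc2, extZero_apply _ (vertex_mem_cellSet hi),
      extZero_apply _ (vertex_mem_cellSet hj)] at hst
    intro l hl
    change φ.1 ⟨v l, _⟩ ![] + (a i - φ.1 ⟨v i, _⟩ ![]) = a l
    obtain rfl | rfl : l = i ∨ l = j := by rw [hc2] at hl; simpa using hl
    · ring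
    · linarith

/-- Extension of `1`-forms with prescribed exterior derivative. -/
lemma exists_extension_one_of_d (hp : 3 ≤ p) (hv : AffineIndependent ℝ v)
    (hW : W ∈ interior (convexHull ℝ (range v)))
    {f : ∀ c' : TriCell, c' < triTop → FormPair v c' 1}
    (hf : (ctFES p v W).IsBoundaryFamily triTop 1 f) {w : FormPair v triTop 2}
    (hw : w ∈ ctSpace p v W triTop 2)
    (hwf : ∀ c (h : c < triTop), (ctFES p v W).r h.le 2 w = (ctFES p v W).d c 1 (f c h))
    (hint : cellIntegral v triTop card_triTop w.1 =
      cellIntegral v (edgeCell 0 1) rfl (f _ (edgeCell_lt (by decide))).1 -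
      cellIntegral v (edgeCell 0 2) rfl (f _ (edgeCell_lt (by decide))).1 +
      cellIntegral v (edgeCell 1 2) rfl (f _ (edgeCell_lt (by decide))).1) :
    ∃ u ∈ ctSpace p v W triTop 1, (ctFES p v W).d triTop 1 u = w ∧
      ∀ c (h : c < triTop), (ctFES p v W).r h.le 1 u = f c h := by
  have hF := isFES_ctFES (p := p) hv hW
  obtain ⟨u₁, hu₁, hu₁w⟩ := exists_d_eq_triTop_two (by omega) hv hW hw
  -- The defect on the boundary of an arbitrary primitive of `w`. Its second component is zero,
  -- since `w` restricts to the differential of the data.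
  let h : ∀ c : TriCell, c < triTop → FormPair v c 1 := fun c hc =>
    f c hc - (ctFES p v W).r hc.le 1 u₁
  have hh : ∀ c hc, h c hc ∈ ctSpace p v W c 1 := fun c hc =>
    Submodule.sub_mem _ (hf.1 c hc) (hF.r_mem hc.le 1 u₁ hu₁)
  have hh2 : ∀ c hc, (h c hc).2 = 0 := fun c hc => by
    have h1 : traceForm v hc.le 2 w.1 = (f c hc).2 := congr_arg Prod.fst (hwf c hc)
    change (f c hc).2 - traceForm v hc.le 2 u₁.2 = 0
    rw [hu₁w, h1, sub_self]
  have hhr : ∀ c' c (h' : c' ≤ c) (hc : c < triTop), h c' (h'.trans_lt hc) =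
      (ctFES p v W).r h' 1 (h c hc) := fun c' c h' hc => by
    simp only [h]
    rw [map_sub, ← hf.2 c' c h' hc, ← hF.r_r h' hc.le 1 u₁ hu₁]
  have hu₁s := cellIntegral_d_triTop_trace v hu₁.1
  rw [hu₁w] at hu₁s
  have hI : ∀ (i j : Fin 3) (hij : i ≠ j), cellIntegral v (edgeCell i j) (card_edgeCell hij)
      (h _ (edgeCell_lt hij)).1 =
      cellIntegral v (edgeCell i j) (card_edgeCell hij) (f _ (edgeCell_lt hij)).1 -
      cellIntegral v (edgeCell i j) (card_edgeCell hij)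
        (traceForm v (TriCell.le_triTop _) 1 u₁.1) := fun i j hij => cellIntegral_sub _ _ _ _ _
  have hI01 := hI 0 1 (by decide)
  have hI02 := hI 0 2 (by decide)
  have hI12 := hI 1 2 (by decide)
  -- Vertex values of a potential of the defect, starting from `0` at the vertex `0`. The edge `{1,
  -- 2}` is consistent because the circulation of the defect is zero, by `hint` and Stokes' formula
  -- for `u₁`.
  let a : Fin 3 → ℝ := ![0, cellIntegral v (edgeCell 0 1) rfl (h _ (edgeCell_lt (by decide))).1,
    cellIntegral v (edgeCell 0 2) rfl (h _ (edgeCell_lt (by decide))).1]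
  have ha : ∀ c (hc : c < triTop) (hcard : c.1.card = 1 + 1) (i j : Fin 3), i < j → c.1 = {i, j} →
      cellIntegral v c hcard (h c hc).1 = a j - a i := by
    intro c hc hcard i j hij hcij
    obtain rfl : c = edgeCell i j := Subtype.ext hcij
    fin_cases i <;> fin_cases j <;> simp at hij
    · simp [a]
    · simp [a]
    · simp only [a]
      refine hI12.trans ?_
      simp only [Fin.reduceFinMk, Matrix.cons_val]
      rw [hI01, hI02]
      linarith
  choose φ hφ hφh hφa using fun c (hc : c < triTop) =>
    exists_potential (by omega) hv hW hc (hh c hc) (ha c hc)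
  -- Potentials on a cell and on its subcells have the same differential and the same vertex values,
  -- so they form a boundary family of functions, which extends to the triangle.
  obtain ⟨Φ, hΦ, hΦφ⟩ := exists_extension_of_ne_one hp hv hW (k := 0) (by decide) φ
    ⟨hφ, fun c' c h' hc => by
      obtain ⟨l, hl⟩ := c'.2
      refine eq_of_snd_eq hv hW (hφ _ _) (hF.r_mem h' 0 _ (hφ c hc)) ?_ (vertex_mem_cellSet hl) ?_
      · rw [hφh, ctFES_r]
        simp only
        rw [hφh, hhr c' c h' hc]
        rfl
      · rw [hφa _ _ l hl, ctFES_r, traceForm_apply]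
        exact (hφa c hc l (h' hl)).symm⟩
  refine ⟨u₁ + (ctFES p v W).d triTop 0 Φ, Submodule.add_mem _ hu₁ (hF.d_mem _ _ _ hΦ), ?_,
    fun c hc => ?_⟩
  · rw [map_add, hF.d_d triTop 0 Φ hΦ, add_zero, ctFES_d, hu₁w]
    exact Prod.ext rfl (ContinuousMap.ext fun x => (altForm_eq_zero le_rfl _).trans
      (altForm_eq_zero le_rfl _).symm)
  · rw [map_add, hF.r_d hc.le 0 Φ hΦ, hΦφ, ctFES_d, hφh]
    have h1 : ((h c hc).1, 0) = h c hc := Prod.ext rfl (hh2 c hc).symm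
    refine (congr_arg _ h1).trans ?_
    simp only [h]
    exact add_sub_cancel _ _

/-- Extension of `1`-forms from the boundary of the triangle. -/
lemma exists_extension_one (hp : 3 ≤ p) (hv : AffineIndependent ℝ v)
    (hW : W ∈ interior (convexHull ℝ (range v)))
    (f : ∀ c' : TriCell, c' < triTop → FormPair v c' 1)
    (hf : (ctFES p v W).IsBoundaryFamily triTop 1 f) :
    ∃ u ∈ ctSpace p v W triTop 1, ∀ c (h : c < triTop), (ctFES p v W).r h.le 1 u = f c h := by
  have hF := isFES_ctFES (p := p) hv hW
  obtain ⟨w₀, hw₀, hw₀f⟩ := exists_extension_of_ne_one hp hv hW (k := 2) (by decide)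
    (fun c hc => (ctFES p v W).d c 1 (f c hc))
    ⟨fun c hc => hF.d_mem c 1 _ (hf.1 c hc), fun c' c h' hc => by
      rw [hF.r_d h' 1 _ (hf.1 c hc), ← hf.2 c' c h' hc]⟩
  obtain ⟨b, hb, hb0, hbI⟩ := exists_hat hp hv hW
  set I : ℝ := cellIntegral v (edgeCell 0 1) rfl (f _ (edgeCell_lt (by decide))).1 -
      cellIntegral v (edgeCell 0 2) rfl (f _ (edgeCell_lt (by decide))).1 +
      cellIntegral v (edgeCell 1 2) rfl (f _ (edgeCell_lt (by decide))).1 with hI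
  -- A multiple of the hat form adjusts the integral to the circulation of the data without changing
  -- the boundary values.
  set t : ℝ := (I - cellIntegral v triTop card_triTop w₀.1) /
    cellIntegral v triTop card_triTop b.1 with ht
  obtain ⟨u, hu, -, huf⟩ := exists_extension_one_of_d hp hv hW hf (w := w₀ + t • b)
    (Submodule.add_mem _ hw₀ (Submodule.smul_mem _ t hb))
    (fun c hc => by rw [map_add, map_smul, hb0 c hc, smul_zero, add_zero, hw₀f]) (by
      rw [← hI]
      change cellIntegral v triTop card_triTop (w₀.1 + t • b.1) = I
      rw [cellIntegral_add, cellIntegral_smul, ht, div_mul_cancel₀ _ hbI]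
      ring)
  exact ⟨u, hu, huf⟩

/-- The Clough-Tocher system admits extensions on the triangle. -/
theorem admitsExtensionsOn_triTop (hp : 3 ≤ p) (hv : AffineIndependent ℝ v)
    (hW : W ∈ interior (convexHull ℝ (range v))) : (ctFES p v W).AdmitsExtensionsOn triTop := by
  intro k f hf
  obtain rfl | hk := eq_or_ne k 1
  · exact exists_extension_one hp hv hW f hf
  · exact exists_extension_of_ne_one hp hv hW hk f hf

/-- Extension of `1`-forms from a vertex to an edge. -/
lemma exists_extension_vertex_edge_one (hp : 3 ≤ p) (hv : AffineIndependent ℝ v)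
    {c c' : TriCell} (hcard : c.1.card = 1 + 1) {i : Fin 3} (hc : c'.1 = {i}) (hcc : c' ≤ c)
    (e : FormPair v c' 1) : ∃ u ∈ ctSpace p v W c 1, (ctFES p v W).r hcc 1 u = e ∧
      ∀ x hx, bary hv i x = 0 → u.1 ⟨x, hx⟩ = 0 ∧ u.2 ⟨x, hx⟩ = 0 := by
  have hne : c ≠ triTop := by rintro rfl; simp [triTop] at hcard
  have hi : v i ∈ cellSet v c' := vertex_mem_cellSet (by simp [hc])
  have h1 : ∀ (q k : ℕ) (a : AltForm k), IsPolyForm (q + 1) fun x => bary hv i x • a :=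
    fun q k a => ((IsPolyForm.smul (isPolyFun_bary hv i) (IsPolyForm.const 0 a))).mono (by omega)
  let u : FormPair v c 1 :=
    (⟨fun x => bary hv i x • e.1 ⟨v i, hi⟩,
      ((h1 0 1 _).contDiff.continuous).comp continuous_subtype_val⟩,
     ⟨fun x => bary hv i x • e.2 ⟨v i, hi⟩,
      ((h1 0 2 _).contDiff.continuous).comp continuous_subtype_val⟩)
  refine ⟨u, mem_ctSpace_of_ne hne (isAdmissible_of_le v c hcard.le u)
    ((h1 0 1 (e.1 ⟨v i, hi⟩)).mono (by omega)) ((h1 0 2 (e.2 ⟨v i, hi⟩)).mono (by omega))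
    (fun _ _ => rfl) (fun _ _ => rfl), formPair_ext (fun x hx => ?_) (fun x hx => ?_),
    fun x hx hxi => ⟨?_, ?_⟩⟩
  · obtain rfl : x = v i := by rwa [cellSet_singleton hc] at hx
    change bary hv i (v i) • e.1 ⟨v i, hi⟩ = e.1 ⟨v i, hi⟩
    rw [bary_vertex, if_pos rfl, one_smul]
  · obtain rfl : x = v i := by rwa [cellSet_singleton hc] at hx
    change bary hv i (v i) • e.2 ⟨v i, hi⟩ = e.2 ⟨v i, hi⟩
    rw [bary_vertex, if_pos rfl, one_smul]
  · change bary hv i x • e.1 ⟨v i, hi⟩ = 0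
    rw [hxi, zero_smul]
  · change bary hv i x • e.2 ⟨v i, hi⟩ = 0
    rw [hxi, zero_smul]

/-- The Clough-Tocher system admits extensions on each cell. -/
theorem admitsExtensionsOn_ctFES (hp : 3 ≤ p) (hv : AffineIndependent ℝ v)
    (hW : W ∈ interior (convexHull ℝ (range v))) (c : TriCell) :
    (ctFES p v W).AdmitsExtensionsOn c := by
  have hF := isFES_ctFES (p := p) hv hW
  have hle : c.1.card ≤ 3 := c.1.card_le_univ
  have h0 := c.2.card_pos
  intro k f hf
  obtain h1 | h1 | h1 : c.1.card = 1 ∨ c.1.card = 1 + 1 ∨ c.1.card = 2 + 1 := by omega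
  · refine ⟨0, Submodule.zero_mem _, fun c' h => ?_⟩
    have h2 : c'.1.card < c.1.card := strictMono_card h
    have h3 := c'.2.card_pos
    omega
  · refine FESData.admitsExtensionsOn_of_step hF _ strictMono_card (fun c' h e he => ?_) f hf
    have h2 : c'.1.card < c.1.card := strictMono_card h
    have h3 := c'.2.card_pos
    obtain ⟨i, hi⟩ := Finset.card_eq_one.1 (show c'.1.card = 1 by omega)
    have hl : ∀ c'' : TriCell, c'' ≠ c' → c''.1.card ≤ c'.1.card → i ∉ c''.1 := by
      intro c'' hne hcard
      obtain ⟨l, hl, hl'⟩ := exists_mem_notMem hne hcard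
      rw [hi, Finset.mem_singleton] at hl
      rwa [← hl]
    obtain rfl | hk := eq_or_ne k 1
    -- In degree one all pairs on an edge are admissible and an explicit extension is enough; in the
    -- other degrees the extension to the triangle is restricted to the edge.
    · obtain ⟨u, hu, hue, hu0⟩ := exists_extension_vertex_edge_one (W := W) hp hv h1 hi h.le e
      refine ⟨u, hu, hue, fun c'' h'' hne hcard => ?_⟩
      have h4 := fun x hx => ((mem_cellSet_iff hv c'' x).1 hx).2 i (hl c'' hne hcard)
      exact formPair_ext (fun x hx => (hu0 x (cellSet_mono v h''.le hx) (h4 x hx)).1)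
        fun x hx => (hu0 x (cellSet_mono v h''.le hx) (h4 x hx)).2
    · obtain ⟨u, hu, hue, hu0⟩ := exists_extension_vertex (W := W) hp hv hW
        (show c'.1.card = 1 by omega) hk e
      refine ⟨(ctFES p v W).r c.le_triTop k u, hF.r_mem _ _ _ hu, ?_, fun c'' h'' hne hcard => ?_⟩
      · rw [← hue]
        rfl
      · have := r_eq_zero_of_bary (p := p) (W := W) (u := u) hv (hl c'' hne hcard)
          (hu0 i (by simp [hi]))
        exact this
  · obtain rfl := eq_triTop_of_card h1
    exact admitsExtensionsOn_triTop hp hv hW k f hf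

/-- The Clough-Tocher system is a compatible finite element system. -/
theorem isCompatible_ctFES (hp : 3 ≤ p) (hv : AffineIndependent ℝ v)
    (hW : W ∈ interior (convexHull ℝ (range v))) : (ctFES p v W).IsCompatible where
  isFES := isFES_ctFES hv hW
  extensions := admitsExtensionsOn_ctFES hp hv hW
  exact := isExactOn_ctFES (by omega) hv hW

end Compatible

/-! ### Finite dimension and exactness of the bubble sequences -/

section ExactBubbles

open Set MeasureTheory

variable {p : ℕ} {v : Fin 3 → Plane} {W : Plane}

lemma finite_cellPieces (v : Fin 3 → Plane) (W : Plane) (c : TriCell) :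
    (cellPieces v W c).Finite := by
  unfold cellPieces
  split_ifs
  · exact finite_range _
  · exact finite_singleton _

lemma exists_mem_cellPieces (hv : AffineIndependent ℝ v)
    (hW : W ∈ interior (convexHull ℝ (range v))) {c : TriCell} {x : Plane} (hx : x ∈ cellSet v c) :
    ∃ K ∈ cellPieces v W c, x ∈ K := by
  by_cases hc : c = triTop
  · subst hc
    obtain ⟨i, hi⟩ := mem_iUnion.1 (cellSet_subset_iUnion_piece hv hW hx)
    exact ⟨_, by rw [cellPieces_triTop]; exact ⟨i, rfl⟩, hi⟩
  · exact ⟨cellSet v c, by rw [cellPieces, if_neg hc]; rfl, hx⟩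

/-- Choosing one piece for each point, a piecewise polynomial form is determined by finitely many
polynomials of bounded degree. -/
lemma finite_polyForms (hv : AffineIndependent ℝ v)
    (hW : W ∈ interior (convexHull ℝ (range v))) (c : TriCell) (q k : ℕ) :
    Module.Finite ℝ (polyForms v W c q k) := by
  have := (finite_cellPieces v W c).to_subtype
  choose idx hidx hidx' using fun x : cellSet v c => exists_mem_cellPieces hv hW x.2
  let Ψ : (cellPieces v W c → (Fin k → Fin 2) → MvPolynomial.restrictTotalDegree (Fin 2) ℝ q) →ₗ[ℝ]
      (cellSet v c → AltForm k) :=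
    { toFun := fun P x => altOfCoord k fun f =>
        MvPolynomial.eval (fun i => (x : Plane) i) (P ⟨idx x, hidx x⟩ f : MvPolynomial (Fin 2) ℝ)
      map_add' := fun P Q => by
        ext1 x
        refine Eq.trans (congr_arg _ ?_) (map_add (altOfCoord k) _ _)
        ext f
        simp
      map_smul' := fun a P => by
        ext1 x
        refine Eq.trans (congr_arg _ ?_) (map_smul (altOfCoord k) a _)
        ext f
        simp [MvPolynomial.smul_eval] }
  let J : polyForms v W c q k →ₗ[ℝ] (cellSet v c → AltForm k) :=
    { toFun := fun u => ⇑u.1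
      map_add' := fun _ _ => rfl
      map_smul' := fun _ _ => rfl }
  have hJ : ∀ u, J u ∈ LinearMap.range Ψ := by
    intro u
    choose P hP hu using fun (K : cellPieces v W c) (f : Fin k → Fin 2) =>
      u.2 K.1 K.2 fun j => EuclideanSpace.single (f j) 1
    refine ⟨fun K f => ⟨P K f, (MvPolynomial.mem_restrictTotalDegree _ _ _).2 (hP K f)⟩, ?_⟩
    ext1 x
    change altOfCoord k _ = u.1 x
    rw [← altOfCoord_altCoord (u.1 x)]
    congr 1
    ext f
    refine (hu ⟨idx x, hidx x⟩ f x (hidx' x)).symm.trans ?_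
    rw [extZero_apply _ x.2]
    rfl
  refine Module.Finite.of_injective (J.codRestrict (LinearMap.range Ψ) hJ) fun u w h => ?_
  exact Subtype.ext (DFunLike.coe_injective (congr_arg Subtype.val h))

lemma finite_A₀_ctFES (hv : AffineIndependent ℝ v)
    (hW : W ∈ interior (convexHull ℝ (range v))) (c : TriCell) (k : ℕ) :
    Module.Finite ℝ ((ctFES p v W).A₀ c k) := by
  have h1 := Module.Finite.iff_fg.1 (finite_polyForms hv hW c (p - k) k)
  have h2 := Module.Finite.iff_fg.1 (finite_polyForms hv hW c (p - (k + 1)) (k + 1))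
  have h3 := Module.Finite.iff_fg.2 (h1.prod h2)
  exact Submodule.finiteDimensional_of_le (inf_le_left.trans inf_le_right)

/-- Closed forms of degree at least the dimension, other than the dimension, are exact. -/
lemma mem_dA₀_of_card_le {c : TriCell} {k : ℕ} (hk : c.1.card ≤ k + 1) {u : FormPair v c (k + 1)}
    (hu : u ∈ (ctFES p v W).A₀ c (k + 1)) (hdu : (ctFES p v W).d c (k + 1) u = 0) :
    u ∈ (ctFES p v W).dA₀ c (k + 1) := by
  rw [FESData.mem_A₀] at hu
  refine ⟨(0, u.1), FESData.mem_A₀.2 ⟨mem_ctSpace_zero_prod hk hu.1, fun c' h => ?_⟩, ?_⟩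
  · exact Prod.ext rfl (congr_arg Prod.fst (hu.2 c' h))
  · exact Prod.ext rfl (congr_arg Prod.fst hdu).symm

lemma eq_zero_of_snd_eq_zero (hv : AffineIndependent ℝ v)
    (hW : W ∈ interior (convexHull ℝ (range v))) {c : TriCell} {z : FormPair v c 0}
    (hz : z ∈ ctSpace p v W c 0) (h : z.2 = 0) {x : Plane}
    (hx : x ∈ cellSet v c) (hxx : z.1 ⟨x, hx⟩ ![] = 0) : z = 0 :=
  eq_of_snd_eq hv hW hz (Submodule.zero_mem _) h hx hxx

/-- A `1`-form vanishing on the boundary is exact if it has a potential vanishing at vertices. -/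
lemma mem_dA₀_of_potential (hv : AffineIndependent ℝ v)
    (hW : W ∈ interior (convexHull ℝ (range v))) {c : TriCell} {u : FormPair v c 1}
    (hu : u ∈ (ctFES p v W).A₀ c 1) (hdu : u.2 = 0) {w : FormPair v c 0}
    (hw : w ∈ ctSpace p v W c 0) (hwu : w.2 = u.1)
    (h0 : ∀ l (hl : l ∈ c.1), w.1 ⟨v l, vertex_mem_cellSet hl⟩ ![] = 0) :
    u ∈ (ctFES p v W).dA₀ c 1 := by
  rw [FESData.mem_A₀] at hu
  refine ⟨w, FESData.mem_A₀.2 ⟨hw, fun c' h => ?_⟩, Prod.ext hwu hdu.symm⟩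
  -- On a strict subcell the trace of `w` has zero differential and vanishes at a vertex, hence is
  -- zero.
  obtain ⟨l, hl⟩ := c'.2
  refine eq_zero_of_snd_eq_zero hv hW ((isFES_ctFES hv hW).r_mem h.le 0 w hw) ?_
    (vertex_mem_cellSet hl) (h0 l (h.le hl))
  rw [ctFES_r]
  simp only
  rw [hwu]
  exact congr_arg Prod.fst (hu.2 c' h)

/-- The potential has zero differential along the edges, hence the same value at all vertices, and a
constant can be subtracted. -/
lemma mem_dA₀_triTop_one (hp : 1 ≤ p) (hv : AffineIndependent ℝ v)
    (hW : W ∈ interior (convexHull ℝ (range v))) {u : FormPair v triTop 1}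
    (hu : u ∈ (ctFES p v W).A₀ triTop 1) (hdu : u.2 = 0) : u ∈ (ctFES p v W).dA₀ triTop 1 := by
  have hu' := FESData.mem_A₀.1 hu
  have hF := isFES_ctFES (p := p) hv hW
  obtain ⟨w, hw, hwu⟩ := exists_d_eq_triTop_one hp hv hW hu'.1 hdu
  have hm : ∀ l : Fin 3, v l ∈ cellSet v triTop := fun l => vertex_mem_cellSet (Finset.mem_univ l)
  have hconst : ∀ l : Fin 3, w.1 ⟨v l, hm l⟩ = w.1 ⟨v 0, hm 0⟩ := by
    intro l
    -- For `l = 0` this cell is the vertex `0` itself, so the three vertices are treated at once.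
    have hlt : edgeCell 0 l < triTop := by
      refine lt_of_le_of_ne (TriCell.le_triTop _) fun he => ?_
      have h1 := congr_arg (fun c : TriCell => c.1.card) he
      have h2 : (edgeCell 0 l).1.card ≤ 2 := Finset.card_le_two
      simp only [triTop, Finset.card_univ, Fintype.card_fin] at h1
      omega
    have h2 : ((ctFES p v W).r hlt.le 0 w).2 = 0 := by
      rw [ctFES_r]
      simp only
      rw [hwu]
      exact congr_arg Prod.fst (hu'.2 _ hlt)
    exact eq_of_snd_eq_zero hv hW (hF.r_mem hlt.le 0 w hw) h2
      (vertex_mem_cellSet (by simp [edgeCell])) (vertex_mem_cellSet (by simp [edgeCell]))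
  refine mem_dA₀_of_potential hv hW hu hdu
    (w := w + (ctFES p v W).const triTop (-w.1 ⟨v 0, hm 0⟩ ![]))
    (Submodule.add_mem _ hw (hF.const_mem _ _)) ((add_zero _).trans hwu) fun l hl => ?_
  change w.1 ⟨v l, hm l⟩ ![] + -w.1 ⟨v 0, hm 0⟩ ![] = 0
  rw [hconst l, add_neg_cancel]

/-- A zero integral allows a potential with value zero at both ends. -/
lemma mem_dA₀_edge_one (hp : 1 ≤ p) (hv : AffineIndependent ℝ v)
    (hW : W ∈ interior (convexHull ℝ (range v))) {c : TriCell} (hcard : c.1.card = 1 + 1)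
    {u : FormPair v c 1} (hu : u ∈ (ctFES p v W).A₀ c 1) (hdu : u.2 = 0)
    (hint : cellIntegral v c hcard u.1 = 0) : u ∈ (ctFES p v W).dA₀ c 1 := by
  have hc : c < triTop := by
    refine lt_of_le_of_ne (TriCell.le_triTop _) ?_
    rintro rfl
    simp [triTop] at hcard
  obtain ⟨w, hw, hwu, h0⟩ := exists_potential hp hv hW hc (FESData.mem_A₀.1 hu).1 (a := 0)
    fun _ i j _ _ => by simpa using hint
  exact mem_dA₀_of_potential hv hW hu hdu hw hwu h0

/-- This is the extension of the zero `1`-form on the boundary with prescribed differential `u`;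
zero integral is precisely the compatibility condition. -/
lemma mem_dA₀_triTop_two (hp : 3 ≤ p) (hv : AffineIndependent ℝ v)
    (hW : W ∈ interior (convexHull ℝ (range v))) {u : FormPair v triTop 2}
    (hu : u ∈ (ctFES p v W).A₀ triTop 2) (hint : cellIntegral v triTop card_triTop u.1 = 0) :
    u ∈ (ctFES p v W).dA₀ triTop 2 := by
  rw [FESData.mem_A₀] at hu
  have h0 : ∀ (c : TriCell) (h : c.1.card = 1 + 1), cellIntegral v c h 0 = 0 := fun c h => by
    simp [cellIntegral, extZero_zero]
  obtain ⟨w, hw, hwu, hwr⟩ := exists_extension_one_of_d hp hv hW (f := fun _ _ => 0)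
    ⟨fun _ _ => Submodule.zero_mem _, fun _ _ _ _ => (map_zero _).symm⟩ hu.1
    (fun c h => (hu.2 c h).trans (map_zero _).symm) 
    (hint.trans ((congr_arg₂ (· + ·) (congr_arg₂ (· - ·) (h0 _ _) (h0 _ _)) (h0 _ _)).trans
      (by simp)).symm)
  exact ⟨w, FESData.mem_A₀.2 ⟨hw, hwr⟩, hwu⟩

/-- A form on an edge, vanishing at the vertices, with nonzero integral. -/
lemma exists_edge_hat (hp : 3 ≤ p) (hv : AffineIndependent ℝ v) {c : TriCell}
    (hcard : c.1.card = 1 + 1) : ∃ u ∈ (ctFES p v W).A₀ c 1, u.2 = 0 ∧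
      cellIntegral v c hcard u.1 ≠ 0 := by
  have hne : c ≠ triTop := by rintro rfl; simp [triTop] at hcard
  obtain ⟨i, j, hij, hc⟩ : ∃ i j : Fin 3, i < j ∧ c.1 = {i, j} := by
    rcases exists_pair_of_card hcard with h | h | h
    exacts [⟨0, 1, by decide, h⟩, ⟨0, 2, by decide, h⟩, ⟨1, 2, by decide, h⟩]
  have hb := isPolyFun_bary hv j
  -- The cubic step `3 λ² - 2 λ³` rises from `0` to `1` and its derivative `6 λ (1 - λ)` vanishes at
  -- both ends; the integral of the latter is therefore one.
  let φ : Plane → ℝ := fun x => 3 * bary hv j x ^ 2 - 2 * bary hv j x ^ 3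
  have hφ : IsPolyFun 3 φ := (((hb.pow 2).const_mul 3).mono (by norm_num)).sub
    (((hb.pow 3).const_mul 2).mono (by norm_num))
  have hφ' : ∀ x, HasFDerivAt φ ((6 * bary hv j x * (1 - bary hv j x)) • baryGrad hv j) x := by
    intro x
    have h := hasFDerivAt_bary hv j x
    refine (((h.pow 2).const_mul 3).sub ((h.pow 3).const_mul 2)).congr_fderiv ?_
    ext ξ
    simp
    ring
  have hg : IsPolyForm 2 fun x => (6 * bary hv j x * (1 - bary hv j x)) • form1 (baryGrad hv j) :=
    (IsPolyForm.smul ((hb.const_mul 6).mul ((IsPolyFun.const 1 1).sub hb)) (IsPolyForm.const 0 _))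
  let u : FormPair v c 1 := (⟨fun x => _, hg.contDiff.continuous.comp continuous_subtype_val⟩, 0)
  let w : FormPair v c 0 :=
    (⟨fun x => form0 φ x, hφ.form0.contDiff.continuous.comp continuous_subtype_val⟩, u.1)
  have hw : IsAdmissible v c 0 w := by
    refine (isAdmissible_edge_iff hij.ne hc w hφ.form0.contDiff fun x hx => rfl).2 fun x hx => ?_
    rw [(hφ' x).fderiv]
    rfl
  refine ⟨u, FESData.mem_A₀.2 ⟨mem_ctSpace_of_ne hne (isAdmissible_of_le v c hcard.le u)
    (hg.mono (by omega)) (IsPolyForm.zero _ _) (fun _ _ => rfl) (fun _ _ => rfl), fun c' h => ?_⟩,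
    rfl, ?_⟩
  · have h1 : c'.1.card < c.1.card := strictMono_card h
    have h2 := c'.2.card_pos
    obtain ⟨l, hl⟩ := Finset.card_eq_one.1 (show c'.1.card = 1 by omega)
    have hlc : l ∈ c.1 := h.le (by simp [hl])
    refine formPair_ext (fun x hx => ?_) fun x hx => rfl
    obtain rfl : x = v l := by rwa [cellSet_singleton hl] at hx
    change (6 * bary hv j (v l) * (1 - bary hv j (v l))) • form1 (baryGrad hv j) = 0
    rw [bary_vertex]
    split_ifs <;> simp
  · rw [show u.1 = w.2 from rfl, cellIntegral_d_edge v hcard hij hc hw,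
      extZero_apply _ (vertex_mem_cellSet (by simp [hc])),
      extZero_apply _ (vertex_mem_cellSet (by simp [hc]))]
    change φ (v j) - φ (v i) ≠ 0
    simp only [φ, bary_vertex, if_neg hij.ne', if_true]
    norm_num

/-- The sequences of bubbles of the Clough-Tocher system are exact. -/
theorem hasExactBubbles_ctFES (hp : 3 ≤ p) (hv : AffineIndependent ℝ v)
    (hW : W ∈ interior (convexHull ℝ (range v))) : (ctFES p v W).HasExactBubbles where
  finite := finite_A₀_ctFES hv hW
  exact_of_ne c k hne u hu hdu := by
    have h3 : c.1.card ≤ 3 := c.1.card_le_univ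
    have h0 := c.2.card_pos
    replace hne : c.1.card - 1 ≠ k := hne
    cases k with
    | zero =>
      obtain ⟨l, hl⟩ := c.2
      have hlt : (⟨{l}, by simp⟩ : TriCell) < c := by
        refine lt_of_le_of_ne (Finset.singleton_subset_iff.2 hl) ?_
        rintro rfl
        simp at hne
      rw [FESData.mem_A₀] at hu
      -- In degree zero `dA₀` is zero by convention; a closed `0`-form is constant, and here it
      -- vanishes at a vertex, which is a strict subcell.
      refine (Submodule.mem_bot ℝ).2 (eq_zero_of_snd_eq_zero hv hW hu.1 (congr_arg Prod.fst hdu)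
        (vertex_mem_cellSet hl) ?_)
      have h1 : traceForm v hlt.le 0 u.1 = 0 := congr_arg Prod.fst (hu.2 _ hlt)
      rw [← traceForm_apply hlt.le 0 u.1 _ (vertex_mem_cellSet (by simp)), h1]
      rfl
    | succ k =>
      by_cases hk : c.1.card ≤ k + 1
      · exact mem_dA₀_of_card_le hk hu hdu
      · obtain rfl : k = 0 := by omega
        obtain rfl := eq_triTop_of_card (c := c) (by omega)
        exact mem_dA₀_triTop_one (by omega) hv hW hu (congr_arg Prod.fst hdu)
  exact_of_eq c k h u hu hdu hev := by
    have h3 : c.1.card ≤ 3 := c.1.card_le_univ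
    have h0 := c.2.card_pos
    have h' : c.1.card - 1 = k := h
    obtain rfl | rfl | rfl : k = 0 ∨ k = 1 ∨ k = 2 := by omega
    · obtain ⟨i, hi⟩ := Finset.card_eq_one.1 (show c.1.card = 1 by omega)
      have hi' : v i ∈ cellSet v c := vertex_mem_cellSet (by simp [hi])
      refine (Submodule.mem_bot ℝ).2 (eq_zero_of_snd_eq_zero hv hW (FESData.mem_A₀.1 hu).1
        (congr_arg Prod.fst hdu) hi' ?_)
      rw [← extZero_apply u.1 hi', ← cellIntegral_vertex v (by omega) hi]
      exact hev
    · exact mem_dA₀_edge_one (by omega) hv hW (by omega) hu (congr_arg Prod.fst hdu) hev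
    · obtain rfl := eq_triTop_of_card (c := c) (by omega)
      exact mem_dA₀_triTop_two hp hv hW hu hev
  exists_ev_ne c k h := by
    have h3 : c.1.card ≤ 3 := c.1.card_le_univ
    have h0 := c.2.card_pos
    have h' : c.1.card - 1 = k := h
    obtain rfl | rfl | rfl : k = 0 ∨ k = 1 ∨ k = 2 := by omega
    · obtain ⟨i, hi⟩ := Finset.card_eq_one.1 (show c.1.card = 1 by omega)
      have hi' : v i ∈ cellSet v c := vertex_mem_cellSet (by simp [hi])
      refine ⟨(ctFES p v W).const c 1, FESData.mem_A₀.2 ⟨(isFES_ctFES hv hW).const_mem c 1,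
        fun c' hc' => ?_⟩, rfl, ?_⟩
      · have h1 : c'.1.card < c.1.card := strictMono_card hc'
        have h2 := c'.2.card_pos
        omega
      · have h1 : (ctFES p v W).ev c 0 h ((ctFES p v W).const c 1) = 1 :=
          (cellIntegral_vertex v (by omega) hi _).trans (extZero_apply _ hi' ▸ rfl)
        rw [h1]
        exact one_ne_zero
    · obtain ⟨u, hu, hdu, hI⟩ := exists_edge_hat (W := W) hp hv (c := c) (by omega)
      exact ⟨u, hu, Prod.ext hdu rfl, hI⟩
    · obtain rfl := eq_triTop_of_card (c := c) (by omega)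
      obtain ⟨u, hu, hur, hI⟩ := exists_hat hp hv hW
      exact ⟨u, FESData.mem_A₀.2 ⟨hu, hur⟩, formPair_eq_zero le_rfl _, hI⟩

end ExactBubbles

/-! ### Unisolvence and the harmonic interpolator on the triangle -/

section Interpolator

variable {p : ℕ} {v : Fin 3 → Plane} {W : Plane}
  {B : ∀ c k, FormPair v c k →ₗ[ℝ] FormPair v c k →ₗ[ℝ] ℝ}

/-- Elements of the system are double-traces of forms on the triangle. -/
lemma IsTraceScalarProduct.pos_of_mem (hB : IsTraceScalarProduct p v W B)
    (hS : (ctFES p v W).IsCompatible) (c : TriCell) (k : ℕ) (x : FormPair v c k)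
    (hx : x ∈ (ctFES p v W).A c k) (hne : x ≠ 0) : 0 < B c k x x := by
  obtain ⟨w, hw, hwx⟩ := FESData.exists_extension hS.isFES TriCell.le_triTop hS.extensions c k hx
  exact hB.pos c k x ⟨w, hw.1, hwx⟩ hne

variable (p W B) in
/-- Evaluation of the harmonic degrees of freedom on all cells. -/
noncomputable def dofMap (k : ℕ) : FormPair v triTop k →ₗ[ℝ]
    ∀ c : TriCell, Module.Dual ℝ ((ctFES p v W).harmonicDoF B c k) :=
  LinearMap.pi fun c =>
    ((ctFES p v W).harmonicDoF B c k).subtype.flip ∘ₗ (ctFES p v W).r c.le_triTop k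

lemma dofMap_eq_iff {k : ℕ} {x y : FormPair v triTop k} :
    dofMap p W B k x = dofMap p W B k y ↔ ∀ c, ∀ l ∈ (ctFES p v W).harmonicDoF B c k,
      l ((ctFES p v W).r c.le_triTop k x) = l ((ctFES p v W).r c.le_triTop k y) := by
  refine ⟨fun h c l hl => ?_, fun h => funext fun c => LinearMap.ext fun l => h c l l.2⟩
  exact LinearMap.congr_fun (congr_fun h c) ⟨l, hl⟩

lemma bijective_dofMap (hp : 3 ≤ p) (hv : AffineIndependent ℝ v)
    (hW : W ∈ interior (convexHull ℝ (Set.range v))) (hB : IsTraceScalarProduct p v W B) (k : ℕ) :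
    Function.Bijective (dofMap p W B k ∘ₗ ((ctFES p v W).A triTop k).subtype) := by
  have hS := isCompatible_ctFES hp hv hW
  rw [Function.bijective_iff_existsUnique]
  intro ψ
  obtain ⟨u, ⟨hu, huψ⟩, huniq⟩ := FESData.existsUnique_of_dual hS (hasExactBubbles_ctFES hp hv hW)
    (hB.pos_of_mem hS) triTop k ψ
  refine ⟨⟨u, hu⟩, funext fun c => LinearMap.ext fun l => huψ c c.le_triTop l, fun w hw => ?_⟩
  refine Subtype.ext (huniq w ⟨w.2, fun c hc l => ?_⟩)
  exact LinearMap.congr_fun (congr_fun hw c) l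

/-- The harmonic degrees of freedom of the differential only depend on those of the form. -/
lemma dofMap_d_eq (hp : 3 ≤ p) (hv : AffineIndependent ℝ v)
    (hW : W ∈ interior (convexHull ℝ (Set.range v))) {k : ℕ} {x y : FormPair v triTop k}
    (hx : x ∈ CdForms v k) (hy : y ∈ CdForms v k) (h : dofMap p W B k x = dofMap p W B k y) :
    dofMap p W B (k + 1) ((ctFES p v W).d triTop k x) =
      dofMap p W B (k + 1) ((ctFES p v W).d triTop k y) := by
  rw [dofMap_eq_iff] at h ⊢
  intro c l hl
  rw [← sub_eq_zero, ← map_sub, ← map_sub, ← map_sub]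
  -- The difference is only a general admissible pair, not an element of the system; this is why
  -- traces and Stokes' formula are needed for all continuous forms with continuous differential.
  have hxy : IsAdmissible v triTop k (x - y) := Submodule.sub_mem _ hx hy
  refine FESData.harmonicDoF_d_eq_zero (B := B) (hasExactBubbles_ctFES hp hv hW) TriCell.le_triTop
    (fun c => rfl) (fun c => rfl) (fun c hc => ?_) (fun c l hl => ?_) c l hl
  · have hadm : IsAdmissible v c k ((ctFES p v W).r c.le_triTop k (x - y)) :=
      isAdmissible_trace v c.le_triTop k hxy
    convert ctFES_stokes p v W c k hc hadm
    rfl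
  · rw [map_sub, map_sub, h c l hl, sub_self]

end Interpolator

theorem mainTheorem2 (p : ℕ) (hp : 3 ≤ p) (v : Fin 3 → Plane) (hv : AffineIndependent ℝ v)
    (W : Plane) (hW : W ∈ interior (convexHull ℝ (Set.range v))) :
    (ctFES p v W).AdmitsExtensionsOn triTop ∧
    (ctFES p v W).IsCompatible ∧
    (∀ k, ∀ u ∈ CdForms v k, (ctFES p v W).d triTop k u ∈ CdForms v (k + 1)) ∧
    ∀ B : ∀ c k, FormPair v c k →ₗ[ℝ] FormPair v c k →ₗ[ℝ] ℝ,
      IsTraceScalarProduct p v W B →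
      HarmonicUnisolvent p v W B ∧
      ∃ I : ∀ k, CdForms v k →ₗ[ℝ] (ctFES p v W).A triTop k,
        IsHarmonicInterpolator p v W B I ∧
        (∀ J : ∀ k, CdForms v k →ₗ[ℝ] (ctFES p v W).A triTop k,
          IsHarmonicInterpolator p v W B J → J = I) ∧
        ∀ k (u : CdForms v k)
          (hdu : (ctFES p v W).d triTop k (u : FormPair v triTop k) ∈ CdForms v (k + 1)),
          (I (k + 1) ⟨(ctFES p v W).d triTop k (u : FormPair v triTop k), hdu⟩ :
              FormPair v triTop (k + 1)) =
            (ctFES p v W).d triTop k (I k u : FormPair v triTop k) := by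
  have hS := isCompatible_ctFES hp hv hW
  refine ⟨hS.extensions triTop, hS, fun k u hu => isAdmissible_d v triTop k hu, fun B hB => ?_⟩
  have hbij := bijective_dofMap hp hv hW hB
  -- By unisolvence the interpolator is forced: take the degrees of freedom of the form and invert
  -- the bijection.
  let I : ∀ k, CdForms v k →ₗ[ℝ] (ctFES p v W).A triTop k := fun k =>
    (LinearEquiv.ofBijective _ (hbij k)).symm.toLinearMap ∘ₗ dofMap p W B k ∘ₗ
      (CdForms v k).subtype
  have hI : ∀ k (u : CdForms v k), dofMap p W B k (I k u) = dofMap p W B k u := fun k u =>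
    (LinearEquiv.ofBijective _ (hbij k)).apply_symm_apply _
  refine ⟨hbij, I, fun k u => dofMap_eq_iff.1 (hI k u), fun J hJ => ?_, fun k u hdu => ?_⟩
  · funext k
    refine LinearMap.ext fun u => (hbij k).1 ?_
    exact (dofMap_eq_iff.2 (hJ k u)).trans (hI k u).symm
  -- Both sides lie in `A^{k+1}(T)`, so it is enough to compare degrees of freedom. Those of a
  -- differential depend only on those of the form, and `I k u` shares them with `u`.
  · refine congr_arg Subtype.val ((hbij (k + 1)).1
      (a₂ := ⟨_, hS.isFES.d_mem triTop k (I k u) (I k u).2⟩) ?_)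
    refine (hI (k + 1) ⟨_, hdu⟩).trans ?_
    exact dofMap_d_eq hp hv hW u.2 (I k u).2.1 (hI k u).symm
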